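/- Conventions. $\|\cdot\|$ is the Euclidean norm. A real matrix is Hurwitz if all its complex eigenvalues have negative real part; an eigenvalue is critical if its real part is zero. A pair $(A,b)$, $A\in\mathbb R^{n\times n}$, $b\in\mathbb R^n$, is controllable if $b,Ab,\dots,A^{n-1}b$ span $\mathbb R^n$. A function $w$ on $[0,\infty)$ is eventually bounded by $\delta$ if $\|w(t)\|\le\delta$ for all $t$ large enough. A control system $\dot x=f(x,u)$ is $SISS_L(\Delta,N)$ ($\Delta,N>0$) if, for every $\delta\in(0,\Delta]$ and every bounded measurable $e:[0,\infty)\to\mathbb R^m$ eventually bounded by $\delta$, every solution of $\dot x=f(x,e)$ is defined on $[0,\infty)$ and eventually bounded by $N\delta$. An input-free system $\dot x=g(x)$ is $SISS_L$ if $\dot x=g(x)+u$ is $SISS_L(\Delta,N)$ for some $\Delta,N>0$. A feedback $\nu$ is $SISS_L$-stabilizing for $\dot x=f(x,u)$ if the closed loop $\dot x=f(x,\nu(x))$ has the origin globally asymptotically stable and is $SISS_L$. For $p\in\mathbb N$ and positive reals $(R_j)_{0\le j\le p}$, a feedback $\nu$ is $p$-bounded by $(R_j)$ if it is of class $C^p$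 and, along every trajectory $x(\cdot)$ of the closed loop, $U(t)=\nu(x(t))$, $t\ge0$, satisfies $\sup_{t\ge0}\|U^{(j)}(t)\|\le R_j$ for all $0\le j\le p$; it is $p$-bounded if it is $p$-bounded by some tuple of positive reals. Theorem. Let $p\in\mathbb N$, let $(R_j)_{0\le j\le p}$ be positive reals, let $q\in\mathbb N$, $n_0\in\mathbb N$, $n_1,\dots,n_q\in\mathbb N_{>0}$, and consider the linear system with state $x=(x_0,\dots,x_q)$, $x_i\in\mathbb R^{n_i}$, and input $u=(u_1,\dots,u_q)\in\mathbb R^q$, $$\dot x_0=\sum_{j=0}^{q}A_{0j}x_j+\sum_{j=1}^{q}b_{0j}u_j,\qquad \dot x_i=\sum_{j=i}^{q}A_{ij}x_j+\sum_{j=i}^{q}b_{ij}u_j\quad(1\le i\le q),$$ in reduced controllability form: $A_{00}$ is Hurwitz and, for every $1\le i\le q$, all eigenvalues of $A_{ii}$ are critical and $(A_{ii},b_{ii})$ is controllable. Then there exist functions $\kappa_i:\mathbb R^{n_i}\to\mathbb R$, $1\le i\le q$, such that (i) for every $1\le i\le q$, $\kappa_i$ is a $p$-bounded and $SISS_L$-stabilizing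 feedback for $\dot x_i=A_{ii}x_i+b_{ii}u_i$; (ii) the feedback $\mu=(\mu_1,\dots,\mu_q)$ given by $$\mu_i(x)=\frac{\kappa_i(x_i)}{(1+\|x_{i+1}\|^2+\dots+\|x_q\|^2)^{p+1}}\quad(1\le i\le q-1),\qquad \mu_q(x)=\kappa_q(x_q),$$ is $p$-bounded by $(R_j)_{0\le j\le p}$ and $SISS_L$-stabilizing for the whole system. -/

import Mathlib

open MeasureTheory Filter Topology Set

noncomputable section

section General

variable {E V : Type*} [NormedAddCommGroup E] [NormedSpace ℝ E]
  [NormedAddCommGroup V] [NormedSpace ℝ V]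

/-- Caratheodory solutions on an interval `I` (either `[0, T)` or `[0, ∞)`) of the differential
equation `x' = F t x`, in integral form. Equivalently: `x` is locally absolutely continuous on `I`
and `x' t = F t (x t)` for almost every `t ∈ I`; if `F` is continuous these are the classical
`C¹` solutions. Values of `x` outside `I` play no role. -/
def IsSolutionOn (F : ℝ → E → E) (I : Set ℝ) (x : ℝ → E) : Prop :=
  ∀ t ∈ I, IntervalIntegrable (fun s => F s (x s)) volume 0 t ∧
    x t = x 0 + ∫ s in (0 : ℝ)..t, F s (x s)

/-- Solutions on `[0, ∞)`. -/
def IsSolution (F : ℝ → E → E) (x : ℝ → E) : Prop :=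
  IsSolutionOn F (Ici 0) x

/-- Every initial condition has a solution on `[0, ∞)`, and no solution is stuck at a finite time:
a solution on `[0, T)` is always the restriction of a solution on `[0, ∞)`. -/
def IsForwardComplete (F : ℝ → E → E) : Prop :=
  (∀ x₀ : E, ∃ x, IsSolution F x ∧ x 0 = x₀) ∧
  ∀ T : ℝ, 0 < T → ∀ x, IsSolutionOn F (Ico 0 T) x →
    ∃ y, IsSolution F y ∧ EqOn y x (Ico 0 T)

/-- `‖w t‖ ≤ δ` for all sufficiently large times. -/
def EventuallyBoundedBy (w : ℝ → E) (δ : ℝ) : Prop :=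
  ∃ T : ℝ, 0 < T ∧ ∀ t, T ≤ t → ‖w t‖ ≤ δ

/-- Bounded (Lebesgue) measurable signals on `[0, ∞)`. -/
def IsBoundedMeasurableSignal (e : ℝ → V) : Prop :=
  AEStronglyMeasurable e (volume.restrict (Ici 0)) ∧ ∃ M : ℝ, ∀ t, 0 ≤ t → ‖e t‖ ≤ M

/-- Small input small state with linear gain, with constants `Δ` and `N`, for the control system
`x' = f x u`: for every bounded measurable `e` eventually bounded by some `δ ∈ (0, Δ]`,
every (maximal) solution of `x' = f x (e t)` is defined for all times `t ≥ 0` and is eventually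
bounded by `N * δ`. -/
def IsSISSLWith (f : E → V → E) (Δ N : ℝ) : Prop :=
  ∀ δ : ℝ, 0 < δ → δ ≤ Δ → ∀ e : ℝ → V, IsBoundedMeasurableSignal e → EventuallyBoundedBy e δ →
    IsForwardComplete (fun t x => f x (e t)) ∧
    ∀ x, IsSolution (fun t x => f x (e t)) x → EventuallyBoundedBy x (N * δ)

/-- A control system is `SISS_L` if it is so for some positive constants. -/
def IsSISSL (f : E → V → E) : Prop :=
  ∃ Δ N : ℝ, 0 < Δ ∧ 0 < N ∧ IsSISSLWith f Δ N

/-- An input-free system `x' = g x` is `SISS_L` if the control system `x' = g x + u` is. -/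
def IsSISSLInputFree (g : E → E) : Prop :=
  IsSISSL (fun x u : E => g x + u)

/-- Global asymptotic stability of the origin for `x' = g x`: forward completeness,
Lyapunov stability, and convergence of all solutions to the origin. -/
def IsGAS (g : E → E) : Prop :=
  IsForwardComplete (fun _ => g) ∧
  (∀ ε : ℝ, 0 < ε → ∃ δ : ℝ, 0 < δ ∧ ∀ x, IsSolution (fun _ => g) x → ‖x 0‖ < δ →
    ∀ t, 0 ≤ t → ‖x t‖ < ε) ∧
  ∀ x, IsSolution (fun _ => g) x → Tendsto x atTop (𝓝 0)

/-- The closed-loop vector field of the control system `x' = f x u` under `u = ν x`. -/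
def closedLoop (f : E → V → E) (ν : E → V) : E → E :=
  fun x => f x (ν x)

/-- The feedback `ν` makes the closed loop both globally asymptotically stable and `SISS_L`. -/
def IsSISSLStabilizing (f : E → V → E) (ν : E → V) : Prop :=
  IsGAS (closedLoop f ν) ∧ IsSISSLInputFree (closedLoop f ν)

/-- `ν` is a feedback law `p`-bounded by `(R_j)_{0 ≤ j ≤ p}` for `x' = f x u`: it is of class `C^p`
and along every closed-loop trajectory the control signal `U t = ν (x t)`, `t ≥ 0`, is `p` times
continuously differentiable with `j`-th derivative bounded by `R j`, `0 ≤ j ≤ p`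
(one-sided derivatives at `t = 0`). -/
def IsPBoundedBy (f : E → V → E) (p : ℕ) (R : Fin (p + 1) → ℝ) (ν : E → V) : Prop :=
  ContDiff ℝ p ν ∧
  ∀ x, IsSolution (fun _ => closedLoop f ν) x →
    ContDiffOn ℝ p (fun t => ν (x t)) (Ici 0) ∧
    ∀ j : Fin (p + 1), ∀ t : ℝ, 0 ≤ t →
      ‖iteratedDerivWithin (j : ℕ) (fun t => ν (x t)) (Ici 0) t‖ ≤ R j

/-- `ν` is a `p`-bounded feedback law: it is `p`-bounded by some tuple of positive numbers. -/
def IsPBounded (f : E → V → E) (p : ℕ) (ν : E → V) : Prop :=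
  ∃ R : Fin (p + 1) → ℝ, (∀ j, 0 < R j) ∧ IsPBoundedBy f p R ν

end General

/-- All complex eigenvalues of the real matrix `A` have negative real part. -/
def IsHurwitz {n : ℕ} (A : Matrix (Fin n) (Fin n) ℝ) : Prop :=
  ∀ z ∈ spectrum ℂ (A.map (algebraMap ℝ ℂ)), z.re < 0

/-- All complex eigenvalues of the real matrix `A` are critical (have zero real part). -/
def HasOnlyCriticalEigenvalues {n : ℕ} (A : Matrix (Fin n) (Fin n) ℝ) : Prop :=
  ∀ z ∈ spectrum ℂ (A.map (algebraMap ℝ ℂ)), z.re = 0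

/-- The pair `(A, b)` is controllable: `b, A b, …, A ^ (n - 1) b` span `ℝⁿ`. -/
def IsControllablePair {n : ℕ} (A : Matrix (Fin n) (Fin n) ℝ) (b : Fin n → ℝ) : Prop :=
  Submodule.span ℝ (range fun k : Fin n => (A ^ (k : ℕ)).mulVec b) = ⊤

/-- The single-input linear system `x' = A x + b u` on Euclidean space. -/
def singleInputSystem {n : ℕ} (A : Matrix (Fin n) (Fin n) ℝ) (b : Fin n → ℝ) :
    EuclideanSpace ℝ (Fin n) → ℝ → EuclideanSpace ℝ (Fin n) :=
  fun x u => WithLp.toLp 2 (A.mulVec x.ofLp + u • b)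

/-- States `x = (x_0, …, x_q)` with `x_i ∈ ℝ^{n_i}`, carrying the Euclidean norm. -/
abbrev BlockState {q : ℕ} (n : Fin (q + 1) → ℕ) : Type :=
  PiLp 2 (fun i : Fin (q + 1) => EuclideanSpace ℝ (Fin (n i)))

/-- The linear system with state blocks `0, …, q` and `q` scalar inputs
`x_i' = ∑ j, A_{ij} x_j + ∑ k, b_{ik} u_k`. The inputs `u_1, …, u_q` are indexed by `k : Fin q`;
the input `k` belongs to the state block `k.succ`. -/
def blockSystem {q : ℕ} {n : Fin (q + 1) → ℕ}
    (A : (i j : Fin (q + 1)) → Matrix (Fin (n i)) (Fin (n j)) ℝ)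
    (b : (i : Fin (q + 1)) → Fin q → Fin (n i) → ℝ) :
    BlockState n → EuclideanSpace ℝ (Fin q) → BlockState n :=
  fun x u => WithLp.toLp 2 fun i =>
    WithLp.toLp 2 (∑ j, (A i j).mulVec (x j).ofLp + ∑ k, u k • b i k)

/-- Reduced controllability form: `A` and `b` are block upper triangular, `A_{00}` is Hurwitz
(its size may be zero), and for `i = 1, …, q` the block `A_{ii}` has positive size and only
critical eigenvalues, and `(A_{ii}, b_{ii})` is controllable. -/
structure IsReducedControllabilityForm {q : ℕ} {n : Fin (q + 1) → ℕ}
    (A : (i j : Fin (q + 1)) → Matrix (Fin (n i)) (Fin (n j)) ℝ)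
    (b : (i : Fin (q + 1)) → Fin q → Fin (n i) → ℝ) : Prop where
  upper_A : ∀ i j, j < i → A i j = 0
  upper_b : ∀ (i : Fin (q + 1)) (k : Fin q), k.succ < i → b i k = 0
  hurwitz : IsHurwitz (A 0 0)
  size_pos : ∀ k : Fin q, 0 < n k.succ
  critical : ∀ k : Fin q, HasOnlyCriticalEigenvalues (A k.succ k.succ)
  controllable : ∀ k : Fin q, IsControllablePair (A k.succ k.succ) (b k.succ k)

/-- The nested feedback
`μ_k x = κ_k (x_k) / (1 + ‖x_{k+1}‖ ^ 2 + ⋯ + ‖x_q‖ ^ 2) ^ (p + 1)`;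
for the last input the sum is empty, so that `μ_q x = κ_q (x_q)`. -/
def nestedFeedback {q : ℕ} {n : Fin (q + 1) → ℕ} (p : ℕ)
    (κ : (k : Fin q) → EuclideanSpace ℝ (Fin (n k.succ)) → ℝ) :
    BlockState n → EuclideanSpace ℝ (Fin q) :=
  fun x => WithLp.toLp 2 fun k =>
    κ k (x k.succ) / (1 + ∑ l ∈ Finset.Ioi k, ‖x l.succ‖ ^ 2) ^ (p + 1)

end

/-!
Why the feedback exists.

*One critical input.* For a critical controllable pair `(A, b)` the feedback is built by induction
on the dimension (`exists_isGoodFeedback`). Over the reals there is an invariant subspace of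
dimension one or two on which `A² = -ω²`; let `κ` be a feedback for the quotient by it, with
linearization `K` at the origin. The induction also provides that the linearized closed loop of the
quotient has no imaginary eigenvalue. Hence `A + b K` has a left eigenvector for `i ω` that is not
zero on the subspace (`exists_functional`), and it gives a coordinate `ξ` in `ℝ` or `ℂ`, complementary
to the quotient state `z`, with `ξ' = i ω ξ + (u - K z)`: to first order `ξ` does not see `z`. The
input is then `κ z` plus the saturated damping
`-l ⟪1, ξ⟫ (1 + ‖ξ‖²)^(-1/2) (1 + ‖z‖²)^(-(p + 1))` with small `l`. A strict Lyapunov function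
shows that the damped oscillator has a linear asymptotic gain (`IsDampedBlock.eventuallyBoundedBy`).
What is left of the coupling, `κ z - K z` and the defect of the weight, is quadratic in `z`, while
`z` is eventually of the order of `l`, so that a small-gain iteration closes the loop
(`IsBlockSplitting.exists_hasSmallGain`). Controllability is used to see that `b` is not annihilated
by the left eigenvector.

*Derivatives.* The derivatives of `κ (x t)` are not estimated along closed-loop trajectories but
along every curve `x' = A x + r`, in terms of the derivatives of `r` of lower order (`HasJetGain`).
Each differentiation costs at most a factor `w (1 + ‖z‖²)^(1/2)`, where `w` bounds `r`; the weight
`(1 + ‖z‖²)^(-(p + 1))` absorbs `p` of these (`IsBlockSplitting.exists_hasJetGain`). As all gains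
can be chosen small, so can the bound for the derivatives. In the whole system the residual `r` of a
block consists of the later blocks and the inputs, and the denominators of the nested feedback absorb
the growth of the later blocks in the same way. The constants that come out depend on the matrices and
on `p` alone, so that the prescribed bounds `R` are met by choosing the jet gain of the single feedbacks
last (`exists_norm_iteratedDerivWithin_cascade_le`, by induction on the order of the derivative).

*Stability.* The asymptotic gain of the whole system is proved block by block, from the last one to
the first (`cascade_smallGain`): the denominators perturb a block only to second order in the size of
the later blocks. For the Hurwitz block it follows from the Cayley-Hamilton theorem
(`IsHurwitz.exists_eventuallyBoundedBy`). Closed loops are globally Lipschitz, so that forward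
completeness is automatic, and `SISS_L` implies global asymptotic stability
(`IsSISSLInputFree.isGAS`).
-/

/-! ### Solutions of globally Lipschitz equations with a bounded disturbance -/

theorem IsBoundedMeasurableSignal.intervalIntegrable {V : Type*} [NormedAddCommGroup V] {e : ℝ → V}
    (he : IsBoundedMeasurableSignal e) {a b : ℝ} (ha : 0 ≤ a) (hb : 0 ≤ b) :
    IntervalIntegrable e volume a b := by
  obtain ⟨hm, M, hM⟩ := he
  have hsub : uIoc a b ⊆ Ici 0 := fun t ht => by
    rw [mem_uIoc] at ht
    rcases ht with h | h
    · exact ha.trans h.1.le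
    · exact hb.trans h.1.le
  refine (intervalIntegrable_const (c := M) (μ := volume)).mono_fun' (hm.mono_set hsub) ?_
  exact (ae_restrict_mem measurableSet_uIoc).mono fun t ht => hM t (hsub ht)

section Solutions

variable {E : Type*} [NormedAddCommGroup E] [NormedSpace ℝ E]

theorem IsSolutionOn.mono {F : ℝ → E → E} {I J : Set ℝ} {x : ℝ → E} (h : IsSolutionOn F I x)
    (hJ : J ⊆ I) : IsSolutionOn F J x := fun t ht => h t (hJ ht)

theorem IsSolutionOn.continuousOn_Icc {F : ℝ → E → E} {T : ℝ} {x : ℝ → E} (hT : 0 ≤ T)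
    (h : IsSolutionOn F (Icc 0 T) x) : ContinuousOn x (Icc 0 T) := by
  have h1 := intervalIntegral.continuousOn_primitive_interval' (h T ⟨hT, le_rfl⟩).1
    (left_mem_uIcc)
  rw [uIcc_of_le hT] at h1
  exact (continuousOn_const.add h1).congr fun t ht => (h t ht).2

theorem IsSolution.continuousOn {F : ℝ → E → E} {x : ℝ → E} (h : IsSolution F x) :
    ContinuousOn x (Ici 0) := by
  intro t ht
  have h0 : (0 : ℝ) ≤ t := ht
  have h1 : ContinuousOn x (Icc 0 (t + 1)) :=
    IsSolutionOn.continuousOn_Icc (by linarith) (h.mono fun s hs => hs.1)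
  refine (h1 t ⟨h0, by linarith⟩).mono_of_mem_nhdsWithin ?_
  rw [← Ici_inter_Iic]
  exact inter_mem_nhdsWithin _ (Iic_mem_nhds (by linarith))

theorem IsSolution.sub_eq_integral {F : ℝ → E → E} {x : ℝ → E} (h : IsSolution F x) {a b : ℝ}
    (ha : 0 ≤ a) (hb : 0 ≤ b) :
    IntervalIntegrable (fun s => F s (x s)) volume a b ∧
      x b - x a = ∫ s in a..b, F s (x s) := by
  obtain ⟨ia, ea⟩ := h a ha
  obtain ⟨ib, eb⟩ := h b hb
  refine ⟨ia.symm.trans ib, ?_⟩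
  rw [ea, eb, add_sub_add_left_eq_sub, intervalIntegral.integral_interval_sub_left ib ia]

variable [CompleteSpace E]

/-- Global existence. The Picard operator is a contraction in the norm
`sup_t exp (-l t) ‖x t‖` with `l = 2 K + 1`; the fixed point theorem is applied to the bounded
function `y t = exp (-l t) x t`. -/
theorem exists_isSolution_of_lipschitz {g : E → E} {K : ℝ} (hK : 0 ≤ K)
    (hg : ∀ x y, ‖g x - g y‖ ≤ K * ‖x - y‖) {e : ℝ → E} (he : IsBoundedMeasurableSignal e)
    (x₀ : E) : ∃ x, IsSolution (fun t x => g x + e t) x ∧ x 0 = x₀ := by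
  classical
  obtain ⟨M, hM⟩ := he.2
  have hM0 : 0 ≤ M := (norm_nonneg _).trans (hM 0 le_rfl)
  set l : ℝ := 2 * K + 1 with hl
  have hlpos : 0 < l := by linarith
  have hgc : Continuous g := by
    refine LipschitzWith.continuous (K := ⟨K, hK⟩) (LipschitzWith.of_dist_le_mul fun x y => ?_)
    rw [dist_eq_norm, dist_eq_norm]; exact hg x y
  have hexp : ∀ t : ℝ, 0 ≤ t → ∫ s in (0 : ℝ)..t, Real.exp (l * s) ≤ Real.exp (l * t) / l := by
    intro t ht
    rw [intervalIntegral.integral_comp_mul_left (fun s => Real.exp s) hlpos.ne']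
    rw [integral_exp, smul_eq_mul, inv_mul_eq_div]
    gcongr
    simp
  have hexpint : ∀ (c t : ℝ), IntervalIntegrable (fun s => c * Real.exp (l * s)) volume 0 t :=
    fun c t => Continuous.intervalIntegrable (by fun_prop) _ _
  have hint : ∀ (y : BoundedContinuousFunction ℝ E) (t : ℝ), 0 ≤ t →
      IntervalIntegrable (fun s => g (Real.exp (l * s) • y s) + e s) volume 0 t := by
    intro y t ht
    refine IntervalIntegrable.add (Continuous.intervalIntegrable ?_ _ _)
      (he.intervalIntegrable le_rfl ht)
    exact hgc.comp ((by fun_prop : Continuous fun s : ℝ => Real.exp (l * s)).smul y.continuous)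
  let Ψ : BoundedContinuousFunction ℝ E → ℝ → E := fun y t =>
    Real.exp (-(l * max t 0)) • (x₀ + ∫ s in (0 : ℝ)..(max t 0), (g (Real.exp (l * s) • y s) + e s))
  have hΨc : ∀ y, Continuous (Ψ y) := by
    intro y
    have h1 : ContinuousOn (fun t => ∫ s in (0 : ℝ)..t, (g (Real.exp (l * s) • y s) + e s))
        (Ici 0) := by
      intro t ht
      have h0 : (0 : ℝ) ≤ t := ht
      have h1 := intervalIntegral.continuousOn_primitive_interval'
        (hint y (t + 1) (by linarith)) left_mem_uIcc
      rw [uIcc_of_le (by linarith)] at h1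
      refine (h1 t ⟨h0, by linarith⟩).mono_of_mem_nhdsWithin ?_
      rw [← Ici_inter_Iic]
      exact inter_mem_nhdsWithin _ (Iic_mem_nhds (by linarith))
    have h2 : Continuous fun t : ℝ =>
        ∫ s in (0 : ℝ)..(max t 0), (g (Real.exp (l * s) • y s) + e s) :=
      h1.comp_continuous (f := fun t : ℝ => max t 0) (by fun_prop) (fun t => le_max_right t 0)
    exact (by fun_prop : Continuous fun t : ℝ => Real.exp (-(l * max t 0))).smul
      (continuous_const.add h2)
  have hΨb : ∀ y, ∀ t, ‖Ψ y t‖ ≤ ‖x₀‖ + (‖g 0‖ + K * ‖y‖ + M) / l := by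
    intro y t
    set τ := max t 0 with hτ
    have hτ0 : 0 ≤ τ := le_max_right _ _
    have h1 : ‖∫ s in (0 : ℝ)..τ, (g (Real.exp (l * s) • y s) + e s)‖ ≤
        ∫ s in (0 : ℝ)..τ, (‖g 0‖ + K * ‖y‖ + M) * Real.exp (l * s) := by
      refine intervalIntegral.norm_integral_le_of_norm_le hτ0 (ae_of_all _ fun s hs => ?_)
        (hexpint _ _)
      have hs0 : 0 ≤ s := hs.1.le
      have he1 : 1 ≤ Real.exp (l * s) := Real.one_le_exp (by positivity)
      have hgs : ‖g (Real.exp (l * s) • y s)‖ ≤ ‖g 0‖ + K * (Real.exp (l * s) * ‖y‖) := by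
        have h2 := hg (Real.exp (l * s) • y s) 0
        have h3 := norm_sub_norm_le (g (Real.exp (l * s) • y s)) (g 0)
        rw [sub_zero, norm_smul, Real.norm_of_nonneg (Real.exp_pos _).le] at h2
        have h4 : Real.exp (l * s) * ‖y s‖ ≤ Real.exp (l * s) * ‖y‖ := by
          gcongr; exact y.norm_coe_le_norm s
        nlinarith [mul_le_mul_of_nonneg_left h4 hK]
      calc ‖g (Real.exp (l * s) • y s) + e s‖ ≤ ‖g 0‖ + K * (Real.exp (l * s) * ‖y‖) + M :=
            (norm_add_le _ _).trans (add_le_add hgs (hM s hs0))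
        _ ≤ ‖g 0‖ * Real.exp (l * s) + K * (Real.exp (l * s) * ‖y‖) + M * Real.exp (l * s) := by
            have := norm_nonneg (g 0)
            nlinarith
        _ = _ := by ring
    rw [intervalIntegral.integral_const_mul] at h1
    have hc0 : 0 ≤ ‖g 0‖ + K * ‖y‖ + M := by positivity
    have h2 : ‖Ψ y t‖ ≤ Real.exp (-(l * τ)) * (‖x₀‖ + (‖g 0‖ + K * ‖y‖ + M) *
        (Real.exp (l * τ) / l)) := by
      simp only [Ψ, ← hτ]
      rw [norm_smul, Real.norm_of_nonneg (Real.exp_pos _).le]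
      gcongr
      exact (norm_add_le _ _).trans (add_le_add le_rfl
        (h1.trans (mul_le_mul_of_nonneg_left (hexp τ hτ0) hc0)))
    refine h2.trans ?_
    have h3 : Real.exp (-(l * τ)) ≤ 1 := Real.exp_le_one_iff.2 (by nlinarith)
    have h4 : Real.exp (-(l * τ)) * Real.exp (l * τ) = 1 := by
      rw [← Real.exp_add]; simp
    calc _ = Real.exp (-(l * τ)) * ‖x₀‖ + (‖g 0‖ + K * ‖y‖ + M) / l *
          (Real.exp (-(l * τ)) * Real.exp (l * τ)) := by ring
      _ ≤ _ := by
          rw [h4, mul_one]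
          have := mul_le_mul_of_nonneg_right h3 (norm_nonneg x₀)
          linarith
  let Φ : BoundedContinuousFunction ℝ E → BoundedContinuousFunction ℝ E := fun y =>
    BoundedContinuousFunction.ofNormedAddCommGroup (Ψ y) (hΨc y) _ (hΨb y)
  have hΦ : ContractingWith (1 / 2) Φ := by
    refine ⟨by norm_num, LipschitzWith.of_dist_le_mul fun y z => ?_⟩
    refine (BoundedContinuousFunction.dist_le (by positivity)).2 fun t => ?_
    change dist (Ψ y t) (Ψ z t) ≤ _
    set τ := max t 0 with hτ
    have hτ0 : 0 ≤ τ := le_max_right _ _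
    have h1 : ‖∫ s in (0 : ℝ)..τ, (g (Real.exp (l * s) • y s) - g (Real.exp (l * s) • z s))‖ ≤
        ∫ s in (0 : ℝ)..τ, (K * dist y z) * Real.exp (l * s) := by
      refine intervalIntegral.norm_integral_le_of_norm_le hτ0 (ae_of_all _ fun s hs => ?_)
        (hexpint _ _)
      refine (hg _ _).trans ?_
      rw [← smul_sub, norm_smul, Real.norm_of_nonneg (Real.exp_pos _).le, ← dist_eq_norm]
      have := BoundedContinuousFunction.dist_coe_le_dist (f := y) (g := z) s
      calc K * (Real.exp (l * s) * dist (y s) (z s))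
          ≤ K * (Real.exp (l * s) * dist y z) := by gcongr
        _ = _ := by ring
    rw [intervalIntegral.integral_const_mul] at h1
    have h2 := h1.trans (mul_le_mul_of_nonneg_left (hexp τ hτ0) (by positivity))
    have h3 : Ψ y t - Ψ z t = Real.exp (-(l * τ)) •
        ∫ s in (0 : ℝ)..τ, (g (Real.exp (l * s) • y s) - g (Real.exp (l * s) • z s)) := by
      simp only [Ψ, ← hτ]
      rw [← smul_sub, add_sub_add_left_eq_sub,
        ← intervalIntegral.integral_sub (hint y τ hτ0) (hint z τ hτ0)]
      simp
    rw [dist_eq_norm, h3, norm_smul, Real.norm_of_nonneg (Real.exp_pos _).le]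
    have h4 : Real.exp (-(l * τ)) * Real.exp (l * τ) = 1 := by
      rw [← Real.exp_add]; simp
    calc _ ≤ Real.exp (-(l * τ)) * (K * dist y z * (Real.exp (l * τ) / l)) := by gcongr
      _ = (K / l) * dist y z * (Real.exp (-(l * τ)) * Real.exp (l * τ)) := by ring
      _ ≤ _ := by
        rw [h4, mul_one]
        have : K / l ≤ 1 / 2 := by rw [div_le_div_iff₀ hlpos (by norm_num)]; linarith
        push_cast
        gcongr
  set y := hΦ.fixedPoint Φ
  have hy : ∀ t, y t = Ψ y t := fun t => by
    have h : Φ y = y := hΦ.fixedPoint_isFixedPt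
    exact (congrArg (fun f : BoundedContinuousFunction ℝ E => f t) h).symm
  have key : ∀ t : ℝ, 0 ≤ t → Real.exp (l * t) • y t =
      x₀ + ∫ s in (0 : ℝ)..t, (g (Real.exp (l * s) • y s) + e s) := by
    intro t ht
    rw [hy t]
    simp only [Ψ, max_eq_left ht]
    rw [smul_smul, ← Real.exp_add]
    simp
  have k0 := key 0 le_rfl
  simp only [intervalIntegral.integral_same, add_zero] at k0
  refine ⟨fun t => Real.exp (l * t) • y t, fun t ht => ⟨hint y t ht, ?_⟩, k0⟩
  change Real.exp (l * t) • y t = Real.exp (l * 0) • y 0 + _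
  rw [k0]
  exact key t ht

/-- Uniqueness, in the form of Grönwall's inequality for the difference of two solutions. -/
theorem IsSolutionOn.eqOn_of_lipschitz {g : E → E} {K : ℝ}
    (hg : ∀ x y, ‖g x - g y‖ ≤ K * ‖x - y‖) {e : ℝ → E} {T : ℝ} (hT : 0 ≤ T)
    {x y : ℝ → E} (hx : IsSolutionOn (fun t x => g x + e t) (Icc 0 T) x)
    (hy : IsSolutionOn (fun t x => g x + e t) (Icc 0 T) y) (h0 : x 0 = y 0) :
    EqOn x y (Icc 0 T) := by
  have hgc : Continuous g := by
    refine LipschitzWith.continuous (K := K.toNNReal) (LipschitzWith.of_dist_le_mul fun x y => ?_)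
    rw [dist_eq_norm, dist_eq_norm]
    exact (hg x y).trans (mul_le_mul_of_nonneg_right (Real.le_coe_toNNReal K) (norm_nonneg _))
  have cx := IsSolutionOn.continuousOn_Icc hT hx
  have cy := IsSolutionOn.continuousOn_Icc hT hy
  have cd : ContinuousOn (fun s => g (x s) - g (y s)) (Icc 0 T) :=
    (hgc.comp_continuousOn cx).sub (hgc.comp_continuousOn cy)
  have heq : ∀ t ∈ Icc 0 T, x t - y t = ∫ s in (0 : ℝ)..t, (g (x s) - g (y s)) := by
    intro t ht
    obtain ⟨i1, e1⟩ := hx t ht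
    obtain ⟨i2, e2⟩ := hy t ht
    rw [e1, e2, h0, add_sub_add_left_eq_sub, ← intervalIntegral.integral_sub i1 i2]
    simp
  have hder : ∀ t ∈ Ico 0 T,
      HasDerivWithinAt (fun s => x s - y s) (g (x t) - g (y t)) (Ici t) t := by
    intro t ht
    have htT : t ∈ Icc 0 T := ⟨ht.1, ht.2.le⟩
    have hnh : Icc 0 T ∈ 𝓝[>] t :=
      mem_of_superset (Ioc_mem_nhdsGT ht.2) fun s hs => ⟨ht.1.trans hs.1.le, hs.2⟩
    have h1 : HasDerivWithinAt (fun u => ∫ s in (0 : ℝ)..u, (g (x s) - g (y s)))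
        (g (x t) - g (y t)) (Ici t) t := by
      refine intervalIntegral.integral_hasDerivWithinAt_right ?_ (t := Ioi t) ?_ ?_
      · refine ContinuousOn.intervalIntegrable (cd.mono ?_)
        rw [uIcc_of_le ht.1]; exact Icc_subset_Icc_right ht.2.le
      · exact ⟨Icc 0 T, hnh, cd.aestronglyMeasurable measurableSet_Icc⟩
      · exact (cd t htT).mono_of_mem_nhdsWithin hnh
    refine h1.congr_of_eventuallyEq ?_ (heq t htT)
    filter_upwards [Icc_mem_nhdsGE ht.2] with s hs
    exact heq s ⟨ht.1.trans hs.1, hs.2⟩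
  have h2 := eq_zero_of_abs_deriv_le_mul_abs_self_of_eq_zero_right (f := fun s => x s - y s)
    (K := K) (cx.sub cy) hder (by simp [h0]) (fun t _ => hg _ _)
  exact fun t ht => sub_eq_zero.1 (h2 t ht)

theorem isForwardComplete_of_lipschitz {g : E → E} {K : ℝ} (hK : 0 ≤ K)
    (hg : ∀ x y, ‖g x - g y‖ ≤ K * ‖x - y‖) {e : ℝ → E} (he : IsBoundedMeasurableSignal e) :
    IsForwardComplete (fun t x => g x + e t) := by
  refine ⟨fun x₀ => exists_isSolution_of_lipschitz hK hg he x₀, fun T hT x hx => ?_⟩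
  obtain ⟨y, hy, hy0⟩ := exists_isSolution_of_lipschitz hK hg he (x 0)
  refine ⟨y, hy, fun t ht => ?_⟩
  exact IsSolutionOn.eqOn_of_lipschitz hg ht.1 (hy.mono fun s hs => hs.1)
    (hx.mono fun s hs => ⟨hs.1, hs.2.trans_lt ht.2⟩) hy0 ⟨ht.1, le_rfl⟩

end Solutions

/-! ### Lyapunov functions and eventual bounds -/

section Lyapunov

variable {E : Type*} [NormedAddCommGroup E] [NormedSpace ℝ E] [CompleteSpace E]

/-- A Dini-derivative estimate: along a Carathéodory solution of `x' = g x + e` with `‖e‖ ≤ η`, the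
slopes of `V ∘ x` are asymptotically at most `V' (g x) + ‖V'‖ η`. It holds at every time, so that
no almost-everywhere differentiation is needed. -/
theorem IsSolution.eventually_slope_lt {g : E → E} (hgc : Continuous g) {e : ℝ → E} {x : ℝ → E}
    (hx : IsSolution (fun t x => g x + e t) x) {T η : ℝ} (hT : 0 ≤ T)
    (he : ∀ t, T ≤ t → ‖e t‖ ≤ η) {V : E → ℝ} {L : E →L[ℝ] ℝ} {t : ℝ} (ht : T ≤ t)
    (hV : HasFDerivAt V L (x t)) {r : ℝ} (hr : L (g (x t)) + ‖L‖ * η < r) :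
    ∀ᶠ z in 𝓝[>] t, slope (fun s => V (x s)) t z < r := by
  have ht0 : 0 ≤ t := hT.trans ht
  have hη : 0 ≤ η := (norm_nonneg _).trans (he t ht)
  set C : ℝ := ‖L‖ + ‖g (x t)‖ + 1 + η with hC
  have hCpos : 0 < C := by positivity
  obtain ⟨ε, hε0, hε1, hε⟩ : ∃ ε : ℝ, 0 < ε ∧ ε ≤ 1 ∧ ε * C < r - (L (g (x t)) + ‖L‖ * η) := by
    refine ⟨min 1 ((r - (L (g (x t)) + ‖L‖ * η)) / (2 * C)), ?_, min_le_left _ _, ?_⟩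
    · have : 0 < r - (L (g (x t)) + ‖L‖ * η) := by linarith
      positivity
    · calc _ ≤ ((r - (L (g (x t)) + ‖L‖ * η)) / (2 * C)) * C := by
            gcongr; exact min_le_right _ _
        _ = (r - (L (g (x t)) + ‖L‖ * η)) / 2 := by field_simp
        _ < _ := by linarith
  have cx : ContinuousWithinAt x (Ici t) t :=
    (hx.continuousOn t ht0).mono fun s hs => ht0.trans hs
  have h1 : ∀ᶠ s in 𝓝[≥] t, ‖g (x s) - g (x t)‖ < ε := by
    have := (hgc.continuousAt.comp_continuousWithinAt cx)
    have h2 := Metric.tendsto_nhds.1 this ε hε0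
    filter_upwards [h2] with s hs
    rwa [← dist_eq_norm]
  obtain ⟨u, hu, hus⟩ := (mem_nhdsGE_iff_exists_Ico_subset).1 h1
  have h2 : ∀ᶠ z in 𝓝[>] t, ‖V (x z) - V (x t) - L (x z - x t)‖ ≤ ε * ‖x z - x t‖ := by
    have h3 := (Asymptotics.isLittleO_iff.1 hV.isLittleO) hε0
    exact (cx.mono Ioi_subset_Ici_self).eventually h3
  filter_upwards [h2, Ioo_mem_nhdsGT hu] with z hz hzu
  have hzt : t < z := hzu.1
  obtain ⟨hi, hd⟩ := hx.sub_eq_integral ht0 (ht0.trans hzt.le)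
  have h3 : ‖x z - x t - (z - t) • g (x t)‖ ≤ (η + ε) * (z - t) := by
    have h4 : x z - x t - (z - t) • g (x t) = ∫ s in t..z, (g (x s) + e s - g (x t)) := by
      rw [intervalIntegral.integral_sub hi intervalIntegrable_const, hd,
        intervalIntegral.integral_const]
    rw [h4]
    refine (intervalIntegral.norm_integral_le_of_norm_le_const (C := η + ε) fun s hs => ?_).trans ?_
    · rw [uIoc_of_le hzt.le] at hs
      have h5 : ‖g (x s) - g (x t)‖ < ε := hus ⟨hs.1.le, hs.2.trans_lt hzu.2⟩
      have h6 := he s (ht.trans hs.1.le)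
      calc ‖g (x s) + e s - g (x t)‖ = ‖e s + (g (x s) - g (x t))‖ := by congr 1; abel
        _ ≤ _ := (norm_add_le _ _).trans (add_le_add h6 h5.le)
    · rw [abs_of_pos (sub_pos.2 hzt)]
  have h4 : ‖x z - x t‖ ≤ (‖g (x t)‖ + η + ε) * (z - t) := by
    have h5 : x z - x t = (z - t) • g (x t) + (x z - x t - (z - t) • g (x t)) := by abel
    rw [h5]
    refine (norm_add_le _ _).trans ?_
    rw [norm_smul, Real.norm_of_nonneg (sub_pos.2 hzt).le]
    linarith
  have h5 : L (x z - x t) ≤ (z - t) * L (g (x t)) + ‖L‖ * ((η + ε) * (z - t)) := by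
    have h6 : L (x z - x t) = (z - t) * L (g (x t)) + L (x z - x t - (z - t) • g (x t)) := by
      rw [map_sub L (x z - x t), map_smul, smul_eq_mul]; ring
    rw [h6]
    gcongr
    exact (Real.le_norm_self _).trans (L.le_opNorm_of_le h3)
  have h6 : V (x z) - V (x t) ≤ L (x z - x t) + ε * ((‖g (x t)‖ + η + ε) * (z - t)) := by
    have := (Real.le_norm_self _).trans hz
    nlinarith [mul_le_mul_of_nonneg_left h4 hε0.le]
  rw [slope_def_field, div_lt_iff₀ (sub_pos.2 hzt)]
  have h7 : (L (g (x t)) + ‖L‖ * (η + ε) + ε * (‖g (x t)‖ + η + ε)) < r := by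
    rw [hC] at hε
    nlinarith
  nlinarith [mul_lt_mul_of_pos_right h7 (sub_pos.2 hzt)]

/-- If `V` decreases at a uniform rate on `{ρ ≤ V}` along `x' = g x + e` for every `e` of size
`η`, then `V ≤ ρ` eventually. -/
theorem IsSolution.eventually_le_of_lyapunov {g : E → E} (hgc : Continuous g) {e : ℝ → E}
    {x : ℝ → E} (hx : IsSolution (fun t x => g x + e t) x) {η : ℝ}
    (he : EventuallyBoundedBy e η) {V : E → ℝ} {V' : E → E →L[ℝ] ℝ}
    (hV : ∀ x, HasFDerivAt V (V' x) x) {ρ c : ℝ} (hc : 0 < c)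
    (hdec : ∀ x, ρ ≤ V x → V' x (g x) + ‖V' x‖ * η ≤ -c) :
    ∃ T : ℝ, 0 < T ∧ ∀ t, T ≤ t → V (x t) ≤ ρ := by
  obtain ⟨T, hT, he⟩ := he
  have cV : Continuous V := continuous_iff_continuousAt.2 fun y => (hV y).continuousAt
  have cf : ∀ a b : ℝ, 0 ≤ a → ContinuousOn (fun s => V (x s)) (Icc a b) := fun a b ha =>
    cV.comp_continuousOn (hx.continuousOn.mono fun s hs => ha.trans hs.1)
  have hslope : ∀ a b, T ≤ a → ∀ t ∈ Ico a b, ∀ r,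
      V' (x t) (g (x t)) + ‖V' (x t)‖ * η < r →
      ∃ᶠ z in 𝓝[>] t, slope (fun s => V (x s)) t z < r := fun a b ha t ht r hr =>
    (hx.eventually_slope_lt hgc hT.le he (ha.trans ht.1) (hV _) hr).frequently
  obtain ⟨S, hTS, hS⟩ : ∃ S, T ≤ S ∧ V (x S) ≤ ρ := by
    by_contra! hcon
    set b : ℝ := T + (|V (x T) - ρ| + 1) / (c / 2) with hb
    have hbT : T ≤ b := by
      have : 0 ≤ (|V (x T) - ρ| + 1) / (c / 2) := by positivity
      linarith
    have h1 := image_le_of_liminf_slope_right_lt_deriv_boundary (cf T b hT.le)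
      (hslope T b le_rfl) (B := fun t => V (x T) - c / 2 * (t - T)) (B' := fun _ => -(c / 2))
      (by simp) (fun t => by
        have := ((hasDerivAt_id t).sub_const T).const_mul (c / 2)
        simpa using this.const_sub (V (x T)))
      (fun t ht _ => by
        have := hdec (x t) (hcon t ht.1).le
        linarith) ⟨hbT, le_rfl⟩
    have h2 : c / 2 * (b - T) = |V (x T) - ρ| + 1 := by
      rw [hb]; field_simp; ring
    have h3 := hcon b hbT
    have h4 := le_abs_self (V (x T) - ρ)
    simp only [h2] at h1
    linarith
  refine ⟨S, hT.trans_le hTS, fun t ht => ?_⟩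
  exact image_le_of_liminf_slope_right_lt_deriv_boundary (cf S t (hT.le.trans hTS))
      (hslope S t hTS) (B := fun _ => ρ) (B' := fun _ => 0) hS
      (fun t => hasDerivAt_const t ρ)
      (fun s hs hs' => by
        have := hdec (x s) hs'.ge
        linarith) ⟨ht, le_rfl⟩

end Lyapunov

/-! ### Small-input small-state stability implies global asymptotic stability -/

section Stability

variable {E : Type*} [NormedAddCommGroup E] [NormedSpace ℝ E]

/-- A solution of `y' = F` on one period `[0, P]` with `∫ F = 0` extends periodically. -/
theorem isSolution_periodic {P : ℝ} (hP : 0 < P) {y F : ℝ → E}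
    (hF : IntervalIntegrable F volume 0 P) (hy : ∀ t ∈ Ico 0 P, y t = y 0 + ∫ s in (0 : ℝ)..t, F s)
    (h0 : ∫ s in (0 : ℝ)..P, F s = 0) :
    IsSolution (fun t _ => F (P * Int.fract (t / P))) (fun t => y (P * Int.fract (t / P))) := by
  have hτ : ∀ t : ℝ, P * Int.fract (t / P) = t - ⌊t / P⌋ * P := fun t => by
    rw [Int.fract]; field_simp
  have hmem : ∀ t : ℝ, P * Int.fract (t / P) ∈ Ico 0 P := fun t =>
    ⟨mul_nonneg hP.le (Int.fract_nonneg _), by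
      have := mul_lt_mul_of_pos_left (Int.fract_lt_one (t / P)) hP
      linarith⟩
  have hid : ∀ t ∈ Ico 0 P, P * Int.fract (t / P) = t := fun t ht => by
    rw [Int.fract_eq_self.2 ⟨div_nonneg ht.1 hP.le, (div_lt_one hP).2 ht.2⟩]; field_simp
  set G : ℝ → E := fun t => F (P * Int.fract (t / P)) with hG
  have hper : Function.Periodic G P := fun t => by
    simp only [hG]
    rw [add_div, div_self hP.ne', Int.fract_add_one]
  have hae : ∀ t ∈ Icc 0 P, ∀ᵐ s, s ∈ uIoc 0 t → F s = G s := fun t ht => by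
    have : ∀ᵐ s : ℝ, s ≠ P := by simp [ae_iff]
    filter_upwards [this] with s hs hst
    rw [uIoc_of_le ht.1] at hst
    simp only [hG]
    rw [hid s ⟨hst.1.le, lt_of_le_of_ne (hst.2.trans ht.2) hs⟩]
  have hGint : ∀ a b, IntervalIntegrable G volume a b := by
    refine hper.intervalIntegrable₀ hP.ne' (hF.congr_ae ?_)
    exact (ae_restrict_iff' measurableSet_uIoc).2 (hae P ⟨hP.le, le_rfl⟩)
  have hint : ∀ t ∈ Icc 0 P, ∫ s in (0 : ℝ)..t, F s = ∫ s in (0 : ℝ)..t, G s := fun t ht =>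
    intervalIntegral.integral_congr_ae (hae t ht)
  have hIper : Function.Periodic (fun t => ∫ s in (0 : ℝ)..t, G s) P := fun t => by
    simp only
    rw [hper.intervalIntegral_add_eq_add 0 t hGint, zero_add, ← hint P ⟨hP.le, le_rfl⟩, h0,
      add_zero]
  intro t ht
  refine ⟨hGint 0 t, ?_⟩
  have h1 : ∫ s in (0 : ℝ)..t, G s = ∫ s in (0 : ℝ)..(P * Int.fract (t / P)), G s := by
    rw [hτ]; exact (hIper.sub_int_mul_eq ⌊t / P⌋).symm
  change y (P * Int.fract (t / P)) = y (P * Int.fract (0 / P)) + ∫ s in (0 : ℝ)..t, G s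
  rw [h1, hy _ (hmem t), hint _ (Ico_subset_Icc_self (hmem t))]
  simp

variable [CompleteSpace E]

/-- For a globally Lipschitz vector field vanishing at the origin, `SISS_L` implies global
asymptotic stability. Attractivity is the case of a zero disturbance. If the origin were not
Lyapunov stable, a solution starting very close to it would make an excursion of size `ε` before
coming back; joining its end point to its initial point by a segment costs a disturbance that is as
small as the initial point, and repeating the resulting loop periodically contradicts the eventual
bound. -/
theorem IsSISSLInputFree.isGAS {g : E → E} {K : ℝ} (hK : 0 ≤ K)
    (hg : ∀ x y, ‖g x - g y‖ ≤ K * ‖x - y‖) (hg0 : g 0 = 0) (h : IsSISSLInputFree g) :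
    IsGAS g := by
  obtain ⟨Δ, N, hΔ, hN, h⟩ := h
  have hgc : Continuous g := by
    refine LipschitzWith.continuous (K := ⟨K, hK⟩) (LipschitzWith.of_dist_le_mul fun x y => ?_)
    rw [dist_eq_norm, dist_eq_norm]; exact hg x y
  have hz : IsBoundedMeasurableSignal (fun _ : ℝ => (0 : E)) :=
    ⟨aestronglyMeasurable_const, 0, by simp⟩
  have hconv : ∀ x, IsSolution (fun _ => g) x → Tendsto x atTop (𝓝 0) := by
    intro x hx
    rw [Metric.tendsto_atTop]
    intro ε hε
    have hδ : 0 < min Δ (ε / (2 * N)) := by positivity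
    obtain ⟨T, hT, hb⟩ := (h _ hδ (min_le_left _ _) _ hz
      ⟨1, one_pos, fun t _ => by simpa using hδ.le⟩).2 x (by simpa using hx)
    refine ⟨T, fun t ht => ?_⟩
    rw [dist_zero_right]
    calc ‖x t‖ ≤ N * min Δ (ε / (2 * N)) := hb t ht
      _ ≤ N * (ε / (2 * N)) := by gcongr; exact min_le_right _ _
      _ = ε / 2 := by field_simp
      _ < ε := by linarith
  refine ⟨by simpa using isForwardComplete_of_lipschitz hK hg hz, ?_, hconv⟩
  by_contra! hcon
  obtain ⟨ε, hε, hcon⟩ := hcon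
  have hδ : 0 < min Δ (ε / (2 * N)) := by positivity
  set δ := min Δ (ε / (2 * N)) with hδdef
  set r := δ / (2 + K) with hr
  have hrpos : 0 < r := by positivity
  obtain ⟨x, hx, hx0, t₁, ht₁, hxt₁⟩ := hcon r hrpos
  obtain ⟨S, hS⟩ := Metric.tendsto_atTop.1 (hconv x hx) r hrpos
  set T := max S (t₁ + 1) with hTdef
  have hTt : t₁ < T := (by linarith : t₁ < t₁ + 1).trans_le (le_max_right _ _)
  have hT0 : 0 < T := ht₁.trans_lt hTt
  have hxT : ‖x T‖ < r := by simpa using hS T (le_max_left _ _)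
  set P := T + 1 with hP
  have hP0 : 0 < P := by positivity
  -- the loop: the solution on `[0, T)`, then the segment back to the initial point
  set y : ℝ → E := fun t => if t < T then x t else x T + (t - T) • (x 0 - x T) with hy
  set F : ℝ → E := fun t => if t < T then g (x (max t 0)) else x 0 - x T with hF
  set e : ℝ → E := fun t => if t < T then 0 else
    (x 0 - x T) - g (x T + (t - T) • (x 0 - x T)) with he
  have hxc : Continuous fun t : ℝ => x (max t 0) :=
    hx.continuousOn.comp_continuous (f := fun t : ℝ => max t 0) (by fun_prop)
      (fun t => le_max_right t 0)
  have hFe : ∀ t, 0 ≤ t → F t = g (y t) + e t := fun t ht => by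
    by_cases h : t < T
    · simp [hF, hy, he, h, max_eq_left ht]
    · simp [hF, hy, he, h]
  have hseg : ∀ a b, IntervalIntegrable (fun t => g (x (max t 0))) volume a b := fun a b =>
    (hgc.comp hxc).intervalIntegrable a b
  have hI1 : ∀ t ∈ Icc 0 T, IntervalIntegrable F volume 0 t ∧
      x t = x 0 + ∫ s in (0 : ℝ)..t, F s := by
    intro t ht
    have hae : ∀ᵐ s : ℝ, s ∈ uIoc 0 t → g (x (max s 0)) = F s := by
      have : ∀ᵐ s : ℝ, s ≠ T := by simp [ae_iff]
      filter_upwards [this] with s hs hst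
      rw [uIoc_of_le ht.1] at hst
      simp [hF, lt_of_le_of_ne (hst.2.trans ht.2) hs]
    refine ⟨(hseg 0 t).congr_ae ((ae_restrict_iff' measurableSet_uIoc).2 hae), ?_⟩
    rw [(hx t ht.1).2]
    congr 1
    rw [← intervalIntegral.integral_congr_ae hae]
    refine intervalIntegral.integral_congr fun s hs => ?_
    rw [uIcc_of_le ht.1] at hs
    simp [max_eq_left hs.1]
  have hI2 : ∀ t, T ≤ t → IntervalIntegrable F volume T t ∧
      ∫ s in T..t, F s = (t - T) • (x 0 - x T) := by
    intro t ht
    have heq : ∀ s ∈ uIcc T t, x 0 - x T = F s := fun s hs => by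
      rw [uIcc_of_le ht] at hs
      simp [hF, not_lt.2 hs.1]
    constructor
    · exact (intervalIntegrable_const (c := x 0 - x T)).congr fun s hs =>
        heq s (uIoc_subset_uIcc hs)
    · rw [← intervalIntegral.integral_congr (f := fun _ => x 0 - x T) heq,
        intervalIntegral.integral_const]
  have hTT := hI1 T ⟨hT0.le, le_rfl⟩
  have hyint : ∀ t ∈ Icc 0 P, IntervalIntegrable F volume 0 t ∧
      y t = y 0 + ∫ s in (0 : ℝ)..t, F s := by
    intro t ht
    have hy0 : y 0 = x 0 := by simp [hy, hT0]
    rw [hy0]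
    by_cases h : t < T
    · have := hI1 t ⟨ht.1, h.le⟩
      simpa [hy, h] using this
    · have h' := hI2 t (not_lt.1 h)
      refine ⟨hTT.1.trans h'.1, ?_⟩
      rw [← intervalIntegral.integral_add_adjacent_intervals hTT.1 h'.1, h'.2, ← add_assoc, ← hTT.2]
      simp [hy, h]
  have hP2 := hyint P ⟨hP0.le, le_rfl⟩
  have hloop : ∫ s in (0 : ℝ)..P, F s = 0 := by
    have : y P = y 0 := by simp [hy, hP, hT0]
    have h3 := hP2.2
    rw [this] at h3
    simpa using h3
  have hsol := isSolution_periodic hP0 hP2.1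
    (fun t ht => (hyint t (Ico_subset_Icc_self ht)).2) hloop
  have hmem : ∀ t : ℝ, 0 ≤ P * Int.fract (t / P) := fun t =>
    mul_nonneg hP0.le (Int.fract_nonneg _)
  have hlt : ∀ t : ℝ, P * Int.fract (t / P) < T + 1 := fun t => by
    have := mul_lt_mul_of_pos_left (Int.fract_lt_one (t / P)) hP0
    linarith
  have heb : ∀ t, 0 ≤ t → t < T + 1 → ‖e t‖ ≤ δ := by
    intro t ht htP
    by_cases h : t < T
    · simp only [he, h, if_true, norm_zero]; exact hδ.le
    · simp only [he, h, if_false]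
      have ha : 0 ≤ t - T := by linarith [not_lt.1 h]
      have hs : ‖x T + (t - T) • (x 0 - x T)‖ ≤ r := by
        have : x T + (t - T) • (x 0 - x T) = (1 - (t - T)) • x T + (t - T) • x 0 := by
          module
        rw [this]
        refine (norm_add_le _ _).trans ?_
        rw [norm_smul, norm_smul, Real.norm_of_nonneg ha, Real.norm_of_nonneg (by linarith)]
        nlinarith
      have h1 := hg (x T + (t - T) • (x 0 - x T)) 0
      rw [hg0, sub_zero, sub_zero] at h1
      have h2 : (2 + K) * r = δ := by rw [hr]; field_simp
      calc _ ≤ ‖x 0‖ + ‖x T‖ + ‖g (x T + (t - T) • (x 0 - x T))‖ :=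
            (norm_sub_le _ _).trans (add_le_add (norm_sub_le _ _) le_rfl)
        _ ≤ r + r + K * r := by gcongr; exact h1.trans (by gcongr)
        _ = δ := by rw [← h2]; ring
  have hem : StronglyMeasurable e := by
    refine StronglyMeasurable.ite measurableSet_Iio stronglyMeasurable_const ?_
    exact Continuous.stronglyMeasurable (by fun_prop)
  have hτm : Measurable fun t : ℝ => P * Int.fract (t / P) :=
    (measurable_fract.comp (measurable_id.div_const P)).const_mul P
  obtain ⟨T', hT', hb⟩ := (h δ hδ (min_le_left _ _) (fun t => e (P * Int.fract (t / P)))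
    ⟨(hem.comp_measurable hτm).aestronglyMeasurable, δ, fun t _ => heb _ (hmem t) (hlt t)⟩
    ⟨1, one_pos, fun t _ => heb _ (hmem t) (hlt t)⟩).2
    (fun t => y (P * Int.fract (t / P))) (by
      intro t ht
      simpa only [hFe _ (hmem _)] using hsol t ht)
  obtain ⟨n, hn⟩ := exists_nat_gt (T' / P)
  have hτ1 : P * Int.fract ((t₁ + n * P) / P) = t₁ := by
    rw [add_div, mul_div_cancel_right₀ _ hP0.ne', Int.fract_add_natCast,
      Int.fract_eq_self.2 ⟨by positivity, (div_lt_one hP0).2 (by linarith)⟩]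
    field_simp
  have h1 := hb (t₁ + n * P) (by
    have := (div_lt_iff₀ hP0).1 hn
    linarith)
  simp only [hτ1] at h1
  have h2 : y t₁ = x t₁ := by simp [hy, hTt]
  rw [h2] at h1
  have h3 : N * δ ≤ N * (ε / (2 * N)) := by gcongr; exact min_le_right _ _
  have h4 : N * (ε / (2 * N)) = ε / 2 := by field_simp
  linarith

end Stability

/-! ### Linear images of solutions; eventual bounds -/

section Auxiliary

variable {E E' : Type*} [NormedAddCommGroup E] [NormedSpace ℝ E] [CompleteSpace E]
  [NormedAddCommGroup E'] [NormedSpace ℝ E'] [CompleteSpace E']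

theorem IsSolution.map {F : ℝ → E → E} {x : ℝ → E} (h : IsSolution F x) (L : E →L[ℝ] E')
    {G : ℝ → E' → E'} (hG : ∀ t, 0 ≤ t → G t (L (x t)) = L (F t (x t))) :
    IsSolution G (fun t => L (x t)) := by
  intro t ht
  have ht0 : (0 : ℝ) ≤ t := ht
  obtain ⟨i, e⟩ := h t ht
  have hEq : EqOn (fun s => L (F s (x s))) (fun s => G s (L (x s))) (uIcc 0 t) := fun s hs => by
    rw [uIcc_of_le ht0] at hs
    exact (hG s hs.1).symm
  have i' : IntervalIntegrable (fun s => L (F s (x s))) volume 0 t :=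
    ⟨L.integrable_comp i.1, L.integrable_comp i.2⟩
  refine ⟨i'.congr fun s hs => hEq (uIoc_subset_uIcc hs), ?_⟩
  rw [← intervalIntegral.integral_congr hEq, L.intervalIntegral_comp_comm i, ← map_add, ← e]

theorem eventuallyBoundedBy_iff {E : Type*} [NormedAddCommGroup E] {w : ℝ → E} {δ : ℝ} :
    EventuallyBoundedBy w δ ↔ ∀ᶠ t in atTop, ‖w t‖ ≤ δ := by
  rw [eventually_atTop]
  constructor
  · rintro ⟨T, -, h⟩; exact ⟨T, h⟩
  · rintro ⟨T, h⟩
    exact ⟨max T 1, by positivity, fun t ht => h t ((le_max_left _ _).trans ht)⟩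

end Auxiliary

/-! ### Hurwitz matrices -/

section Hurwitz

open scoped InnerProductSpace

theorem eventuallyBoundedBy_of_re_neg {z : ℂ} (hz : z.re < 0) {η : ℝ} (hη : 0 < η) {r y : ℝ → ℂ}
    (hr : EventuallyBoundedBy r η) (hy : IsSolution (fun t y => z * y + r t) y) :
    EventuallyBoundedBy y (2 / -z.re * η) := by
  have ha : 0 < -z.re := by linarith
  set a := -z.re with haz
  have key := hy.eventually_le_of_lyapunov (g := fun y => z * y) (by fun_prop) hr
    (V := fun y => ‖y‖ ^ 2) (V' := fun y => 2 • innerSL ℝ y)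
    (fun y => (hasStrictFDerivAt_norm_sq y).hasFDerivAt) (ρ := (2 / a * η) ^ 2)
    (c := 2 * (2 / a * η) * η) (by positivity) (by
      intro y hyρ
      have h1 : 2 / a * η ≤ ‖y‖ := by
        rw [sq_le_sq₀ (by positivity) (norm_nonneg _)] at hyρ
        exact hyρ
      have h2 : (2 • innerSL ℝ y) (z * y) = 2 * (-a * ‖y‖ ^ 2) := by
        simp only [smul_apply, innerSL_apply_apply, Complex.inner, nsmul_eq_mul]
        rw [haz, ← Complex.normSq_eq_norm_sq, Complex.normSq_apply]
        simp
        ring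
      have h3 : ‖(2 • innerSL ℝ y : ℂ →L[ℝ] ℝ)‖ ≤ 2 * ‖y‖ := by
        rw [← Nat.cast_smul_eq_nsmul ℝ, norm_smul, innerSL_apply_norm]
        simp
      have h4 : 2 * η ≤ a * ‖y‖ := by
        have := mul_le_mul_of_nonneg_left h1 ha.le
        have h5 : a * (2 / a * η) = 2 * η := by field_simp
        linarith
      rw [h2]
      have h5 := mul_le_mul_of_nonneg_right h3 hη.le
      nlinarith [norm_nonneg y, mul_le_mul_of_nonneg_right h1 hη.le,
        mul_le_mul_of_nonneg_right h4 (norm_nonneg y)])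
  obtain ⟨T, hT, h⟩ := key
  refine ⟨T, hT, fun t ht => ?_⟩
  have := h t ht
  rwa [sq_le_sq₀ (norm_nonneg _) (by positivity)] at this

/-- The cascade behind input-to-state stability of a Hurwitz system `x' = A x + e`. With
`Q' = (M - z) Q`, the signal `y = Q x` obeys `y' = z y + Q' x + Q e`, and the last signal of the
chain vanishes by Cayley-Hamilton. -/
theorem exists_eventuallyBoundedBy_of_prod_eq_zero {n : ℕ} {E : Type*} [NormedAddCommGroup E]
    [NormedSpace ℝ E] [FiniteDimensional ℝ E] (A : E →L[ℝ] E)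
    (M : Module.End ℂ (Fin n → ℂ)) (l : List ℂ) (hl : ∀ z ∈ l, z.re < 0) :
    ∀ Q : E →ₗ[ℝ] (Fin n → ℂ), (∀ x, Q (A x) = M (Q x)) →
      (∀ x, (l.map fun z => M - algebraMap ℂ _ z).prod (Q x) = 0) →
      ∃ C : ℝ, 0 < C ∧ ∀ η, 0 < η → ∀ e : ℝ → E, EventuallyBoundedBy e η →
        ∀ x, IsSolution (fun t x => A x + e t) x → EventuallyBoundedBy (fun t => Q (x t)) (C * η) := by
  have : CompleteSpace E := FiniteDimensional.complete ℝ E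
  induction l using List.reverseRecOn with
  | nil =>
    intro Q _ h0
    refine ⟨1, one_pos, fun η hη e _ x _ => ⟨1, one_pos, fun t _ => ?_⟩⟩
    have := h0 (x t)
    simp only [List.map_nil, List.prod_nil, Module.End.one_apply] at this
    simp [this, hη.le]
  | append_singleton l z ih =>
    intro Q hQ h0
    set M' : Module.End ℂ (Fin n → ℂ) := M - algebraMap ℂ _ z with hM'
    have hcomm : ∀ v, M' (M v) = M (M' v) := fun v => by simp [hM']
    obtain ⟨C, hC, hb⟩ := ih (fun w hw => hl w (by simp [hw])) ((M'.restrictScalars ℝ) ∘ₗ Q)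
      (fun x => by simp [hQ, hcomm]) (fun x => by
        have := h0 x
        rw [List.map_append, List.prod_append] at this
        simpa [hM'] using this)
    have hz : z.re < 0 := hl z (by simp)
    set Qc : E →L[ℝ] (Fin n → ℂ) := LinearMap.toContinuousLinearMap Q with hQc
    set D := 2 / -z.re * (C + ‖Qc‖) with hD
    have hzpos : 0 < -z.re := by linarith
    have hDpos : 0 < D := by positivity
    refine ⟨D, hDpos, fun η hη e he x hx => ?_⟩
    have h1 := hb η hη e he x hx
    rw [eventuallyBoundedBy_iff] at h1
    have h2 := eventuallyBoundedBy_iff.1 he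
    have hcoord : ∀ i, EventuallyBoundedBy (fun t => Q (x t) i) (D * η) := by
      intro i
      have hr : EventuallyBoundedBy (fun t => (M' (Q (x t)) + Q (e t)) i) ((C + ‖Qc‖) * η) := by
        rw [eventuallyBoundedBy_iff]
        filter_upwards [h1, h2] with t ht1 ht2
        have h3 : ‖Q (e t)‖ ≤ ‖Qc‖ * η := Qc.le_opNorm_of_le ht2
        calc _ ≤ ‖M' (Q (x t)) + Q (e t)‖ := norm_le_pi_norm _ i
          _ ≤ C * η + ‖Qc‖ * η := (norm_add_le _ _).trans (add_le_add ht1 h3)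
          _ = _ := by ring
      have hsol := hx.map ((ContinuousLinearMap.proj (R := ℝ) (φ := fun _ : Fin n => ℂ) i).comp Qc)
        (G := fun t y => z * y + (M' (Q (x t)) + Q (e t)) i) (by
          intro t _
          simp only [hQc, ContinuousLinearMap.comp_apply, map_add,
            LinearMap.coe_toContinuousLinearMap', ContinuousLinearMap.proj_apply, hQ, hM']
          simp
          ring)
      have := eventuallyBoundedBy_of_re_neg hz (by positivity) hr hsol
      rw [hD, mul_assoc]
      exact this
    rw [eventuallyBoundedBy_iff]
    have h3 : ∀ᶠ t in atTop, ∀ i, ‖Q (x t) i‖ ≤ D * η :=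
      eventually_all.2 fun i => eventuallyBoundedBy_iff.1 (hcoord i)
    filter_upwards [h3] with t ht
    exact (pi_norm_le_iff_of_nonneg (by positivity)).2 ht

/-- The coordinatewise embedding `ℝⁿ → ℂⁿ`. -/
def complexify (n : ℕ) : EuclideanSpace ℝ (Fin n) →ₗ[ℝ] (Fin n → ℂ) where
  toFun x i := (x i : ℂ)
  map_add' x y := by ext; simp
  map_smul' c x := by ext; simp

theorem complexify_injective (n : ℕ) : Function.Injective (complexify n) := fun x y h => by
  ext i
  have := congrFun h i
  simpa [complexify] using this

theorem complexify_mulVec {n : ℕ} (A : Matrix (Fin n) (Fin n) ℝ) (x : EuclideanSpace ℝ (Fin n)) :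
    complexify n (Matrix.toEuclideanCLM (𝕜 := ℝ) A x) =
      Matrix.toLin' (A.map (algebraMap ℝ ℂ)) (complexify n x) := by
  ext i
  simp [complexify, Matrix.mulVec, dotProduct]

theorem prod_charpoly_roots_apply {n : ℕ} (M : Matrix (Fin n) (Fin n) ℂ) (v : Fin n → ℂ) :
    (M.charpoly.roots.toList.map fun z => Matrix.toLin' M - algebraMap ℂ _ z).prod v = 0 := by
  have h1 : M.charpoly = (M.charpoly.roots.toList.map fun z => Polynomial.X - Polynomial.C z).prod := by
    conv_lhs => rw [(IsAlgClosed.splits M.charpoly).eq_prod_roots_of_monic M.charpoly_monic]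
    rw [← Multiset.prod_toList, ← Multiset.prod_coe, ← Multiset.prod_coe, Multiset.coe_toList,
      ← Multiset.map_coe, Multiset.coe_toList]
  have h2 : Polynomial.aeval (Matrix.toLin' M) M.charpoly = 0 := by
    have h := Polynomial.aeval_algHom_apply (Matrix.toLinAlgEquiv' (R := ℂ) (n := Fin n)) M M.charpoly
    rw [Matrix.aeval_self_charpoly, map_zero] at h
    exact h
  rw [h1, map_list_prod, List.map_map] at h2
  have h3 : ((Polynomial.aeval (Matrix.toLin' M)) ∘ fun z => Polynomial.X - Polynomial.C z) =
      fun z => Matrix.toLin' M - algebraMap ℂ _ z := by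
    funext z; simp
  rw [h3] at h2
  rw [h2]; rfl

theorem mem_spectrum_of_mem_charpoly_roots {n : ℕ} {M : Matrix (Fin n) (Fin n) ℂ} {z : ℂ}
    (hz : z ∈ M.charpoly.roots) : z ∈ spectrum ℂ M := by
  rw [Matrix.mem_spectrum_iff_isRoot_charpoly]
  exact Polynomial.isRoot_of_mem_roots hz

theorem IsHurwitz.exists_eventuallyBoundedBy {n : ℕ} {A : Matrix (Fin n) (Fin n) ℝ}
    (hA : IsHurwitz A) :
    ∃ C : ℝ, 0 < C ∧ ∀ η, 0 < η → ∀ e : ℝ → EuclideanSpace ℝ (Fin n), EventuallyBoundedBy e η →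
      ∀ x, IsSolution (fun t x => Matrix.toEuclideanCLM (𝕜 := ℝ) A x + e t) x →
        EventuallyBoundedBy x (C * η) := by
  obtain ⟨C, hC, h⟩ := exists_eventuallyBoundedBy_of_prod_eq_zero
    (Matrix.toEuclideanCLM (𝕜 := ℝ) A) (Matrix.toLin' (A.map (algebraMap ℝ ℂ)))
    (A.map (algebraMap ℝ ℂ)).charpoly.roots.toList
    (fun z hz => hA z (mem_spectrum_of_mem_charpoly_roots (by simpa using hz)))
    (complexify n) (complexify_mulVec A) (fun x => prod_charpoly_roots_apply _ _)
  obtain ⟨K, hK, hKL⟩ := (complexify n).exists_antilipschitzWith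
    (LinearMap.ker_eq_bot.2 (complexify_injective n))
  refine ⟨K * C, by positivity, fun η hη e he x hx => ?_⟩
  have h1 := eventuallyBoundedBy_iff.1 (h η hη e he x hx)
  rw [eventuallyBoundedBy_iff]
  filter_upwards [h1] with t ht
  have h2 := hKL.le_mul_dist (x t) 0
  rw [map_zero, dist_zero_right, dist_zero_right] at h2
  calc ‖x t‖ ≤ K * ‖complexify n (x t)‖ := h2
    _ ≤ K * (C * η) := by gcongr
    _ = _ := by ring

end Hurwitz

/-! ### Saturated feedback for a critical block -/

section CriticalBlock

open scoped InnerProductSpace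

variable {W : Type*} [NormedAddCommGroup W]

/-- The weight `(1 + ‖ξ‖²)^(-1/2)`. -/
noncomputable def invJap (ξ : W) : ℝ := (√(1 + ‖ξ‖ ^ 2))⁻¹

theorem invJap_pos (ξ : W) : 0 < invJap ξ := by unfold invJap; positivity

theorem invJap_sq (ξ : W) : invJap ξ ^ 2 * (1 + ‖ξ‖ ^ 2) = 1 := by
  unfold invJap
  rw [inv_pow, Real.sq_sqrt (by positivity)]
  field_simp

theorem invJap_le_one (ξ : W) : invJap ξ ≤ 1 := by
  have := invJap_sq ξ
  have h := invJap_pos ξ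
  nlinarith [sq_nonneg ‖ξ‖, mul_nonneg (sq_nonneg (invJap ξ)) (sq_nonneg ‖ξ‖)]

theorem norm_mul_invJap_le_one (ξ : W) : ‖ξ‖ * invJap ξ ≤ 1 := by
  have := invJap_sq ξ
  have h := invJap_pos ξ
  have : (‖ξ‖ * invJap ξ) ^ 2 ≤ 1 := by nlinarith
  nlinarith [mul_nonneg (norm_nonneg ξ) h.le]

variable [InnerProductSpace ℝ W]

theorem hasFDerivAt_invJap (ξ : W) :
    HasFDerivAt (invJap : W → ℝ) (-(invJap ξ ^ 3) • innerSL ℝ ξ) ξ := by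
  have hpos : (0 : ℝ) < 1 + ‖ξ‖ ^ 2 := by positivity
  have h1 : HasDerivAt (fun s : ℝ => (√(1 + s))⁻¹)
      (-(1 / (2 * √(1 + ‖ξ‖ ^ 2))) / √(1 + ‖ξ‖ ^ 2) ^ 2) (‖ξ‖ ^ 2) := by
    have h2 : HasDerivAt (fun s : ℝ => 1 + s) 1 (‖ξ‖ ^ 2) := (hasDerivAt_id _).const_add 1
    exact (h2.sqrt hpos.ne').fun_inv (Real.sqrt_pos.2 hpos).ne'
  have h3 := h1.comp_hasFDerivAt ξ (hasStrictFDerivAt_norm_sq ξ).hasFDerivAt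
  refine h3.congr_fderiv ?_
  ext v
  have hs : √(1 + ‖ξ‖ ^ 2) ≠ 0 := (Real.sqrt_pos.2 hpos).ne'
  simp only [smul_apply, innerSL_apply_apply, smul_eq_mul, nsmul_eq_mul, invJap]
  field_simp
  simp

/-- The data behind a strict Lyapunov function for a skew-adjoint system `ξ' = A ξ` damped along
the direction `β`: a correction `⟪S ξ, ξ⟫` whose derivative along `A` turns the one-directional
dissipation `2 ⟪β, ξ⟫²` into the full `‖ξ‖²`. -/
structure IsDampedBlock (A : W →L[ℝ] W) (β : W) (S : W →L[ℝ] W) : Prop where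
  skew : ∀ ξ, ⟪ξ, A ξ⟫_ℝ = 0
  dissipation : ∀ ξ, ⟪S (A ξ), ξ⟫_ℝ + ⟪S ξ, A ξ⟫_ℝ ≤ 2 * ⟪β, ξ⟫_ℝ ^ 2 - ‖ξ‖ ^ 2

/-- The Lyapunov function is `V ξ = ‖ξ‖² + l ⟪S ξ, ξ⟫ (1 + ‖ξ‖²)^(-1/2)`: its derivative is at most
`-(l / 2) ‖ξ‖² (1 + ‖ξ‖²)^(-1/2)` without disturbance. -/
theorem IsDampedBlock.eventuallyBoundedBy [CompleteSpace W] {A : W →L[ℝ] W} {β : W}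
    {S : W →L[ℝ] W} (h : IsDampedBlock A β S) {l : ℝ} (hl : 0 < l)
    (hsmall : 6 * l * (‖S‖ * (1 + ‖β‖ ^ 2)) ≤ 1) {η : ℝ} (hη : 0 < η) (hηl : 24 * η ≤ l)
    {e ξ : ℝ → W} (he : EventuallyBoundedBy e η)
    (hξ : IsSolution (fun t ξ => (A ξ - (l * (⟪β, ξ⟫_ℝ * invJap ξ)) • β) + e t) ξ) :
    EventuallyBoundedBy ξ (48 * η / l) := by
  set r := 24 * η / l with hr
  have hr0 : 0 < r := by positivity
  have hr1 : r ≤ 1 := (div_le_one hl).2 hηl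
  have hS1 : 6 * l * ‖S‖ ≤ 1 := by
    nlinarith [mul_nonneg (mul_nonneg hl.le (norm_nonneg S)) (sq_nonneg ‖β‖)]
  have hS2 : 6 * l * (‖S‖ * ‖β‖ ^ 2) ≤ 1 := by nlinarith [mul_nonneg hl.le (norm_nonneg S)]
  set g : W → W := fun ξ => A ξ - (l * (⟪β, ξ⟫_ℝ * invJap ξ)) • β with hg
  have hJc : Continuous (invJap : W → ℝ) :=
    continuous_iff_continuousAt.2 fun ξ => (hasFDerivAt_invJap ξ).continuousAt
  have hgc : Continuous g := by fun_prop
  set V : W → ℝ := fun ξ => ‖ξ‖ ^ 2 + l * (⟪S ξ, ξ⟫_ℝ * invJap ξ) with hVdef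
  set V' : W → W →L[ℝ] ℝ := fun ξ => 2 • innerSL ℝ ξ +
    l • (⟪S ξ, ξ⟫_ℝ • (-(invJap ξ ^ 3) • innerSL ℝ ξ) +
      invJap ξ • ((innerSL ℝ (S ξ)) + (innerSL ℝ ξ).comp S)) with hV'def
  have hV : ∀ ξ, HasFDerivAt V (V' ξ) ξ := by
    intro ξ
    have h1 : HasFDerivAt (fun ξ => ⟪S ξ, ξ⟫_ℝ) (innerSL ℝ (S ξ) + (innerSL ℝ ξ).comp S) ξ := by
      refine (S.hasFDerivAt.inner ℝ (hasFDerivAt_id ξ)).congr_fderiv ?_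
      ext v
      simp [fderivInnerCLM_apply, real_inner_comm]
    exact ((hasStrictFDerivAt_norm_sq ξ).hasFDerivAt).add
      ((h1.mul (hasFDerivAt_invJap ξ)).const_mul l)
  have hV'app : ∀ ξ k, V' ξ k = 2 * ⟪ξ, k⟫_ℝ + l * (-(⟪S ξ, ξ⟫_ℝ * invJap ξ ^ 3 * ⟪ξ, k⟫_ℝ) +
      invJap ξ * (⟪S ξ, k⟫_ℝ + ⟪S k, ξ⟫_ℝ)) := fun ξ k => by
    simp [hV'def, real_inner_comm]
    ring
  have hSq : ∀ ξ, |⟪S ξ, ξ⟫_ℝ| ≤ ‖S‖ * ‖ξ‖ ^ 2 := fun ξ =>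
    (abs_real_inner_le_norm _ _).trans (by
      have := S.le_opNorm ξ
      nlinarith [norm_nonneg ξ])
  have hcorr : ∀ ξ k, |-(⟪S ξ, ξ⟫_ℝ * invJap ξ ^ 3 * ⟪ξ, k⟫_ℝ) +
      invJap ξ * (⟪S ξ, k⟫_ℝ + ⟪S k, ξ⟫_ℝ)| ≤ 3 * ‖S‖ * (invJap ξ * ‖ξ‖) * ‖k‖ := by
    intro ξ k
    have hJ := invJap_pos ξ
    have hxJ := norm_mul_invJap_le_one ξ
    have h1 : |⟪S ξ, ξ⟫_ℝ * invJap ξ ^ 3 * ⟪ξ, k⟫_ℝ| ≤ ‖S‖ * (invJap ξ * ‖ξ‖) * ‖k‖ := by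
      rw [abs_mul, abs_mul, abs_of_pos (pow_pos hJ 3)]
      calc _ ≤ (‖S‖ * ‖ξ‖ ^ 2) * invJap ξ ^ 3 * (‖ξ‖ * ‖k‖) := by
            gcongr
            · exact hSq ξ
            · exact abs_real_inner_le_norm _ _
        _ = ‖S‖ * (invJap ξ * ‖ξ‖) * ‖k‖ * (‖ξ‖ * invJap ξ) ^ 2 := by ring
        _ ≤ ‖S‖ * (invJap ξ * ‖ξ‖) * ‖k‖ * 1 := by
            gcongr
            exact pow_le_one₀ (by positivity) hxJ
        _ = _ := by ring
    have h2 : |⟪S ξ, k⟫_ℝ| ≤ ‖S‖ * ‖ξ‖ * ‖k‖ :=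
      (abs_real_inner_le_norm _ _).trans (by gcongr; exact S.le_opNorm ξ)
    have h3 : |⟪S k, ξ⟫_ℝ| ≤ ‖S‖ * ‖ξ‖ * ‖k‖ :=
      (abs_real_inner_le_norm _ _).trans (by
        have := mul_le_mul_of_nonneg_right (S.le_opNorm k) (norm_nonneg ξ)
        linarith)
    calc _ ≤ ‖S‖ * (invJap ξ * ‖ξ‖) * ‖k‖ + invJap ξ * (‖S‖ * ‖ξ‖ * ‖k‖ + ‖S‖ * ‖ξ‖ * ‖k‖) := by
          refine (abs_add_le _ _).trans (add_le_add ?_ ?_)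
          · rwa [abs_neg]
          · rw [abs_mul, abs_of_pos hJ]
            gcongr
            exact (abs_add_le _ _).trans (add_le_add h2 h3)
      _ = _ := by ring
  have hnorm : ∀ ξ, ‖V' ξ‖ ≤ 3 * ‖ξ‖ := by
    intro ξ
    refine ContinuousLinearMap.opNorm_le_bound _ (by positivity) fun k => ?_
    rw [hV'app, Real.norm_eq_abs]
    have h1 := hcorr ξ k
    have h2 : |2 * ⟪ξ, k⟫_ℝ| ≤ 2 * (‖ξ‖ * ‖k‖) := by
      rw [abs_mul, abs_two]; gcongr; exact abs_real_inner_le_norm _ _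
    refine (abs_add_le _ _).trans ?_
    rw [abs_mul l, abs_of_pos hl]
    have h3 : invJap ξ * ‖ξ‖ ≤ ‖ξ‖ := mul_le_of_le_one_left (norm_nonneg _) (invJap_le_one ξ)
    have h4 : l * (3 * ‖S‖ * (invJap ξ * ‖ξ‖) * ‖k‖) ≤ l * (3 * ‖S‖ * ‖ξ‖ * ‖k‖) := by gcongr
    have h5 := mul_le_mul_of_nonneg_left h1 hl.le
    nlinarith [mul_nonneg (norm_nonneg ξ) (norm_nonneg k),
      mul_le_mul_of_nonneg_right hS1 (mul_nonneg (norm_nonneg ξ) (norm_nonneg k))]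
  have hdecay : ∀ ξ, V' ξ (g ξ) ≤ -(l / 2) * (invJap ξ * ‖ξ‖ ^ 2) := by
    intro ξ
    have hJ := invJap_pos ξ
    have hA : V' ξ (A ξ) ≤ l * (invJap ξ * (2 * ⟪β, ξ⟫_ℝ ^ 2 - ‖ξ‖ ^ 2)) := by
      rw [hV'app, h.skew ξ]
      have := h.dissipation ξ
      simp only [mul_zero, neg_zero, zero_add]
      gcongr
      linarith
    have hB : V' ξ β = 2 * ⟪β, ξ⟫_ℝ + l * (-(⟪S ξ, ξ⟫_ℝ * invJap ξ ^ 3 * ⟪ξ, β⟫_ℝ) +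
      invJap ξ * (⟪S ξ, β⟫_ℝ + ⟪S β, ξ⟫_ℝ)) := by rw [hV'app, real_inner_comm]
    have hc := hcorr ξ β
    set c := -(⟪S ξ, ξ⟫_ℝ * invJap ξ ^ 3 * ⟪ξ, β⟫_ℝ) +
      invJap ξ * (⟪S ξ, β⟫_ℝ + ⟪S β, ξ⟫_ℝ) with hcdef
    have hbx : |⟪β, ξ⟫_ℝ| ≤ ‖β‖ * ‖ξ‖ := abs_real_inner_le_norm _ _
    have h1 : -(⟪β, ξ⟫_ℝ * c) ≤ (‖β‖ * ‖ξ‖) * (3 * ‖S‖ * (invJap ξ * ‖ξ‖) * ‖β‖) := by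
      refine (neg_le_abs _).trans ?_
      rw [abs_mul]
      gcongr
    have h2 : V' ξ (g ξ) = V' ξ (A ξ) - l * (⟪β, ξ⟫_ℝ * invJap ξ) * V' ξ β := by
      simp only [hg, map_sub, map_smul, smul_eq_mul]
    rw [h2, hB]
    have h3 : l * (⟪β, ξ⟫_ℝ * invJap ξ) * (2 * ⟪β, ξ⟫_ℝ + l * c) =
        l * (invJap ξ * (2 * ⟪β, ξ⟫_ℝ ^ 2)) + l * l * invJap ξ * (⟪β, ξ⟫_ℝ * c) := by ring
    have h4 : l * l * invJap ξ * -(⟪β, ξ⟫_ℝ * c) ≤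
        l * l * invJap ξ * ((‖β‖ * ‖ξ‖) * (3 * ‖S‖ * (invJap ξ * ‖ξ‖) * ‖β‖)) := by gcongr
    have h5 : l * l * invJap ξ * ((‖β‖ * ‖ξ‖) * (3 * ‖S‖ * (invJap ξ * ‖ξ‖) * ‖β‖)) ≤
        l / 2 * (invJap ξ * ‖ξ‖ ^ 2) := by
      calc _ = (6 * l * (‖S‖ * ‖β‖ ^ 2)) * (invJap ξ * (l / 2 * (invJap ξ * ‖ξ‖ ^ 2))) := by ring
        _ ≤ 1 * (1 * (l / 2 * (invJap ξ * ‖ξ‖ ^ 2))) := by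
          gcongr
          exact invJap_le_one ξ
        _ = _ := by ring
    nlinarith
  obtain ⟨T, hT, hfin⟩ := hξ.eventually_le_of_lyapunov hgc he hV (ρ := 2 * r ^ 2)
    (c := 3 * η * r) (by positivity) (by
      intro ξ hξ
      have hJ := invJap_pos ξ
      have hq := hSq ξ
      have hxr : r ≤ ‖ξ‖ := by
        have h1 : l * (⟪S ξ, ξ⟫_ℝ * invJap ξ) ≤ ‖ξ‖ ^ 2 := by
          have h2 : ⟪S ξ, ξ⟫_ℝ * invJap ξ ≤ ‖S‖ * ‖ξ‖ ^ 2 * 1 :=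
            (mul_le_mul_of_nonneg_right ((le_abs_self _).trans hq) hJ.le).trans
              (mul_le_mul_of_nonneg_left (invJap_le_one ξ) (by positivity))
          nlinarith [mul_le_mul_of_nonneg_left h2 hl.le, sq_nonneg ‖ξ‖,
            mul_nonneg hl.le (norm_nonneg S)]
        have h2 : r ^ 2 ≤ ‖ξ‖ ^ 2 := by simp only [hVdef] at hξ; linarith
        exact (sq_le_sq₀ hr0.le (norm_nonneg _)).1 h2
      -- `‖ξ‖ (1 + ‖ξ‖²)^(-1/2)` is at least `r / 2`, since `r ≤ 1` and `r ≤ ‖ξ‖`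
      have hsat : r / 2 ≤ invJap ξ * ‖ξ‖ := by
        have h1 := invJap_sq ξ
        have h2 : (r / 2) ^ 2 ≤ (invJap ξ * ‖ξ‖) ^ 2 := by
          have h3 : r ^ 2 ≤ ‖ξ‖ ^ 2 := by gcongr
          have h4 : r ^ 2 ≤ 1 := pow_le_one₀ hr0.le hr1
          have h5 : r ^ 2 * (1 + ‖ξ‖ ^ 2) ≤ 4 * ‖ξ‖ ^ 2 := by nlinarith [sq_nonneg ‖ξ‖]
          have h6 : invJap ξ ^ 2 * (r ^ 2 * (1 + ‖ξ‖ ^ 2)) ≤ invJap ξ ^ 2 * (4 * ‖ξ‖ ^ 2) := by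
            gcongr
          have h7 : invJap ξ ^ 2 * (r ^ 2 * (1 + ‖ξ‖ ^ 2)) = r ^ 2 := by
            calc _ = r ^ 2 * (invJap ξ ^ 2 * (1 + ‖ξ‖ ^ 2)) := by ring
              _ = _ := by rw [h1, mul_one]
          nlinarith
        exact (sq_le_sq₀ (by positivity) (by positivity)).1 h2
      have h1 := hdecay ξ
      have h2 := mul_le_mul_of_nonneg_right (hnorm ξ) hη.le
      have h3 : l * r = 24 * η := by rw [hr]; field_simp
      have h4 : 6 * η * ‖ξ‖ ≤ l / 2 * (invJap ξ * ‖ξ‖ ^ 2) := by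
        calc 6 * η * ‖ξ‖ = l / 2 * (r / 2 * ‖ξ‖) := by rw [show η = l * r / 24 by linarith]; ring
          _ ≤ l / 2 * (invJap ξ * ‖ξ‖ * ‖ξ‖) := by gcongr
          _ = _ := by ring
      have h5 : 3 * η * r ≤ 3 * η * ‖ξ‖ := by gcongr
      linarith)
  refine ⟨T, hT, fun t ht => ?_⟩
  have h1 := hfin t ht
  have hJ := invJap_pos (ξ t)
  have h2 : -(‖ξ t‖ ^ 2 / 2) ≤ l * (⟪S (ξ t), ξ t⟫_ℝ * invJap (ξ t)) := by
    have h3 : -(‖S‖ * ‖ξ t‖ ^ 2 * 1) ≤ ⟪S (ξ t), ξ t⟫_ℝ * invJap (ξ t) := by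
      refine le_trans ?_ (neg_abs_le _)
      rw [abs_mul, abs_of_pos hJ]
      gcongr
      · exact hSq _
      · exact invJap_le_one _
    nlinarith [mul_le_mul_of_nonneg_left h3 hl.le, sq_nonneg ‖ξ t‖,
      mul_nonneg hl.le (norm_nonneg S)]
  have h3 : ‖ξ t‖ ^ 2 ≤ (48 * η / l) ^ 2 := by
    have : 48 * η / l = 2 * r := by rw [hr]; ring
    rw [this]
    simp only [hVdef] at h1
    nlinarith
  exact (sq_le_sq₀ (norm_nonneg _) (by positivity)).1 h3

/-- The damped block has no imaginary eigenvalue, stated over the reals. -/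
theorem IsDampedBlock.eq_zero_of_sq_eq {A : W →L[ℝ] W} {β : W} {S : W →L[ℝ] W}
    (h : IsDampedBlock A β S) {l : ℝ} (hl : 0 < l) {ν : ℝ} {ξ η : W}
    (h1 : η = A ξ - (l * ⟪β, ξ⟫_ℝ) • β) (h2 : A η - (l * ⟪β, η⟫_ℝ) • β = -(ν ^ 2) • ξ) :
    ξ = 0 := by
  -- the energy `ν² ‖ξ‖² + ‖η‖²` shows that the damping is not active
  have e1 : ⟪ξ, η⟫_ℝ = -(l * ⟪β, ξ⟫_ℝ ^ 2) := by
    rw [h1, inner_sub_right, h.skew, inner_smul_right, real_inner_comm]; ring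
  have e2 : -(ν ^ 2) * ⟪ξ, η⟫_ℝ = -(l * ⟪β, η⟫_ℝ ^ 2) := by
    have h3 : ⟪η, A η - (l * ⟪β, η⟫_ℝ) • β⟫_ℝ = -(l * ⟪β, η⟫_ℝ ^ 2) := by
      rw [inner_sub_right, h.skew, inner_smul_right, real_inner_comm]; ring
    rw [h2, inner_smul_right, real_inner_comm] at h3
    exact h3
  have e3 : ν ^ 2 * ⟪β, ξ⟫_ℝ ^ 2 + ⟪β, η⟫_ℝ ^ 2 = 0 := by
    rw [e1] at e2
    have : l * (ν ^ 2 * ⟪β, ξ⟫_ℝ ^ 2 + ⟪β, η⟫_ℝ ^ 2) = 0 := by linarith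
    exact (mul_eq_zero.1 this).resolve_left hl.ne'
  have e4 : ⟪β, η⟫_ℝ = 0 := by nlinarith [sq_nonneg (ν * ⟪β, ξ⟫_ℝ), sq_nonneg ⟪β, η⟫_ℝ]
  have hAη : A η = -(ν ^ 2) • ξ := by rw [← h2, e4]; simp
  have key : ∀ ζ : W, ⟪β, ζ⟫_ℝ = 0 → A ζ = 0 → ζ = 0 := by
    intro ζ hb hA
    have := h.dissipation ζ
    rw [hA, hb] at this
    simp only [map_zero, inner_zero_left, inner_zero_right] at this
    have h0 : ‖ζ‖ ^ 2 = 0 := le_antisymm (by linarith) (sq_nonneg _)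
    simpa using h0
  by_cases hν : ν = 0
  · have hη0 : η = 0 := key η e4 (by rw [hAη, hν]; simp)
    have e5 : ⟪β, ξ⟫_ℝ = 0 := by
      rw [hη0, inner_zero_right] at e1
      have : l * ⟪β, ξ⟫_ℝ ^ 2 = 0 := by linarith
      simpa using (mul_eq_zero.1 this).resolve_left hl.ne'
    refine key ξ e5 ?_
    rw [hη0, e5] at h1
    simpa using h1.symm
  · have e5 : ⟪β, ξ⟫_ℝ = 0 := by
      have : (ν * ⟪β, ξ⟫_ℝ) ^ 2 = 0 := by nlinarith [sq_nonneg (ν * ⟪β, ξ⟫_ℝ), sq_nonneg ⟪β, η⟫_ℝ]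
      exact (mul_eq_zero.1 (pow_eq_zero_iff (two_ne_zero) |>.1 this)).resolve_left hν
    have hAξ : A ξ = η := by rw [h1, e5]; simp
    have d1 := h.dissipation ξ
    have d2 := h.dissipation η
    rw [hAξ, e5] at d1
    rw [hAη, e4] at d2
    simp only [map_smul, inner_smul_left, inner_smul_right] at d2
    simp only [map_neg, map_pow, conj_trivial] at d2
    have : ν ^ 2 * ‖ξ‖ ^ 2 ≤ 0 := by
      nlinarith [sq_nonneg ‖η‖, mul_le_mul_of_nonneg_left d1 (sq_nonneg ν)]
    have h0 : ‖ξ‖ ^ 2 = 0 := by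
      have hν2 : 0 < ν ^ 2 := by positivity
      nlinarith [sq_nonneg ‖ξ‖]
    simpa using h0

/-- The scalar integrator `ξ' = v`. -/
theorem isDampedBlock_real : IsDampedBlock (0 : ℝ →L[ℝ] ℝ) 1 0 where
  skew ξ := by simp
  dissipation ξ := by
    simp
    nlinarith [sq_nonneg ξ]

/-- Multiplication by `i ω` as a real-linear map of `ℂ`. -/
noncomputable def rotationCLM (ω : ℝ) : ℂ →L[ℝ] ℂ :=
  ContinuousLinearMap.mul ℝ ℂ (Complex.I * ω)

/-- The oscillator `ξ' = i ω ξ + v`; the correction is `Re ξ * Im ξ / ω`. -/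
theorem isDampedBlock_complex {ω : ℝ} (hω : ω ≠ 0) :
    IsDampedBlock (rotationCLM ω) 1 ((1 / ω) • Complex.ofRealCLM.comp Complex.imCLM) where
  skew ξ := by
    simp [rotationCLM, Complex.inner]
    ring
  dissipation ξ := by
    rw [← Complex.normSq_eq_norm_sq, Complex.normSq_apply]
    simp [rotationCLM, Complex.inner]
    field_simp
    nlinarith

end CriticalBlock

/-! ### Bounds on the successive derivatives of a curve -/

section Jets

open scoped InnerProductSpace ContDiff

variable {F G : Type*} [NormedAddCommGroup F] [NormedSpace ℝ F] [NormedAddCommGroup G]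
  [NormedSpace ℝ G]

/-- Geometric bounds on the derivatives up to order `n`, at time `t`, of a curve on `[0, ∞)`. -/
def JetBound (n : ℕ) (f : ℝ → F) (t a D : ℝ) : Prop :=
  ∀ k ≤ n, ‖iteratedDerivWithin k f (Ici 0) t‖ ≤ a * D ^ k

theorem JetBound.mono {n : ℕ} {f : ℝ → F} {t a a' D D' : ℝ} (h : JetBound n f t a D)
    (ha : a ≤ a') (ha0 : 0 ≤ a') (hD0 : 0 ≤ D) (hD : D ≤ D') : JetBound n f t a' D' :=
  fun k hk => (h k hk).trans (by gcongr)

theorem JetBound.congr {n : ℕ} {f g : ℝ → F} {t a D : ℝ} (h : JetBound n f t a D)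
    (ht : 0 ≤ t) (hfg : EqOn f g (Ici 0)) : JetBound n g t a D := fun k hk => by
  rw [← iteratedDerivWithin_congr hfg ht]
  exact h k hk

/-- A constant factor is moved into the rate `D`; the order zero, where this is impossible, is
bounded separately. -/
theorem JetBound.absorb {n : ℕ} {f : ℝ → F} {t m c D : ℝ} (h : JetBound n f t (m * c) D)
    (hm : 1 ≤ m) (hc : ‖f t‖ ≤ c) (hD : 0 ≤ D) : JetBound n f t c (m * D) := fun k hk => by
  have hc0 : 0 ≤ c := (norm_nonneg _).trans hc
  rcases k with _ | k
  · simpa using hc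
  · refine (h _ hk).trans ?_
    rw [mul_pow]
    calc m * c * D ^ (k + 1) = c * (m * D ^ (k + 1)) := by ring
      _ ≤ c * (m ^ (k + 1) * D ^ (k + 1)) := by
          gcongr
          exact le_self_pow₀ hm (by omega)

theorem JetBound.add {n : ℕ} {f g : ℝ → F} {t a b D : ℝ} (hf : JetBound n f t a D)
    (hg : JetBound n g t b D) (ht : 0 ≤ t) (cf : ContDiffOn ℝ ∞ f (Ici 0))
    (cg : ContDiffOn ℝ ∞ g (Ici 0)) : JetBound n (fun s => f s + g s) t (a + b) D := fun k hk => by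
  have hk' : (k : WithTop ℕ∞) ≤ ∞ := by exact_mod_cast le_top
  have ht' : t ∈ Ici (0 : ℝ) := ht
  rw [iteratedDerivWithin_fun_add ht' (uniqueDiffOn_Ici 0) ((cf.of_le hk') t ht)
    ((cg.of_le hk') t ht), add_mul]
  exact (norm_add_le _ _).trans (add_le_add (hf k hk) (hg k hk))

theorem jetBound_const (n : ℕ) (c : F) (t : ℝ) {D : ℝ} (hD : 0 ≤ D) :
    JetBound n (fun _ => c) t ‖c‖ D := fun k hk => by
  rw [iteratedDerivWithin_const]
  split_ifs with h
  · simp [h]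
  · simp; positivity

theorem iteratedDerivWithin_clm_comp {f : ℝ → F} {t : ℝ} (ht : 0 ≤ t)
    (cf : ContDiffOn ℝ ∞ f (Ici 0)) (L : F →L[ℝ] G) (k : ℕ) :
    iteratedDerivWithin k (fun s => L (f s)) (Ici 0) t =
      L (iteratedDerivWithin k f (Ici 0) t) := by
  have hk' : (k : WithTop ℕ∞) ≤ ∞ := by exact_mod_cast le_top
  have h := L.iteratedFDerivWithin_comp_left (cf.of_le hk' t ht) (uniqueDiffOn_Ici 0) ht le_rfl
  simp only [iteratedDerivWithin]
  change (iteratedFDerivWithin ℝ k (L ∘ f) (Ici 0) t) _ = _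
  rw [h]; rfl

theorem JetBound.clm {n : ℕ} {f : ℝ → F} {t a D : ℝ} (hf : JetBound n f t a D) (ht : 0 ≤ t)
    (cf : ContDiffOn ℝ ∞ f (Ici 0)) (L : F →L[ℝ] G) :
    JetBound n (fun s => L (f s)) t (‖L‖ * a) D := fun k hk => by
  rw [iteratedDerivWithin_clm_comp ht cf, mul_assoc]
  exact L.le_opNorm_of_le (hf k hk)

theorem JetBound.bilin {H : Type*} [NormedAddCommGroup H] [NormedSpace ℝ H]
    {n : ℕ} {f : ℝ → F} {g : ℝ → G} {t a b D D' : ℝ}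
    (hf : JetBound n f t a D) (hg : JetBound n g t b D') (ht : 0 ≤ t)
    (cf : ContDiffOn ℝ ∞ f (Ici 0)) (cg : ContDiffOn ℝ ∞ g (Ici 0))
    (B : F →L[ℝ] G →L[ℝ] H) (hB : ‖B‖ ≤ 1) :
    JetBound n (fun s => B (f s) (g s)) t (a * b) (D + D') := fun k hk => by
  have hk' : (k : WithTop ℕ∞) ≤ ∞ := by exact_mod_cast le_top
  rw [← norm_iteratedFDerivWithin_eq_norm_iteratedDerivWithin]
  refine (B.norm_iteratedFDerivWithin_le_of_bilinear_of_le_one cf cg (uniqueDiffOn_Ici 0) ht hk'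
    hB).trans ?_
  rw [add_pow, Finset.mul_sum]
  refine Finset.sum_le_sum fun i hi => ?_
  rw [norm_iteratedFDerivWithin_eq_norm_iteratedDerivWithin,
    norm_iteratedFDerivWithin_eq_norm_iteratedDerivWithin]
  have hi' : i ≤ k := by simpa [Nat.lt_succ_iff] using hi
  have h1 := hf i (hi'.trans hk)
  have h2 := hg (k - i) ((Nat.sub_le _ _).trans hk)
  calc _ ≤ (k.choose i : ℝ) * (a * D ^ i) * (b * D' ^ (k - i)) := by
        gcongr
        exact mul_nonneg (Nat.cast_nonneg _) ((norm_nonneg _).trans h1)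
    _ = _ := by ring

theorem JetBound.mul {n : ℕ} {f g : ℝ → ℝ} {t a b D D' : ℝ}
    (hf : JetBound n f t a D) (hg : JetBound n g t b D') (ht : 0 ≤ t)
    (cf : ContDiffOn ℝ ∞ f (Ici 0)) (cg : ContDiffOn ℝ ∞ g (Ici 0)) :
    JetBound n (fun s => f s * g s) t (a * b) (D + D') := by
  have := hf.bilin hg ht cf cg (ContinuousLinearMap.mul ℝ ℝ) (by simp)
  simpa using this

/-- Real powers. The function is normalised to equal `1` at the time under consideration, where the
derivatives of `u ↦ u ^ s` are constants. -/
theorem exists_jetBound_rpow (N : ℕ) (s : ℝ) :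
    ∃ C : ℝ, 0 < C ∧ ∀ n ≤ N, ∀ (φ : ℝ → ℝ) (t D : ℝ), 0 ≤ t → 0 ≤ D → ContDiffOn ℝ ∞ φ (Ici 0) →
      (∀ τ, 0 ≤ τ → 0 < φ τ) →
      (∀ k, 1 ≤ k → k ≤ n → ‖iteratedDerivWithin k φ (Ici 0) t‖ ≤ φ t * D ^ k) →
      JetBound n (fun τ => φ τ ^ s) t (C * φ t ^ s) D := by
  set c : ℕ → ℝ := fun k => ‖iteratedFDerivWithin ℝ k (fun u : ℝ => u ^ s) (Ioi 0) 1‖ with hc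
  set C₀ : ℝ := ∑ k ∈ Finset.range (N + 1), c k with hC₀
  have hc0 : ∀ k, 0 ≤ c k := fun k => norm_nonneg _
  have hcC : ∀ k ≤ N, c k ≤ C₀ + 1 := fun k hk => by
    have := Finset.single_le_sum (f := c) (fun i _ => hc0 i)
      (Finset.mem_range.2 (Nat.lt_succ_of_le hk))
    linarith
  have hC₀0 : 0 ≤ C₀ := Finset.sum_nonneg fun i _ => hc0 i
  refine ⟨(Nat.factorial N : ℝ) * (C₀ + 1), by positivity, fun n hn φ t D ht hD cφ hpos hφ k hk => ?_⟩
  have hk' : (k : WithTop ℕ∞) ≤ ∞ := by exact_mod_cast le_top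
  have hφt := hpos t ht
  set ψ : ℝ → ℝ := fun τ => (φ t)⁻¹ * φ τ with hψ
  have cψ : ContDiffOn ℝ ∞ ψ (Ici 0) := contDiffOn_const.mul cφ
  have hrp : ContDiffOn ℝ ∞ (fun u : ℝ => u ^ s) (Ioi 0) := fun u hu =>
    (Real.contDiffAt_rpow_const_of_ne (ne_of_gt hu)).contDiffWithinAt
  have hmaps : MapsTo ψ (Ici 0) (Ioi 0) := fun τ hτ => by
    have := hpos τ hτ
    simp only [hψ, mem_Ioi]; positivity
  have hψt : ψ t = 1 := by simp [hψ, hφt.ne']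
  have key := norm_iteratedFDerivWithin_comp_le (n := k) (N := ∞) hrp cψ hk' (uniqueDiffOn_Ioi 0)
    (uniqueDiffOn_Ici 0) hmaps ht (C := C₀ + 1) (D := D)
    (fun i hi => by
      rw [hψt]; exact hcC i (hi.trans (hk.trans hn)))
    (fun i hi1 hi => by
      rw [norm_iteratedFDerivWithin_eq_norm_iteratedDerivWithin]
      have hi' : (i : WithTop ℕ∞) ≤ ∞ := by exact_mod_cast le_top
      rw [hψ, iteratedDerivWithin_const_mul_field, norm_mul,
        Real.norm_of_nonneg (inv_nonneg.2 hφt.le), inv_mul_le_iff₀ hφt]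
      exact hφ i hi1 (hi.trans hk))
  rw [norm_iteratedFDerivWithin_eq_norm_iteratedDerivWithin] at key
  have hEq : EqOn (fun τ => φ τ ^ s) (fun τ => φ t ^ s * ψ τ ^ s) (Ici 0) := fun τ hτ => by
    have := hpos τ hτ
    simp only [hψ]
    rw [← Real.mul_rpow hφt.le (by positivity)]
    congr 1
    field_simp
  rw [iteratedDerivWithin_congr hEq ht, iteratedDerivWithin_const_mul_field, norm_mul,
    Real.norm_of_nonneg (Real.rpow_nonneg hφt.le s)]
  have hfac : (Nat.factorial k : ℝ) ≤ (Nat.factorial N : ℝ) := by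
    exact_mod_cast Nat.factorial_le (hk.trans hn)
  calc _ ≤ φ t ^ s * ((Nat.factorial k : ℝ) * (C₀ + 1) * D ^ k) := by
        gcongr
        exact key
    _ ≤ φ t ^ s * ((Nat.factorial N : ℝ) * (C₀ + 1) * D ^ k) := by
        have := Real.rpow_nonneg hφt.le s
        gcongr
    _ = _ := by ring

/-- Powers of `1 + ‖y‖²` along a curve whose derivatives are controlled by `(1 + ‖y‖²)^(1/2)`. -/
theorem exists_jetBound_one_add_norm_sq_rpow.{u} (N : ℕ) (s : ℝ) :
    ∃ C : ℝ, 0 < C ∧ ∀ {H : Type u} [NormedAddCommGroup H] [InnerProductSpace ℝ H],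
      ∀ n ≤ N, ∀ (y : ℝ → H) (t D : ℝ), 0 ≤ t → 0 ≤ D → ContDiffOn ℝ ∞ y (Ici 0) →
      JetBound n y t √(1 + ‖y t‖ ^ 2) D →
      JetBound n (fun τ => (1 + ‖y τ‖ ^ 2) ^ s) t (C * (1 + ‖y t‖ ^ 2) ^ s) (4 * D) := by
  obtain ⟨C, hC, h⟩ := exists_jetBound_rpow N s
  refine ⟨C, hC, fun {H} _ _ n hn y t D ht hD cy hy => ?_⟩
  have hsq : √(1 + ‖y t‖ ^ 2) * √(1 + ‖y t‖ ^ 2) = 1 + ‖y t‖ ^ 2 :=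
    Real.mul_self_sqrt (by positivity)
  have h1 := hy.bilin hy ht cy cy (innerSL ℝ) (norm_innerSL_le ℝ)
  have h2 : JetBound n (fun τ => ‖y τ‖ ^ 2) t (1 + ‖y t‖ ^ 2) (D + D) := by
    rw [hsq] at h1
    refine h1.congr ht fun τ _ => ?_
    exact real_inner_self_eq_norm_sq _
  have cy2 : ContDiffOn ℝ ∞ (fun τ => ‖y τ‖ ^ 2) (Ici 0) := cy.norm_sq ℝ
  have h3 := (jetBound_const n (1 : ℝ) t (add_nonneg hD hD)).add h2 ht contDiffOn_const cy2
  refine h n hn _ t (4 * D) ht (by positivity) (contDiffOn_const.add cy2)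
    (fun τ _ => by positivity) fun k hk1 hk => ?_
  refine (h3 k hk).trans ?_
  have h4 : 4 * D = 2 * (D + D) := by ring
  have h5 : (2 : ℝ) ≤ 2 ^ k := le_self_pow₀ (by norm_num) (by omega)
  have h6 : ‖(1 : ℝ)‖ + (1 + ‖y t‖ ^ 2) ≤ 2 * (1 + ‖y t‖ ^ 2) := by
    rw [norm_one]; nlinarith [sq_nonneg ‖y t‖]
  rw [h4, mul_pow]
  calc _ ≤ 2 * (1 + ‖y t‖ ^ 2) * (D + D) ^ k := by gcongr
    _ = (1 + ‖y t‖ ^ 2) * (2 * (D + D) ^ k) := by ring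
    _ ≤ _ := by gcongr

/-- The derivatives of a solution of `x' = A x + r` are controlled by those of `r` of lower order. -/
theorem jetBound_of_hasDerivWithinAt {A : F →L[ℝ] F} {x r : ℝ → F}
    (cx : ContDiffOn ℝ ∞ x (Ici 0)) (cr : ContDiffOn ℝ ∞ r (Ici 0))
    (hx : ∀ t, 0 ≤ t → HasDerivWithinAt x (A (x t) + r t) (Ici 0) t) {n : ℕ} {t a D : ℝ}
    (ht : 0 ≤ t) (ha : 0 ≤ a) (hD : 0 ≤ D)
    (hr : ∀ k < n, ‖iteratedDerivWithin k r (Ici 0) t‖ ≤ a * D ^ k) :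
    JetBound n x t (‖x t‖ + a) (‖A‖ + 1 + D) := by
  intro k
  induction k with
  | zero => intro _; simpa using ha
  | succ k ih =>
    intro hk
    have hk' : (k : WithTop ℕ∞) ≤ ∞ := by exact_mod_cast le_top
    have ht' : t ∈ Ici (0 : ℝ) := ht
    have hEq : EqOn (derivWithin x (Ici 0)) (fun s => A (x s) + r s) (Ici 0) := fun s hs =>
      (hx s hs).derivWithin (uniqueDiffOn_Ici 0 s hs)
    rw [iteratedDerivWithin_succ', iteratedDerivWithin_congr hEq ht,
      iteratedDerivWithin_fun_add (f := fun s => A (x s)) ht' (uniqueDiffOn_Ici 0)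
        (A.contDiff.comp_contDiffOn (cx.of_le hk') t ht) (cr.of_le hk' t ht),
      iteratedDerivWithin_clm_comp ht cx]
    have h1 := A.le_opNorm_of_le (ih (by omega))
    have h2 := hr k (by omega)
    set C := ‖A‖ + 1 + D with hC
    have hC1 : D ≤ C := by have := norm_nonneg A; linarith
    have h3 : D ^ k ≤ C ^ k := by gcongr
    have hC0 : 0 ≤ C ^ k := by positivity
    calc _ ≤ ‖A‖ * ((‖x t‖ + a) * C ^ k) + a * D ^ k := (norm_add_le _ _).trans (add_le_add h1 h2)
      _ ≤ ‖A‖ * ((‖x t‖ + a) * C ^ k) + (‖x t‖ + a) * C ^ k := by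
          gcongr
          have := norm_nonneg (x t)
          linarith
      _ = (‖A‖ + 1) * ((‖x t‖ + a) * C ^ k) := by ring
      _ ≤ C * ((‖x t‖ + a) * C ^ k) := by
          gcongr; linarith
      _ = _ := by ring

end Jets

/-! ### Smoothness of solutions -/

section SmoothSolutions

open scoped ContDiff

variable {E : Type*} [NormedAddCommGroup E] [NormedSpace ℝ E] [CompleteSpace E]

theorem IsSolution.hasDerivWithinAt {G : E → E} (hG : Continuous G) {x : ℝ → E}
    (hx : IsSolution (fun _ => G) x) {t : ℝ} (ht : 0 ≤ t) :
    HasDerivWithinAt x (G (x t)) (Ici 0) t := by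
  have hc : Continuous fun s : ℝ => G (x (max s 0)) :=
    hG.comp (hx.continuousOn.comp_continuous (f := fun t : ℝ => max t 0) (by fun_prop)
      (fun t => le_max_right t 0))
  have h1 := (intervalIntegral.integral_hasDerivAt_right (hc.intervalIntegrable 0 t)
    (hc.stronglyMeasurableAtFilter _ _) hc.continuousAt).const_add (x 0)
  rw [max_eq_left ht] at h1
  refine h1.hasDerivWithinAt.congr_of_mem (fun s hs => ?_) ht
  rw [(hx s hs).2]
  congr 1
  refine intervalIntegral.integral_congr fun u hu => ?_
  rw [uIcc_of_le hs] at hu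
  simp [max_eq_left hu.1]

theorem IsSolution.contDiffOn {G : E → E} (hG : ContDiff ℝ ∞ G) {x : ℝ → E}
    (hx : IsSolution (fun _ => G) x) : ContDiffOn ℝ ∞ x (Ici 0) := by
  rw [contDiffOn_infty]
  intro n
  induction n with
  | zero => simpa using hx.continuousOn
  | succ n ih =>
    push_cast
    rw [contDiffOn_succ_iff_derivWithin (uniqueDiffOn_Ici 0)]
    have hd := fun t (ht : (0 : ℝ) ≤ t) => hx.hasDerivWithinAt hG.continuous ht
    refine ⟨fun t ht => (hd t ht).differentiableWithinAt, by simp, ?_⟩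
    refine ((hG.of_le (by exact_mod_cast le_top)).comp_contDiffOn ih).congr fun t ht => ?_
    exact (hd t ht).derivWithin (uniqueDiffOn_Ici 0 t ht)

end SmoothSolutions

/-! ### Bounded Lipschitz functions -/

section BoundedLipschitz

open scoped InnerProductSpace

variable {E E' : Type*} [NormedAddCommGroup E]

/-- Bounded and globally Lipschitz real functions, with one constant for both bounds. -/
def BoundedLipschitz (f : E → ℝ) : Prop :=
  ∃ C : ℝ, 0 ≤ C ∧ (∀ x, |f x| ≤ C) ∧ ∀ x y, |f x - f y| ≤ C * ‖x - y‖

theorem BoundedLipschitz.add {f g : E → ℝ} (hf : BoundedLipschitz f) (hg : BoundedLipschitz g) :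
    BoundedLipschitz fun x => f x + g x := by
  obtain ⟨C, hC, h1, h2⟩ := hf
  obtain ⟨D, hD, h3, h4⟩ := hg
  refine ⟨C + D, by positivity, fun x => (abs_add_le _ _).trans (add_le_add (h1 x) (h3 x)),
    fun x y => ?_⟩
  rw [add_sub_add_comm, add_mul]
  exact (abs_add_le _ _).trans (add_le_add (h2 x y) (h4 x y))

theorem BoundedLipschitz.mul {f g : E → ℝ} (hf : BoundedLipschitz f) (hg : BoundedLipschitz g) :
    BoundedLipschitz fun x => f x * g x := by
  obtain ⟨C, hC, h1, h2⟩ := hf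
  obtain ⟨D, hD, h3, h4⟩ := hg
  refine ⟨2 * (C * D) , by positivity, fun x => ?_, fun x y => ?_⟩
  · rw [abs_mul]
    nlinarith [mul_le_mul (h1 x) (h3 x) (abs_nonneg _) hC, mul_nonneg hC hD]
  · have : f x * g x - f y * g y = f x * (g x - g y) + (f x - f y) * g y := by ring
    rw [this]
    refine (abs_add_le _ _).trans ?_
    rw [abs_mul, abs_mul]
    have h5 := mul_le_mul (h1 x) (h4 x y) (abs_nonneg _) hC
    have h6 := mul_le_mul (h2 x y) (h3 y) (abs_nonneg _) (by positivity)
    linarith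

theorem boundedLipschitz_const (c : ℝ) : BoundedLipschitz fun _ : E => c :=
  ⟨|c|, abs_nonneg c, fun _ => le_rfl, fun x y => by simp; positivity⟩

theorem BoundedLipschitz.pow {f : E → ℝ} (hf : BoundedLipschitz f) (m : ℕ) :
    BoundedLipschitz fun x => f x ^ m := by
  induction m with
  | zero => simpa using boundedLipschitz_const 1
  | succ m ih => simpa [pow_succ] using ih.mul hf

variable [NormedSpace ℝ E] [NormedAddCommGroup E'] [NormedSpace ℝ E']

theorem BoundedLipschitz.comp_clm {f : E' → ℝ} (hf : BoundedLipschitz f) (L : E →L[ℝ] E') :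
    BoundedLipschitz fun x => f (L x) := by
  obtain ⟨C, hC, h1, h2⟩ := hf
  refine ⟨C + C * ‖L‖, by positivity, fun x => (h1 _).trans (by nlinarith [norm_nonneg L]),
    fun x y => (h2 _ _).trans ?_⟩
  rw [← map_sub]
  have := mul_le_mul_of_nonneg_left (L.le_opNorm (x - y)) hC
  nlinarith [mul_nonneg hC (norm_nonneg (x - y))]

/-- `f` times a vector, added to a linear map, is globally Lipschitz. -/
theorem BoundedLipschitz.exists_lipschitz {f : E → ℝ} (hf : BoundedLipschitz f) (A : E →L[ℝ] E)
    (b : E) : ∃ K : ℝ, 0 ≤ K ∧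
      ∀ x y, ‖(A x + f x • b) - (A y + f y • b)‖ ≤ K * ‖x - y‖ := by
  obtain ⟨C, hC, -, h2⟩ := hf
  refine ⟨‖A‖ + C * ‖b‖, by positivity, fun x y => ?_⟩
  rw [add_sub_add_comm, ← map_sub, ← sub_smul]
  refine (norm_add_le _ _).trans ?_
  rw [norm_smul, Real.norm_eq_abs, add_mul]
  refine add_le_add (A.le_opNorm _) ?_
  have := mul_le_mul_of_nonneg_right (h2 x y) (norm_nonneg b)
  linarith

variable {W : Type*} [NormedAddCommGroup W]

/-- The decaying weight `(1 + ‖z‖²)^(-(p + 1))` that keeps derivatives of the feedback bounded while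
the components it depends on are large. -/
noncomputable def weight (p : ℕ) (z : W) : ℝ := ((1 + ‖z‖ ^ 2) ^ (p + 1))⁻¹

theorem weight_pos (p : ℕ) (z : W) : 0 < weight p z := by unfold weight; positivity

theorem weight_le_one (p : ℕ) (z : W) : weight p z ≤ 1 :=
  inv_le_one_of_one_le₀ (one_le_pow₀ (by nlinarith [sq_nonneg ‖z‖]))

theorem one_sub_weight_le (p : ℕ) (z : W) : 1 - weight p z ≤ (p + 1) * ‖z‖ ^ 2 := by
  have hpos : 0 < 1 + ‖z‖ ^ 2 := by positivity
  have h1 : 1 + ((p + 1 : ℕ) : ℝ) * (-(‖z‖ ^ 2 / (1 + ‖z‖ ^ 2))) ≤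
      (1 + -(‖z‖ ^ 2 / (1 + ‖z‖ ^ 2))) ^ (p + 1) := by
    refine one_add_mul_le_pow ?_ _
    have : ‖z‖ ^ 2 / (1 + ‖z‖ ^ 2) ≤ 1 := (div_le_one hpos).2 (by linarith)
    linarith
  have h2 : 1 + -(‖z‖ ^ 2 / (1 + ‖z‖ ^ 2)) = (1 + ‖z‖ ^ 2)⁻¹ := by field_simp; ring
  rw [h2, inv_pow] at h1
  have h3 : ‖z‖ ^ 2 / (1 + ‖z‖ ^ 2) ≤ ‖z‖ ^ 2 :=
    div_le_self (sq_nonneg _) (by nlinarith [sq_nonneg ‖z‖])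
  push_cast at h1
  unfold weight
  nlinarith

theorem one_sub_invJap_le (ξ : W) : 1 - invJap ξ ≤ ‖ξ‖ := by
  have h1 := invJap_sq ξ
  have h2 := invJap_pos ξ
  have h3 := invJap_le_one ξ
  by_contra! h
  have h4 : ‖ξ‖ < 1 := by linarith
  nlinarith [norm_nonneg ξ, mul_nonneg (norm_nonneg ξ) h2.le,
    mul_nonneg (mul_nonneg h2.le h2.le) (sq_nonneg ‖ξ‖)]

theorem one_sub_weight_le_norm (p : ℕ) (z : W) : 1 - weight p z ≤ (p + 1) * ‖z‖ := by
  have h1 := one_sub_weight_le p z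
  have h2 := weight_pos p z
  have hp : (0 : ℝ) ≤ p := Nat.cast_nonneg p
  rcases le_total ‖z‖ 1 with h | h
  · have : ‖z‖ ^ 2 ≤ ‖z‖ := by nlinarith [norm_nonneg z]
    nlinarith
  · nlinarith

theorem boundedLipschitz_weight (p : ℕ) : BoundedLipschitz (weight p : W → ℝ) := by
  have h : BoundedLipschitz fun z : W => (1 + ‖z‖ ^ 2)⁻¹ := by
    refine ⟨1, zero_le_one, fun z => ?_, fun x y => ?_⟩
    · rw [abs_of_pos (by positivity)]
      exact inv_le_one_of_one_le₀ (by nlinarith [sq_nonneg ‖z‖])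
    · have hx : 0 < 1 + ‖x‖ ^ 2 := by positivity
      have hy : 0 < 1 + ‖y‖ ^ 2 := by positivity
      have h1 : (1 + ‖x‖ ^ 2)⁻¹ - (1 + ‖y‖ ^ 2)⁻¹ =
          (‖y‖ - ‖x‖) * ((‖y‖ + ‖x‖) / ((1 + ‖x‖ ^ 2) * (1 + ‖y‖ ^ 2))) := by
        field_simp; ring
      rw [h1, abs_mul, one_mul]
      have h2 : |(‖y‖ + ‖x‖) / ((1 + ‖x‖ ^ 2) * (1 + ‖y‖ ^ 2))| ≤ 1 := by
        rw [abs_of_nonneg (by positivity), div_le_one (by positivity)]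
        nlinarith [sq_nonneg (‖x‖ - 1), sq_nonneg (‖y‖ - 1),
          mul_nonneg (sq_nonneg ‖x‖) (sq_nonneg ‖y‖), sq_nonneg (‖x‖ - 1/2), sq_nonneg (‖y‖ - 1/2)]
      have h3 := abs_norm_sub_norm_le y x
      rw [norm_sub_rev] at h3
      exact (mul_le_of_le_one_right (abs_nonneg _) h2).trans h3
  have := h.pow (p + 1)
  simp only [inv_pow] at this
  exact this

variable [InnerProductSpace ℝ W]

theorem boundedLipschitz_inner_mul_invJap (β : W) :
    BoundedLipschitz fun ξ : W => ⟪β, ξ⟫_ℝ * invJap ξ := by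
  refine ⟨2 * ‖β‖, by positivity, fun ξ => ?_, fun x y => ?_⟩
  · rw [abs_mul, abs_of_pos (invJap_pos ξ)]
    calc _ ≤ ‖β‖ * ‖ξ‖ * invJap ξ := by
          gcongr
          · exact (invJap_pos ξ).le
          · exact abs_real_inner_le_norm _ _
      _ = ‖β‖ * (‖ξ‖ * invJap ξ) := by ring
      _ ≤ ‖β‖ * 2 := by
          gcongr; linarith [norm_mul_invJap_le_one ξ]
      _ = _ := by ring
  · have hd : ∀ ξ : W, HasFDerivAt (fun ξ : W => ⟪β, ξ⟫_ℝ * invJap ξ)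
        (⟪β, ξ⟫_ℝ • (-(invJap ξ ^ 3) • innerSL ℝ ξ) + invJap ξ • innerSL ℝ β) ξ := fun ξ =>
      (innerSL ℝ β).hasFDerivAt.mul (hasFDerivAt_invJap ξ)
    refine convex_univ.norm_image_sub_le_of_norm_hasFDerivWithin_le
      (fun ξ _ => (hd ξ).hasFDerivWithinAt) (fun ξ _ => ?_) (mem_univ y) (mem_univ x)
    have hJ := invJap_pos ξ
    refine (norm_add_le _ _).trans ?_
    rw [norm_smul, norm_smul, norm_smul, innerSL_apply_norm, innerSL_apply_norm, Real.norm_eq_abs,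
      norm_neg, Real.norm_of_nonneg (by positivity), Real.norm_of_nonneg hJ.le]
    have h1 : |⟪β, ξ⟫_ℝ| * (invJap ξ ^ 3 * ‖ξ‖) ≤ ‖β‖ := by
      calc _ ≤ (‖β‖ * ‖ξ‖) * (invJap ξ ^ 3 * ‖ξ‖) := by
            gcongr; exact abs_real_inner_le_norm _ _
        _ = ‖β‖ * ((‖ξ‖ * invJap ξ) ^ 2 * invJap ξ) := by ring
        _ ≤ ‖β‖ * (1 * 1) := by
            gcongr
            · exact pow_le_one₀ (by positivity) (norm_mul_invJap_le_one ξ)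
            · exact invJap_le_one ξ
        _ = _ := by ring
    have h2 := mul_le_of_le_one_left (norm_nonneg β) (invJap_le_one ξ)
    linarith

end BoundedLipschitz

/-! ### Feedback laws for a single-input critical system -/

section Feedback

open scoped InnerProductSpace ContDiff

variable {E : Type*} [NormedAddCommGroup E] [InnerProductSpace ℝ E]

/-- A bound on the time derivatives of `κ (x t)`, up to order `p`, along *every* smooth curve
`x' = A x + r`, in terms of the derivatives of lower order of the residual `r`. The residual stands
for whatever acts on the system: its own input, or the states of the other systems of a cascade. -/
def HasJetGain (A : E →L[ℝ] E) (p : ℕ) (κ : E → ℝ) (ε : ℝ) : Prop :=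
  ∀ n ≤ p, ∀ w : ℝ, 1 ≤ w → ∀ x r : ℝ → E, ContDiffOn ℝ ∞ x (Ici 0) → ContDiffOn ℝ ∞ r (Ici 0) →
    (∀ t, 0 ≤ t → HasDerivWithinAt x (A (x t) + r t) (Ici 0) t) → ∀ t, 0 ≤ t →
    (∀ k < n, ‖iteratedDerivWithin k r (Ici 0) t‖ ≤ w) → JetBound n (fun s => κ (x s)) t ε w

/-- `x' = A x + κ x b` has a linear asymptotic gain from small disturbances to the state. The
disturbance is not assumed to be measurable or bounded: being a solution already implies that the
right-hand side is locally integrable. -/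
def HasSmallGain (A : E →L[ℝ] E) (b : E) (κ : E → ℝ) : Prop :=
  ∃ Δ N : ℝ, 0 < Δ ∧ 0 < N ∧ ∀ δ, 0 < δ → δ ≤ Δ → ∀ e : ℝ → E, EventuallyBoundedBy e δ →
    ∀ x, IsSolution (fun t x => (A x + κ x • b) + e t) x → EventuallyBoundedBy x (N * δ)

/-- `K` approximates `κ` to second order, and `A + b K` has no eigenvalue on the imaginary axis.
The latter is stated over the reals: `(A + b K)² + ν²` is injective for every real `ν`. -/
def IsNondegenerateLinearization (A : E →L[ℝ] E) (b : E) (κ : E → ℝ) (K : E →L[ℝ] ℝ) : Prop :=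
  (∃ C : ℝ, 0 ≤ C ∧ ∀ x, |κ x - K x| ≤ C * ‖x‖ ^ 2) ∧
  ∀ (ν : ℝ) (x y : E), y = A x + K x • b → A y + K y • b = -(ν ^ 2) • x → x = 0

/-- The properties of a feedback that are propagated by induction on the dimension. -/
structure IsGoodFeedback (A : E →L[ℝ] E) (b : E) (p : ℕ) (ε : ℝ) (κ : E → ℝ) : Prop where
  smooth : ContDiff ℝ ∞ κ
  boundedLipschitz : BoundedLipschitz κ
  jetGain : HasJetGain A p κ ε
  smallGain : HasSmallGain A b κ
  linearization : ∃ K, IsNondegenerateLinearization A b κ K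

theorem HasJetGain.mono {A : E →L[ℝ] E} {p : ℕ} {κ : E → ℝ} {ε ε' : ℝ} (h : HasJetGain A p κ ε)
    (hε : ε ≤ ε') (hε0 : 0 ≤ ε') : HasJetGain A p κ ε' :=
  fun n hn w hw x r cx cr hx t ht hr =>
    (h n hn w hw x r cx cr hx t ht hr).mono hε hε0 (by linarith) le_rfl

end Feedback

/-! ### Adding one critical block to a feedback -/

section Extension

open scoped InnerProductSpace ContDiff

variable {E Z W : Type*} [NormedAddCommGroup E] [InnerProductSpace ℝ E]
  [NormedAddCommGroup Z] [InnerProductSpace ℝ Z] [NormedAddCommGroup W] [InnerProductSpace ℝ W]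

/-- Coordinates `(Pi x, π x)` for `x' = A x + b u`. The quotient system `z = π x` is
`z' = A_z z + b_z u`, and once the feedback `u = K z + v` is applied, `ξ = Pi x` decouples from
`z`: it satisfies `ξ' = A₁ ξ + β v`. -/
structure IsBlockSplitting (A : E →L[ℝ] E) (b : E) (Az : Z →L[ℝ] Z) (bz : Z) (K : Z →L[ℝ] ℝ)
    (A₁ : W →L[ℝ] W) (β : W) (π : E →L[ℝ] Z) (Pi : E →L[ℝ] W) : Prop where
  norm_le : ‖π‖ ≤ 1
  map_A : ∀ x, π (A x) = Az (π x)
  map_b : π b = bz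
  decoupled : ∀ x, Pi (A x + K (π x) • b) = A₁ (Pi x)
  map_b' : Pi b = β
  bounded_below : ∃ c, 0 < c ∧ ∀ x, ‖x‖ ≤ c * (‖Pi x‖ + ‖π x‖)

/-- The feedback `κ` of the quotient, plus a saturated damping of the new block with gain `l`,
attenuated when the quotient state is large. -/
noncomputable def extendFeedback (κ : Z → ℝ) (π : E →L[ℝ] Z) (Pi : E →L[ℝ] W) (β : W) (p : ℕ)
    (l : ℝ) (x : E) : ℝ :=
  κ (π x) + -l * ((⟪β, Pi x⟫_ℝ * invJap (Pi x)) * weight p (π x))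

theorem contDiff_invJap : ContDiff ℝ ∞ (invJap : W → ℝ) := by
  unfold invJap
  refine ContDiff.inv (ContDiff.sqrt (contDiff_const.add (contDiff_norm_sq ℝ)) fun x => ?_)
    fun x => ?_ <;> positivity

theorem contDiff_weight (p : ℕ) : ContDiff ℝ ∞ (weight p : W → ℝ) := by
  unfold weight
  refine ContDiff.inv ((contDiff_const.add (contDiff_norm_sq ℝ)).pow _) fun x => ?_
  positivity

variable {A : E →L[ℝ] E} {b : E} {Az : Z →L[ℝ] Z} {bz : Z} {K : Z →L[ℝ] ℝ} {A₁ : W →L[ℝ] W} {β : W}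
  {π : E →L[ℝ] Z} {Pi : E →L[ℝ] W} {κ : Z → ℝ}

theorem contDiff_extendFeedback (hκ : ContDiff ℝ ∞ κ) (p : ℕ) (l : ℝ) :
    ContDiff ℝ ∞ (extendFeedback κ π Pi β p l) := by
  unfold extendFeedback
  have h1 : ContDiff ℝ ∞ fun x => ⟪β, Pi x⟫_ℝ := contDiff_const.inner ℝ Pi.contDiff
  exact (hκ.comp π.contDiff).add (contDiff_const.mul ((h1.mul (contDiff_invJap.comp Pi.contDiff)).mul
    ((contDiff_weight p).comp π.contDiff)))

theorem boundedLipschitz_extendFeedback (hκ : BoundedLipschitz κ) (p : ℕ) (l : ℝ) :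
    BoundedLipschitz (extendFeedback κ π Pi β p l) :=
  (hκ.comp_clm π).add ((boundedLipschitz_const (-l)).mul
    (((boundedLipschitz_inner_mul_invJap β).comp_clm Pi).mul
      ((boundedLipschitz_weight p).comp_clm π)))

theorem IsBlockSplitting.isNondegenerateLinearization
    (h : IsBlockSplitting A b Az bz K A₁ β π Pi) {S : W →L[ℝ] W} (hS : IsDampedBlock A₁ β S)
    (hK : IsNondegenerateLinearization Az bz κ K) (p : ℕ) {l : ℝ} (hl : 0 < l) :
    IsNondegenerateLinearization A b (extendFeedback κ π Pi β p l)
      (K.comp π - l • (innerSL ℝ β).comp Pi) := by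
  obtain ⟨⟨C, hC, hq⟩, hinj⟩ := hK
  refine ⟨⟨C * ‖π‖ ^ 2 + l * (‖β‖ * ‖Pi‖ * (‖Pi‖ + (p + 1) * ‖π‖)), by positivity, fun x => ?_⟩, ?_⟩
  · have hJ := invJap_pos (Pi x)
    have hJ1 := invJap_le_one (Pi x)
    have hw := weight_pos p (π x)
    have hw1 := weight_le_one p (π x)
    have h1 := one_sub_invJap_le (Pi x)
    have h2 := one_sub_weight_le_norm p (π x)
    have hP := Pi.le_opNorm x
    have hπ := π.le_opNorm x
    have e1 : extendFeedback κ π Pi β p l x - (K.comp π - l • (innerSL ℝ β).comp Pi) x =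
        (κ (π x) - K (π x)) +
          l * (⟪β, Pi x⟫_ℝ * (1 - invJap (Pi x) * weight p (π x))) := by
      simp [extendFeedback]; ring
    have h3 : |1 - invJap (Pi x) * weight p (π x)| ≤ ‖Pi‖ * ‖x‖ + (p + 1) * (‖π‖ * ‖x‖) := by
      have h0 : 0 ≤ 1 - invJap (Pi x) * weight p (π x) := by
        have := mul_le_one₀ hJ1 hw.le hw1
        linarith
      rw [abs_of_nonneg h0]
      have h4 : 1 - invJap (Pi x) * weight p (π x) =
          (1 - invJap (Pi x)) + invJap (Pi x) * (1 - weight p (π x)) := by ring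
      have h5 : invJap (Pi x) * (1 - weight p (π x)) ≤ 1 - weight p (π x) :=
        mul_le_of_le_one_left (by linarith) hJ1
      have h6 : ((p : ℝ) + 1) * ‖π x‖ ≤ (p + 1) * (‖π‖ * ‖x‖) := by gcongr
      linarith
    have h4 : |⟪β, Pi x⟫_ℝ| ≤ ‖β‖ * (‖Pi‖ * ‖x‖) :=
      (abs_real_inner_le_norm _ _).trans (by gcongr)
    rw [e1]
    refine (abs_add_le _ _).trans ?_
    rw [abs_mul, abs_mul, abs_of_pos hl]
    calc _ ≤ C * (‖π‖ * ‖x‖) ^ 2 +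
          l * (‖β‖ * (‖Pi‖ * ‖x‖) * (‖Pi‖ * ‖x‖ + (p + 1) * (‖π‖ * ‖x‖))) := by
          gcongr
          exact (hq _).trans (by gcongr)
      _ = _ := by ring
  · intro ν x y hy hy'
    set F : E → E := fun x => A x + (K.comp π - l • (innerSL ℝ β).comp Pi) x • b with hF
    have hPF : ∀ x, Pi (F x) = A₁ (Pi x) - (l * ⟪β, Pi x⟫_ℝ) • β := fun x => by
      rw [← h.decoupled]
      simp [hF, sub_smul, h.map_b']
      abel
    have hπF : ∀ x, π (F x) = Az (π x) + K (π x) • bz - (l * ⟪β, Pi x⟫_ℝ) • bz := fun x => by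
      rw [← h.map_A, ← h.map_b]
      simp [hF, sub_smul]
      abel
    have e1 : Pi y = A₁ (Pi x) - (l * ⟪β, Pi x⟫_ℝ) • β := by rw [← hPF]; exact congrArg Pi hy
    have e2 : A₁ (Pi y) - (l * ⟪β, Pi y⟫_ℝ) • β = -(ν ^ 2) • Pi x := by
      rw [← hPF, ← map_smul]; exact congrArg Pi hy'
    have hx0 : Pi x = 0 := hS.eq_zero_of_sq_eq hl e1 e2
    have hy0 : Pi y = 0 := by rw [e1, hx0]; simp
    have e3 : π y = Az (π x) + K (π x) • bz := by
      have := hπF x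
      rw [hx0, inner_zero_right, mul_zero, zero_smul, sub_zero] at this
      rw [← this]; exact congrArg π hy
    have e4 : Az (π y) + K (π y) • bz = -(ν ^ 2) • π x := by
      have := hπF y
      rw [hy0, inner_zero_right, mul_zero, zero_smul, sub_zero] at this
      rw [← this, ← map_smul]; exact congrArg π hy'
    have hz0 := hinj ν (π x) (π y) e3 e4
    obtain ⟨c, _, hc⟩ := h.bounded_below
    have := hc x
    rw [hx0, hz0] at this
    simpa using this

/-- The square of `l B s + δ` contains `s` with a factor of order `l²`, smaller than the gain `l` of
the damping. -/
theorem sq_add_le_of_le_one {l B s δ : ℝ} (hs : 0 ≤ s) (hs1 : s ≤ 1) (hδ : 0 ≤ δ) (hδ1 : δ ≤ 1) :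
    (l * B * s + δ) ^ 2 ≤ 2 * (B ^ 2 + 1) * (l ^ 2 * s + δ) := by
  have h6 : (l * B * s + δ) ^ 2 ≤ 2 * (l * B * s) ^ 2 + 2 * δ ^ 2 := by
    nlinarith [sq_nonneg (l * B * s - δ)]
  have h7 : s ^ 2 ≤ s := by nlinarith
  have h8 : δ ^ 2 ≤ δ := by nlinarith
  have h9 : (l * B * s) ^ 2 ≤ B ^ 2 * (l ^ 2 * s) := by
    calc _ = B ^ 2 * (l ^ 2 * s ^ 2) := by ring
      _ ≤ _ := by gcongr
  nlinarith [mul_nonneg (sq_nonneg B) hδ, mul_nonneg (sq_nonneg l) hs]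

set_option maxHeartbeats 400000 in
/-- The small-gain argument. If the saturated state `‖ξ‖ (1 + ‖ξ‖²)^(-1/2)` is eventually at most
`s`, the quotient state is eventually of size `l s + δ`, hence the nonlinear remainder acting on `ξ`
is of size `(l s + δ)²`. The damping of strength `l` then gives `‖ξ‖ ≤ s / 2 + D δ`
eventually, when `l` is small. Iterating from `s = 1` makes the state of size `δ`. -/
theorem IsBlockSplitting.exists_hasSmallGain [CompleteSpace E] [CompleteSpace Z] [CompleteSpace W]
    (h : IsBlockSplitting A b Az bz K A₁ β π Pi) {S : W →L[ℝ] W} (hS : IsDampedBlock A₁ β S)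
    (hgain : HasSmallGain Az bz κ) (hK : IsNondegenerateLinearization Az bz κ K) (p : ℕ) :
    ∃ l₀ : ℝ, 0 < l₀ ∧ ∀ l, 0 < l → l ≤ l₀ → HasSmallGain A b (extendFeedback κ π Pi β p l) := by
  obtain ⟨⟨C, hC, hq⟩, -⟩ := hK
  obtain ⟨Δ, N, hΔ, hN, hgain⟩ := hgain
  obtain ⟨c, hc, hbelow⟩ := h.bounded_below
  set B₀ := ‖β‖ * ‖bz‖ with hB₀
  set C₂ := C * ‖β‖ + ‖β‖ ^ 2 * (p + 1) with hC₂
  set C₃ := 2 * C₂ * N ^ 2 * (B₀ ^ 2 + 1) + ‖Pi‖ + 1 with hC₃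
  have hB₀0 : 0 ≤ B₀ := by positivity
  have hC₂0 : 0 ≤ C₂ := by positivity
  have hC₃1 : 1 ≤ C₃ := by
    have : 0 ≤ 2 * C₂ * N ^ 2 * (B₀ ^ 2 + 1) + ‖Pi‖ := by positivity
    linarith
  have hC₃0 : 0 < C₃ := by linarith
  set M := 1 + 96 * C₃ + 2 * B₀ / Δ + 6 * (‖S‖ * (1 + ‖β‖ ^ 2)) with hM
  have hM0 : 0 < M := by positivity
  refine ⟨1 / M, by positivity, fun l hl hlM => ?_⟩
  have hMl : l * M ≤ 1 := by rwa [le_div_iff₀ hM0] at hlM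
  -- `M` collects the reciprocals of all upper bounds that `l` has to satisfy
  have hterm : ∀ a, a ≤ M → l * a ≤ 1 := fun a ha =>
    (mul_le_mul_of_nonneg_left ha hl.le).trans hMl
  have hnS : 0 ≤ 6 * (‖S‖ * (1 + ‖β‖ ^ 2)) := by positivity
  have hnB : 0 ≤ 2 * B₀ / Δ := by positivity
  have hl1 : l ≤ 1 := by simpa using hterm 1 (by rw [hM]; linarith)
  have hl96 : l * (96 * C₃) ≤ 1 := hterm _ (by rw [hM]; linarith)
  have hlB : l * B₀ ≤ Δ / 2 := by
    have h1 : l * (2 * B₀ / Δ) ≤ 1 := hterm _ (by rw [hM]; linarith)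
    have h2 : l * (2 * B₀ / Δ) = 2 * (l * B₀) / Δ := by ring
    rw [h2, div_le_one hΔ] at h1
    linarith
  have hlS : 6 * l * (‖S‖ * (1 + ‖β‖ ^ 2)) ≤ 1 := by
    have h1 : l * (6 * (‖S‖ * (1 + ‖β‖ ^ 2))) ≤ 1 := hterm _ (by rw [hM]; linarith)
    linarith
  set D := 48 * C₃ / l with hD
  have hD0 : 0 < D := by positivity
  have hDl : D * l = 48 * C₃ := by rw [hD]; field_simp
  refine ⟨min 1 (min (Δ / 2) (l / (48 * C₃))), c * (1 + 3 * D + N * (B₀ * (1 + 2 * D) + 1)),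
    by positivity, by positivity, fun δ hδ hδΔ e he x hx => ?_⟩
  have hδ1 : δ ≤ 1 := hδΔ.trans (min_le_left _ _)
  have hδ2 : δ ≤ Δ / 2 := hδΔ.trans ((min_le_right _ _).trans (min_le_left _ _))
  have hδ3 : 48 * C₃ * δ ≤ l := by
    have h1 : δ ≤ l / (48 * C₃) := hδΔ.trans ((min_le_right _ _).trans (min_le_right _ _))
    rw [le_div_iff₀ (by positivity)] at h1
    linarith
  have he' := eventuallyBoundedBy_iff.1 he
  set v : ℝ → ℝ := fun t => ⟪β, Pi (x t)⟫_ℝ * invJap (Pi (x t)) with hv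
  have hvσ : ∀ t, |v t| ≤ ‖β‖ * (‖Pi (x t)‖ * invJap (Pi (x t))) := fun t => by
    simp only [hv]
    rw [abs_mul, abs_of_pos (invJap_pos _), ← mul_assoc]
    gcongr
    · exact (invJap_pos _).le
    · exact abs_real_inner_le_norm _ _
  set ez : ℝ → Z := fun t => (-l * (v t * weight p (π (x t)))) • bz + π (e t) with hez
  have hzsol : IsSolution (fun t z => (Az z + κ z • bz) + ez t) (fun t => π (x t)) :=
    hx.map π fun t _ => by
      simp only [hez, hv, extendFeedback, map_add, map_smul, h.map_A, h.map_b, add_smul]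
      abel
  set ex : ℝ → W := fun t => (κ (π (x t)) - K (π (x t))) • β +
    (l * (v t * (1 - weight p (π (x t))))) • β + Pi (e t) with hex
  have hξsol : IsSolution
      (fun t ξ => (A₁ ξ - (l * (⟪β, ξ⟫_ℝ * invJap ξ)) • β) + ex t) (fun t => Pi (x t)) :=
    hx.map Pi fun t _ => by
      rw [← h.decoupled]
      simp only [hex, hv, extendFeedback, map_add, map_smul, h.map_b']
      module
  have hstep : ∀ s, 0 < s → s ≤ 1 →
      (∀ᶠ t in atTop, ‖Pi (x t)‖ * invJap (Pi (x t)) ≤ s) →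
      (∀ᶠ t in atTop, ‖π (x t)‖ ≤ N * (l * B₀ * s + δ)) ∧
        ∀ᶠ t in atTop, ‖Pi (x t)‖ ≤ s / 2 + D * δ := by
    intro s hs hs1 hσ
    set d := l * B₀ * s + δ with hd
    have hd0 : 0 < d := by positivity
    have hdΔ : d ≤ Δ := by
      have : l * B₀ * s ≤ l * B₀ := mul_le_of_le_one_right (by positivity) hs1
      linarith
    have hz := eventuallyBoundedBy_iff.1 (hgain d hd0 hdΔ ez (eventuallyBoundedBy_iff.2 (by
      filter_upwards [hσ, he'] with t ht1 ht2
      have h1 : |-l * (v t * weight p (π (x t)))| ≤ l * (‖β‖ * s) := by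
        rw [abs_mul, abs_neg, abs_of_pos hl, abs_mul, abs_of_pos (weight_pos _ _)]
        have h0 : |v t| ≤ ‖β‖ * s :=
          (hvσ t).trans (mul_le_mul_of_nonneg_left ht1 (norm_nonneg _))
        exact mul_le_mul_of_nonneg_left
          ((mul_le_of_le_one_right (abs_nonneg _) (weight_le_one _ _)).trans h0) hl.le
      have h2 : ‖π (e t)‖ ≤ δ := (π.le_of_opNorm_le h.norm_le _).trans (by linarith)
      refine (norm_add_le _ _).trans (add_le_add ?_ h2)
      rw [norm_smul, Real.norm_eq_abs, hB₀]
      calc _ ≤ l * (‖β‖ * s) * ‖bz‖ := by gcongr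
        _ = _ := by ring)) _ hzsol)
    refine ⟨hz, ?_⟩
    set η := C₃ * (l ^ 2 * s + δ) with hη
    have hη0 : 0 < η := by positivity
    have hηl : 24 * η ≤ l := by
      have h1 : l * (96 * C₃) * (l * s) ≤ 1 * (l * 1) := by gcongr
      have h2 : 24 * η = l * (96 * C₃) * (l * s) / 4 + 48 * C₃ * δ / 2 := by rw [hη]; ring
      linarith
    have hexη : EventuallyBoundedBy ex η := by
      rw [eventuallyBoundedBy_iff]
      filter_upwards [hσ, he', hz] with t ht1 ht2 ht3
      have hz2 : ‖π (x t)‖ ^ 2 ≤ (N * d) ^ 2 := by gcongr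
      have h1 : ‖(κ (π (x t)) - K (π (x t))) • β‖ ≤ C * ‖β‖ * (N * d) ^ 2 := by
        rw [norm_smul, Real.norm_eq_abs]
        calc _ ≤ C * ‖π (x t)‖ ^ 2 * ‖β‖ := by gcongr; exact hq _
          _ ≤ C * (N * d) ^ 2 * ‖β‖ := by gcongr
          _ = _ := by ring
      have h2 : ‖(l * (v t * (1 - weight p (π (x t))))) • β‖ ≤ ‖β‖ ^ 2 * (p + 1) * (N * d) ^ 2 := by
        have h3 : |v t| ≤ ‖β‖ := (hvσ t).trans
          (mul_le_of_le_one_right (norm_nonneg _) (norm_mul_invJap_le_one _))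
        have h4 : |1 - weight p (π (x t))| ≤ (p + 1) * (N * d) ^ 2 := by
          rw [abs_of_nonneg (by linarith [weight_le_one p (π (x t))])]
          exact (one_sub_weight_le _ _).trans (by gcongr)
        rw [norm_smul, Real.norm_eq_abs, abs_mul, abs_mul, abs_of_pos hl]
        calc _ ≤ 1 * (‖β‖ * ((p + 1) * (N * d) ^ 2)) * ‖β‖ := by gcongr
          _ = _ := by ring
      have h3 : ‖Pi (e t)‖ ≤ ‖Pi‖ * δ := Pi.le_opNorm_of_le ht2
      have h4 : ‖ex t‖ ≤ C₂ * (N * d) ^ 2 + ‖Pi‖ * δ := by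
        refine (norm_add_le _ _).trans (add_le_add ((norm_add_le _ _).trans ?_) h3)
        rw [hC₂]; linarith
      have h5 : d ^ 2 ≤ 2 * (B₀ ^ 2 + 1) * (l ^ 2 * s + δ) :=
        sq_add_le_of_le_one hs.le hs1 hδ.le hδ1
      have h6 : C₂ * (N * d) ^ 2 ≤ 2 * C₂ * N ^ 2 * (B₀ ^ 2 + 1) * (l ^ 2 * s + δ) := by
        calc _ = C₂ * N ^ 2 * d ^ 2 := by ring
          _ ≤ C₂ * N ^ 2 * (2 * (B₀ ^ 2 + 1) * (l ^ 2 * s + δ)) := by gcongr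
          _ = _ := by ring
      have h7 : ‖Pi‖ * δ ≤ (‖Pi‖ + 1) * (l ^ 2 * s + δ) := by
        have : 0 ≤ l ^ 2 * s := by positivity
        exact mul_le_mul (by linarith) (by linarith) hδ.le (by positivity)
      calc _ ≤ _ := h4
        _ ≤ _ := add_le_add h6 h7
        _ = _ := by rw [hη, hC₃]; ring
    filter_upwards [eventuallyBoundedBy_iff.1 (hS.eventuallyBoundedBy hl hlS hη0 hηl hexη hξsol)]
      with t ht
    refine ht.trans ?_
    have h1 : 48 * η / l = l * (96 * C₃) * s / 2 + D * δ := by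
      rw [hη, hD]; field_simp; ring
    rw [h1]
    have h2 : l * (96 * C₃) * s ≤ 1 * s := by gcongr
    linarith
  have hσ1 : ∀ t, ‖Pi (x t)‖ * invJap (Pi (x t)) ≤ 1 := fun t => norm_mul_invJap_le_one _
  have hσle : ∀ t, ‖Pi (x t)‖ * invJap (Pi (x t)) ≤ ‖Pi (x t)‖ := fun t =>
    mul_le_of_le_one_right (norm_nonneg _) (invJap_le_one _)
  have hiter : ∀ k : ℕ, ∀ᶠ t in atTop,
      ‖Pi (x t)‖ * invJap (Pi (x t)) ≤ min 1 ((1 / 2) ^ k + 2 * D * δ) := by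
    intro k
    induction k with
    | zero =>
      refine Eventually.of_forall fun t => le_min (hσ1 t) ?_
      have : 0 ≤ 2 * D * δ := by positivity
      simpa using (hσ1 t).trans (by linarith)
    | succ k ih =>
      filter_upwards [(hstep _ (by positivity) (min_le_left _ _) ih).2] with t ht
      refine le_min (hσ1 t) ((hσle t).trans (ht.trans ?_))
      have := min_le_right (1 : ℝ) ((1 / 2) ^ k + 2 * D * δ)
      rw [pow_succ]
      linarith
  obtain ⟨k, hk⟩ := exists_pow_lt_of_lt_one hδ (by norm_num : (1 / 2 : ℝ) < 1)
  set s := min 1 ((1 / 2) ^ k + 2 * D * δ) with hs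
  have hsδ : s ≤ (1 + 2 * D) * δ := (min_le_right _ _).trans (by linarith)
  obtain ⟨hz, hξ⟩ := hstep s (by positivity) (min_le_left _ _) (hiter k)
  rw [eventuallyBoundedBy_iff]
  filter_upwards [hz, hξ] with t ht1 ht2
  refine (hbelow _).trans ?_
  have h1 : ‖Pi (x t)‖ ≤ (1 + 3 * D) * δ := by
    have := mul_pos hD0 hδ
    linarith
  have h2 : N * (l * B₀ * s + δ) ≤ N * ((B₀ * (1 + 2 * D) + 1) * δ) := by
    have h3 : l * B₀ * s ≤ 1 * B₀ * ((1 + 2 * D) * δ) := by gcongr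
    have h4 : l * B₀ * s + δ ≤ (B₀ * (1 + 2 * D) + 1) * δ := by linarith
    gcongr
  calc _ ≤ c * ((1 + 3 * D) * δ + N * ((B₀ * (1 + 2 * D) + 1) * δ)) := by
        gcongr; exact ht1.trans h2
    _ = _ := by ring

end Extension

/-! ### Derivatives of the extended feedback -/

section ExtensionJets

open scoped InnerProductSpace ContDiff

theorem weight_eq_rpow {W : Type*} [NormedAddCommGroup W] (p : ℕ) (z : W) :
    weight p z = (1 + ‖z‖ ^ 2) ^ (-((p + 1 : ℕ) : ℝ)) := by
  rw [Real.rpow_neg (by positivity), Real.rpow_natCast]; rfl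

theorem invJap_eq_rpow {W : Type*} [NormedAddCommGroup W] (z : W) :
    invJap z = (1 + ‖z‖ ^ 2) ^ (-(1 / 2) : ℝ) := by
  rw [Real.rpow_neg (by positivity), ← Real.sqrt_eq_rpow]; rfl

/-- The weight beats any product of at most `2 (p + 1)` factors of size `(1 + ‖z‖²)^(1/2)`. -/
theorem weight_mul_sqrt_pow_le_one {W : Type*} [NormedAddCommGroup W]
    {p k : ℕ} (hk : k ≤ 2 * (p + 1)) (z : W) : weight p z * √(1 + ‖z‖ ^ 2) ^ k ≤ 1 := by
  have h1 : (1 : ℝ) ≤ √(1 + ‖z‖ ^ 2) := Real.one_le_sqrt.2 (by nlinarith [sq_nonneg ‖z‖])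
  have h2 : √(1 + ‖z‖ ^ 2) ^ k ≤ √(1 + ‖z‖ ^ 2) ^ (2 * (p + 1)) := pow_le_pow_right₀ h1 hk
  rw [pow_mul, Real.sq_sqrt (by positivity)] at h2
  calc _ ≤ weight p z * (1 + ‖z‖ ^ 2) ^ (p + 1) := by
        gcongr; exact (weight_pos p z).le
    _ = 1 := inv_mul_cancel₀ (by positivity)

universe u

variable {E Z W : Type u} [NormedAddCommGroup E] [InnerProductSpace ℝ E]
  [NormedAddCommGroup Z] [InnerProductSpace ℝ Z] [NormedAddCommGroup W] [InnerProductSpace ℝ W]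
  {A : E →L[ℝ] E} {b : E} {Az : Z →L[ℝ] Z} {bz : Z} {K : Z →L[ℝ] ℝ} {A₁ : W →L[ℝ] W} {β : W}
  {π : E →L[ℝ] Z} {Pi : E →L[ℝ] W} {κ : Z → ℝ}

/-- Each derivative of `z = π x` or `ξ = Pi x` costs at most a factor of size
`w (1 + ‖z‖²)^(1/2)`; the factors that depend on `z` are absorbed by the weight. -/
theorem IsBlockSplitting.exists_hasJetGain (h : IsBlockSplitting A b Az bz K A₁ β π Pi) (p : ℕ)
    {ε : ℝ} (hκ : HasJetGain Az p κ ε) (cκ : ContDiff ℝ ∞ κ) :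
    ∃ C : ℝ, 0 < C ∧ ∀ l, 0 < l → HasJetGain A p (extendFeedback κ π Pi β p l) (ε + l * C) := by
  obtain ⟨Cw, hCw, hweight⟩ := exists_jetBound_one_add_norm_sq_rpow.{u} p (-((p + 1 : ℕ) : ℝ))
  obtain ⟨Cj, hCj, hjap⟩ := exists_jetBound_one_add_norm_sq_rpow.{u} p (-(1 / 2))
  set cz := ‖Az‖ + 1 + 1 with hcz
  have hcz1 : 1 ≤ cz := by have := norm_nonneg Az; linarith
  have hcz0 : 0 ≤ cz := by linarith
  set B : Z →L[ℝ] W := -((ContinuousLinearMap.toSpanSingleton ℝ β).comp K) with hB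
  set q := 2 * ‖B‖ + ‖Pi‖ + 1 with hq
  have hq1 : 1 ≤ q := by have := norm_nonneg B; have := norm_nonneg Pi; linarith
  set cξ := ‖A₁‖ + 1 + cz with hcξ
  have hcξ0 : 0 ≤ cξ := by positivity
  set c₃ := 10 * q * cξ + 8 * cz with hc₃
  have hc₃1 : 1 ≤ c₃ := by
    have : 0 ≤ 10 * q * cξ := by positivity
    linarith
  refine ⟨‖β‖ * Cj * Cw * c₃ ^ p + 1, by positivity, fun l hl n hn w hw x r cx cr hx t ht hr => ?_⟩
  have hw0 : 0 ≤ w := by linarith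
  -- the quotient state
  have cz' : ContDiffOn ℝ ∞ (fun s => π (x s)) (Ici 0) := π.contDiff.comp_contDiffOn cx
  have crz : ContDiffOn ℝ ∞ (fun s => π (r s)) (Ici 0) := π.contDiff.comp_contDiffOn cr
  have hz : ∀ s, 0 ≤ s → HasDerivWithinAt (fun s => π (x s)) (Az (π (x s)) + π (r s)) (Ici 0) s :=
    fun s hs => by
      have := π.hasFDerivAt.comp_hasDerivWithinAt s (hx s hs)
      rwa [map_add, h.map_A] at this
  have hrz : ∀ k < n, ‖iteratedDerivWithin k (fun s => π (r s)) (Ici 0) t‖ ≤ w := fun k hk => by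
    rw [iteratedDerivWithin_clm_comp ht cr]
    exact (π.le_of_opNorm_le h.norm_le _).trans (by rw [one_mul]; exact hr k hk)
  have j1 := hκ n hn w hw _ _ cz' crz hz t ht hrz
  have jz := jetBound_of_hasDerivWithinAt cz' crz hz (n := n) ht hw0 zero_le_one
    (fun k hk => by simpa using hrz k hk)
  set w₀ := √(1 + ‖π (x t)‖ ^ 2) with hw₀
  have hw₀1 : 1 ≤ w₀ := Real.one_le_sqrt.2 (by nlinarith [sq_nonneg ‖π (x t)‖])
  have hzw₀ : ‖π (x t)‖ ≤ w₀ := Real.le_sqrt_of_sq_le (by linarith)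
  have hzw : ‖π (x t)‖ + w ≤ 2 * w * w₀ := by nlinarith
  have jz1 : JetBound n (fun s => π (x s)) t w₀ (2 * w * cz) :=
    (jz.mono hzw (by positivity) hcz0 le_rfl).absorb (by linarith) hzw₀ hcz0
  have jweight := hweight n hn _ t (2 * w * cz) ht (by positivity) cz' jz1
  -- the new block
  set X := q * (w₀ * w) with hX
  have hww : 1 ≤ w₀ * w := one_le_mul_of_one_le_of_one_le hw₀1 hw
  have hX1 : 1 ≤ X := one_le_mul_of_one_le_of_one_le hq1 hww
  have cξ' : ContDiffOn ℝ ∞ (fun s => Pi (x s)) (Ici 0) := Pi.contDiff.comp_contDiffOn cx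
  have cBz : ContDiffOn ℝ ∞ (fun s => B (π (x s))) (Ici 0) := B.contDiff.comp_contDiffOn cz'
  have cPr : ContDiffOn ℝ ∞ (fun s => Pi (r s)) (Ici 0) := Pi.contDiff.comp_contDiffOn cr
  have hξ : ∀ s, 0 ≤ s → HasDerivWithinAt (fun s => Pi (x s))
      (A₁ (Pi (x s)) + (B (π (x s)) + Pi (r s))) (Ici 0) s := fun s hs => by
    have h1 := Pi.hasFDerivAt.comp_hasDerivWithinAt s (hx s hs)
    refine h1.congr_deriv ?_
    rw [← h.decoupled]
    simp [hB, h.map_b']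
  have hrξ : ∀ k < n, ‖iteratedDerivWithin k (fun s => B (π (x s)) + Pi (r s)) (Ici 0) t‖ ≤
      X * cz ^ k := fun k hk => by
    have hk' : (k : WithTop ℕ∞) ≤ ∞ := by exact_mod_cast le_top
    rw [iteratedDerivWithin_fun_add (f := fun s => B (π (x s))) (mem_Ici.2 ht) (uniqueDiffOn_Ici 0)
      (cBz.of_le hk' t ht) (cPr.of_le hk' t ht), iteratedDerivWithin_clm_comp ht cz',
      iteratedDerivWithin_clm_comp ht cr]
    have h1 := B.le_opNorm_of_le (jz k hk.le)
    have h2 := Pi.le_opNorm_of_le (hr k hk)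
    have h3 : (1 : ℝ) ≤ cz ^ k := one_le_pow₀ hcz1
    refine (norm_add_le _ _).trans ((add_le_add h1 h2).trans ?_)
    calc _ ≤ ‖B‖ * (2 * w * w₀ * cz ^ k) + ‖Pi‖ * (w * w₀ * cz ^ k) := by
          gcongr
          calc w = w * 1 * 1 := by ring
            _ ≤ _ := by gcongr
      _ = (2 * ‖B‖ + ‖Pi‖) * (w₀ * w * cz ^ k) := by ring
      _ ≤ q * (w₀ * w * cz ^ k) := by gcongr; linarith
      _ = _ := by rw [hX]; ring
  have jξ := jetBound_of_hasDerivWithinAt cξ' (cBz.add cPr) hξ (n := n) ht (by positivity) hcz0 hrξ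
  set jx := √(1 + ‖Pi (x t)‖ ^ 2) with hjx
  have hjx1 : 1 ≤ jx := Real.one_le_sqrt.2 (by nlinarith [sq_nonneg ‖Pi (x t)‖])
  have hξjx : ‖Pi (x t)‖ ≤ jx := Real.le_sqrt_of_sq_le (by linarith)
  have jξ1 : JetBound n (fun s => Pi (x s)) t jx (2 * X * cξ) :=
    (jξ.mono (a' := 2 * X * jx) (by nlinarith) (by positivity) hcξ0 le_rfl).absorb (by linarith)
      hξjx hcξ0
  have jjap := hjap n hn _ t (2 * X * cξ) ht (by positivity) cξ' jξ1
  have jinner : JetBound n (fun s => ⟪β, Pi (x s)⟫_ℝ) t (‖β‖ * jx) (2 * X * cξ) := by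
    have := jξ1.clm ht cξ' (innerSL ℝ β)
    rwa [innerSL_apply_norm] at this
  have cinner : ContDiffOn ℝ ∞ (fun s => ⟪β, Pi (x s)⟫_ℝ) (Ici 0) :=
    (innerSL ℝ β).contDiff.comp_contDiffOn cξ'
  simp only [← invJap_eq_rpow] at jjap
  simp only [← weight_eq_rpow] at jweight
  have cjap : ContDiffOn ℝ ∞ (fun s => invJap (Pi (x s))) (Ici 0) :=
    contDiff_invJap.comp_contDiffOn cξ'
  have cweight : ContDiffOn ℝ ∞ (fun s => weight p (π (x s))) (Ici 0) :=
    (contDiff_weight p).comp_contDiffOn cz'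
  have j2 := ((jinner.mul jjap ht cinner cjap).mul jweight ht (cinner.mul cjap) cweight).clm ht
    ((cinner.mul cjap).mul cweight) (-l • ContinuousLinearMap.id ℝ ℝ)
  have j3 : JetBound n (fun s => -l * ((⟪β, Pi (x s)⟫_ℝ * invJap (Pi (x s))) *
      weight p (π (x s)))) t (l * (‖β‖ * Cj * Cw * c₃ ^ p + 1)) w := by
    intro k hk
    refine (j2 k hk).trans ?_
    have h1 : ‖-l • ContinuousLinearMap.id ℝ ℝ‖ ≤ l := by
      rw [norm_smul, norm_neg, Real.norm_of_nonneg hl.le]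
      exact mul_le_of_le_one_right hl.le (ContinuousLinearMap.norm_id_le)
    have h2 : ‖β‖ * jx * (Cj * invJap (Pi (x t))) = ‖β‖ * Cj := by
      have : jx * invJap (Pi (x t)) = 1 := mul_inv_cancel₀ (by positivity)
      calc _ = ‖β‖ * Cj * (jx * invJap (Pi (x t))) := by ring
        _ = _ := by rw [this, mul_one]
    have h3 : 2 * X * cξ + 4 * (2 * X * cξ) + 4 * (2 * w * cz) ≤ c₃ * (w₀ * w) := by
      have h4 : w ≤ w₀ * w := le_mul_of_one_le_left hw0 hw₀1
      have h5 : 8 * cz * w ≤ 8 * cz * (w₀ * w) := by gcongr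
      rw [hX, hc₃]
      linarith
    have hwp := weight_pos p (π (x t))
    have h6 : weight p (π (x t)) * w₀ ^ k ≤ 1 := weight_mul_sqrt_pow_le_one (by omega) _
    have h7 : c₃ ^ k ≤ c₃ ^ p := pow_le_pow_right₀ hc₃1 (hk.trans hn)
    rw [h2]
    calc _ ≤ l * (‖β‖ * Cj * (Cw * weight p (π (x t)))) * (c₃ * (w₀ * w)) ^ k := by gcongr
      _ = l * (‖β‖ * Cj * Cw * c₃ ^ k * (weight p (π (x t)) * w₀ ^ k)) * w ^ k := by ring_nf
      _ ≤ l * (‖β‖ * Cj * Cw * c₃ ^ p * 1) * w ^ k := by gcongr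
      _ ≤ _ := by
        gcongr
        linarith
  exact j1.add j3 ht (cκ.comp_contDiffOn cz')
    (contDiffOn_const.mul ((cinner.mul cjap).mul cweight))

end ExtensionJets

/-! ### Splitting off a critical eigenspace -/

section Construction

open scoped InnerProductSpace

universe u

/-- Controllability of `(A, b)`: no proper `A`-invariant subspace contains `b`. -/
def IsReachable {E : Type*} [NormedAddCommGroup E] [NormedSpace ℝ E] (A : E →L[ℝ] E) (b : E) :
    Prop :=
  ∀ S : Submodule ℝ E, b ∈ S → (∀ x ∈ S, A x ∈ S) → S = ⊤

/-- All eigenvalues of `A` are imaginary, in a form that passes to quotients: `A` is annihilated by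
a product of factors `A² + ω²` with `ω` real. -/
def IsCritical {E : Type*} [NormedAddCommGroup E] [NormedSpace ℝ E] (A : E →L[ℝ] E) : Prop :=
  ∃ l : List ℝ, (l.map fun ω => A * A + (ω ^ 2) • (1 : E →L[ℝ] E)).prod = 0

/-- A real invariant subspace of dimension one or two: `v` and `A v` span it. -/
theorem IsCritical.exists_apply_apply_eq {E : Type*} [NormedAddCommGroup E] [NormedSpace ℝ E]
    [Nontrivial E] {A : E →L[ℝ] E} (h : IsCritical A) :
    ∃ (ω : ℝ) (v : E), v ≠ 0 ∧ A (A v) = -(ω ^ 2) • v ∧ (ω = 0 → A v = 0) := by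
  obtain ⟨l, hl⟩ := h
  have key : ∃ (ω : ℝ) (v : E), v ≠ 0 ∧ A (A v) = -(ω ^ 2) • v := by
    by_contra! hcon
    have hinj : ∀ l : List ℝ, ∀ v : E,
        (l.map fun ω => A * A + (ω ^ 2) • (1 : E →L[ℝ] E)).prod v = 0 → v = 0 := by
      intro l
      induction l with
      | nil => intro v hv; simpa using hv
      | cons ω l ih =>
        intro v hv
        rw [List.map_cons, List.prod_cons] at hv
        refine ih v (by_contra fun h0 => hcon ω _ h0 ?_)
        have h1 : A (A ((l.map fun ω => A * A + (ω ^ 2) • (1 : E →L[ℝ] E)).prod v)) +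
          (ω ^ 2) • ((l.map fun ω => A * A + (ω ^ 2) • (1 : E →L[ℝ] E)).prod v) = 0 := hv
        rw [neg_smul]
        exact eq_neg_of_add_eq_zero_left h1
    obtain ⟨v, hv⟩ := exists_ne (0 : E)
    exact hv (hinj l v (by rw [hl]; rfl))
  obtain ⟨ω, v, hv, hA⟩ := key
  by_cases hω : ω = 0
  · subst hω
    by_cases hAv : A v = 0
    · exact ⟨0, v, hv, hA, fun _ => hAv⟩
    · have h0 : A (A v) = 0 := by rw [hA]; simp
      exact ⟨0, A v, hAv, by rw [h0]; simp, fun _ => h0⟩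
  · exact ⟨ω, v, hv, hA, fun h => absurd h hω⟩

section Quotient

variable {E Z : Type*} [NormedAddCommGroup E] [NormedSpace ℝ E] [NormedAddCommGroup Z]
  [NormedSpace ℝ Z] {A : E →L[ℝ] E} {Az : Z →L[ℝ] Z} {π : E →L[ℝ] Z}

theorem IsCritical.of_surjective (h : IsCritical A) (hπ : Function.Surjective π)
    (hA : ∀ x, π (A x) = Az (π x)) : IsCritical Az := by
  obtain ⟨l, hl⟩ := h
  refine ⟨l, ?_⟩
  have key : ∀ l : List ℝ, ∀ x, π ((l.map fun ω => A * A + (ω ^ 2) • (1 : E →L[ℝ] E)).prod x) =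
      (l.map fun ω => Az * Az + (ω ^ 2) • (1 : Z →L[ℝ] Z)).prod (π x) := by
    intro l
    induction l with
    | nil => intro x; simp
    | cons ω l ih =>
      intro x
      rw [List.map_cons, List.prod_cons, List.map_cons, List.prod_cons]
      simp only [mul_apply_eq_comp, add_apply, smul_apply,
        one_apply_eq_self, map_add, map_smul, hA, ih]
  ext z
  obtain ⟨x, rfl⟩ := hπ z
  rw [← key l x, hl]
  simp

theorem IsReachable.of_surjective {b : E} (h : IsReachable A b) (hπ : Function.Surjective π)
    (hA : ∀ x, π (A x) = Az (π x)) : IsReachable Az (π b) := by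
  intro S hb hS
  have h1 := h (S.comap π.toLinearMap) hb (fun x hx => by
    change π (A x) ∈ S
    rw [hA]; exact hS _ hx)
  rw [eq_top_iff]
  intro z _
  obtain ⟨x, rfl⟩ := hπ z
  have : x ∈ S.comap π.toLinearMap := by rw [h1]; trivial
  exact this

end Quotient

theorem exists_norm_le_of_injective {E Z W : Type*} [NormedAddCommGroup E] [NormedSpace ℝ E]
    [FiniteDimensional ℝ E] [NormedAddCommGroup Z] [NormedSpace ℝ Z] [NormedAddCommGroup W]
    [NormedSpace ℝ W] (Pi : E →L[ℝ] W) (π : E →L[ℝ] Z) (h : ∀ x, Pi x = 0 → π x = 0 → x = 0) :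
    ∃ c, 0 < c ∧ ∀ x, ‖x‖ ≤ c * (‖Pi x‖ + ‖π x‖) := by
  obtain ⟨c, hc, hL⟩ := (Pi.toLinearMap.prod π.toLinearMap).exists_antilipschitzWith (by
    rw [LinearMap.ker_eq_bot']
    intro x hx
    exact h x (congrArg Prod.fst hx) (congrArg Prod.snd hx))
  refine ⟨c, hc, fun x => ?_⟩
  have h1 := hL.le_mul_dist x 0
  rw [map_zero, dist_zero_right, dist_zero_right] at h1
  refine h1.trans ?_
  gcongr
  exact max_le_add_of_nonneg (norm_nonneg _) (norm_nonneg _)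

/-- The feedback of a quotient extends to the whole system, once a damped block that decouples
from the closed-loop quotient is known. -/
theorem IsBlockSplitting.exists_isGoodFeedback {E Z W : Type u}
    [NormedAddCommGroup E] [InnerProductSpace ℝ E] [CompleteSpace E]
    [NormedAddCommGroup Z] [InnerProductSpace ℝ Z] [CompleteSpace Z]
    [NormedAddCommGroup W] [InnerProductSpace ℝ W] [CompleteSpace W]
    {A : E →L[ℝ] E} {b : E} {Az : Z →L[ℝ] Z} {bz : Z} {K : Z →L[ℝ] ℝ} {A₁ : W →L[ℝ] W} {β : W}
    {π : E →L[ℝ] Z} {Pi : E →L[ℝ] W} {κ : Z → ℝ} (h : IsBlockSplitting A b Az bz K A₁ β π Pi)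
    {S : W →L[ℝ] W} (hS : IsDampedBlock A₁ β S) {p : ℕ} {ε : ℝ} (hε : 0 < ε)
    (hκ : IsGoodFeedback Az bz p (ε / 2) κ) (hK : IsNondegenerateLinearization Az bz κ K) :
    ∃ κ', IsGoodFeedback A b p ε κ' := by
  obtain ⟨l₀, hl₀, hgain⟩ := h.exists_hasSmallGain hS hκ.smallGain hK p
  obtain ⟨C, hC, hjet⟩ := h.exists_hasJetGain p hκ.jetGain hκ.smooth
  have hl : 0 < min l₀ (ε / (2 * C)) := by positivity
  refine ⟨extendFeedback κ π Pi β p (min l₀ (ε / (2 * C))), contDiff_extendFeedback hκ.smooth _ _,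
    boundedLipschitz_extendFeedback hκ.boundedLipschitz _ _,
    (hjet _ hl).mono ?_ hε.le, hgain _ hl (min_le_left _ _), _,
    h.isNondegenerateLinearization hS hK p hl⟩
  have h1 : min l₀ (ε / (2 * C)) * C ≤ ε / (2 * C) * C := by gcongr; exact min_le_right _ _
  have h2 : ε / (2 * C) * C = ε / 2 := by field_simp
  linarith

theorem isGoodFeedback_zero_of_subsingleton {E : Type*} [NormedAddCommGroup E]
    [InnerProductSpace ℝ E] [Subsingleton E] (A : E →L[ℝ] E) (b : E) (p : ℕ) {ε : ℝ} (hε : 0 ≤ ε) :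
    IsGoodFeedback A b p ε (fun _ => 0) where
  smooth := contDiff_const
  boundedLipschitz := boundedLipschitz_const 0
  jetGain n _ w hw x r _ _ _ t _ _ := by
    have := jetBound_const n (0 : ℝ) t (zero_le_one.trans hw)
    exact this.mono (by simpa using hε) hε (by linarith) le_rfl
  smallGain := ⟨1, 1, one_pos, one_pos, fun δ hδ _ e _ x _ => ⟨1, one_pos, fun t _ => by
    rw [Subsingleton.elim (x t) 0, norm_zero]; linarith⟩⟩
  linearization := ⟨0, ⟨0, le_rfl, fun x => by simp⟩, fun _ x _ _ _ => Subsingleton.elim x 0⟩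

section Splitting

variable {E : Type*} [NormedAddCommGroup E] [InnerProductSpace ℝ E] [FiniteDimensional ℝ E]
  {Z : Type*} [NormedAddCommGroup Z] [InnerProductSpace ℝ Z] [FiniteDimensional ℝ Z]
  {A : E →L[ℝ] E} {b v : E} {Az : Z →L[ℝ] Z} {bz : Z} {K : Z →L[ℝ] ℝ} {π : E →L[ℝ] Z} {ω : ℝ}

/-- A functional that annihilates the range of `F² + ω²`, `F = A + b K π` being the linearised
closed loop. It cannot vanish at both `v` and `A v`: it would come from the quotient, where
`F² + ω²` is onto. -/
theorem exists_functional (hA : ∀ x, π (A x) = Az (π x)) (hb : π b = bz)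
    (hπ : Function.Surjective π)
    (hker : ∀ x, π x = 0 → ∃ α γ : ℝ, x = α • v + γ • A v)
    (hK : ∀ (ν : ℝ) (x y : Z), y = Az x + K x • bz → Az y + K y • bz = -(ν ^ 2) • x → x = 0)
    (hv : v ≠ 0) (hπv : π v = 0) (hπAv : π (A v) = 0) (hAv : A (A v) = -(ω ^ 2) • v)
    (hω : ω = 0 → A v = 0) :
    ∃ φ : E →L[ℝ] ℝ, φ ≠ 0 ∧
      (∀ x y, y = A x + K (π x) • b → φ (A y + K (π y) • b) = -(ω ^ 2) * φ x) ∧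
      (ω = 0 → ∀ x, φ (A x + K (π x) • b) = 0) ∧ ¬(φ v = 0 ∧ φ (A v) = 0) := by
  set F : E →L[ℝ] E := A + (K.comp π).smulRight b with hF
  have hFapp : ∀ x, F x = A x + K (π x) • b := fun x => by simp [hF]
  have hFv : F v = A v := by rw [hFapp, hπv]; simp
  have hFFv : F (F v) = -(ω ^ 2) • v := by rw [hFv, hFapp, hπAv, hAv]; simp
  set Fz : Z →L[ℝ] Z := Az + K.smulRight bz with hFz
  have hFzapp : ∀ z, Fz z = Az z + K z • bz := fun z => by simp [hFz]
  have hπF : ∀ x, π (F x) = Fz (π x) := fun x => by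
    rw [hFapp, hFzapp, map_add, map_smul, hA, hb]
  -- the singular operator is `F² + ω²`, or `F` itself when `ω = 0`
  obtain ⟨G, hGv, hG, hG0⟩ : ∃ G : E →L[ℝ] E, G v = 0 ∧
      (∀ x, ∃ y, F (F x) + (ω ^ 2) • x = G y) ∧ (ω = 0 → ∀ x, ∃ y, F x = G y) := by
    by_cases h0 : ω = 0
    · exact ⟨F, by rw [hFv, hω h0], fun x => ⟨F x, by simp [h0]⟩, fun _ x => ⟨x, rfl⟩⟩
    · exact ⟨F.comp F + (ω ^ 2) • ContinuousLinearMap.id ℝ E, by simp [hFFv],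
        fun x => ⟨x, by simp⟩, fun h => absurd h h0⟩
  have hnot : LinearMap.range G.toLinearMap < ⊤ := by
    rw [lt_top_iff_ne_top]
    intro htop
    have hinj : Function.Injective G.toLinearMap :=
      LinearMap.injective_iff_surjective.2 (LinearMap.range_eq_top.1 htop)
    exact hv (hinj (by simpa using hGv))
  obtain ⟨f, hf0, hf⟩ := Submodule.exists_le_ker_of_lt_top _ hnot
  have hfG : ∀ y, f (G y) = 0 := fun y => hf ⟨y, rfl⟩
  set φ : E →L[ℝ] ℝ := LinearMap.toContinuousLinearMap f with hφ
  have hφf : ∀ x, φ x = f x := fun x => rfl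
  have hFF : ∀ x, φ (F (F x)) = -(ω ^ 2) * φ x := fun x => by
    obtain ⟨y, hy⟩ := hG x
    have h1 : φ (F (F x) + (ω ^ 2) • x) = 0 := by rw [hy]; exact hfG y
    rw [map_add, map_smul, smul_eq_mul] at h1
    linarith
  refine ⟨φ, fun h => hf0 ?_, fun x y hy => ?_, fun h0 x => ?_, fun hcon => hf0 ?_⟩
  · ext x; rw [← hφf, h]; rfl
  · rw [← hFapp] at hy ⊢
    rw [hy, hFF]
  · obtain ⟨y, hy⟩ := hG0 h0 x
    rw [← hFapp, hy]; exact hfG y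
  · have hkerφ : ∀ x, π x = 0 → φ x = 0 := fun x hx => by
      obtain ⟨α, γ, rfl⟩ := hker x hx
      simp [hcon.1, hcon.2]
    have hsurj : Function.Surjective (Fz.comp Fz + (ω ^ 2) • ContinuousLinearMap.id ℝ Z) := by
      refine LinearMap.surjective_of_injective
        (f := (Fz.comp Fz + (ω ^ 2) • ContinuousLinearMap.id ℝ Z).toLinearMap) ?_
      rw [← LinearMap.ker_eq_bot, LinearMap.ker_eq_bot']
      intro z hz
      refine hK ω z (Fz z) (hFzapp z) ?_
      rw [← hFzapp, neg_smul]
      exact eq_neg_of_add_eq_zero_left hz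
    ext x
    obtain ⟨z, hz⟩ := hsurj (π x)
    obtain ⟨y, rfl⟩ := hπ z
    have h1 : π (x - (F (F y) + (ω ^ 2) • y)) = 0 := by
      rw [map_sub, map_add, hπF, hπF, map_smul, sub_eq_zero]; exact hz.symm
    have h2 := hkerφ _ h1
    rw [map_sub, map_add, hFF, map_smul, smul_eq_mul] at h2
    rw [← hφf]
    simp only [LinearMap.zero_apply]
    linarith

end Splitting

end Construction

/-! ### Induction on the dimension -/

section Induction

open scoped InnerProductSpace

section Splitting

variable {E : Type*} [NormedAddCommGroup E] [InnerProductSpace ℝ E] [FiniteDimensional ℝ E]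
  {Z : Type*} [NormedAddCommGroup Z] [InnerProductSpace ℝ Z] [FiniteDimensional ℝ Z]
  {A : E →L[ℝ] E} {b v : E} {Az : Z →L[ℝ] Z} {bz : Z} {K : Z →L[ℝ] ℝ} {π : E →L[ℝ] Z} {ω : ℝ}

/-- A zero eigenvalue. The left eigenvector `φ` of the linearised closed loop does not vanish at `b`,
since its kernel would otherwise be a proper invariant subspace of `A` that contains `b`. -/
theorem exists_isBlockSplitting_real (hreach : IsReachable A b) (hnorm : ‖π‖ ≤ 1)
    (hA : ∀ x, π (A x) = Az (π x)) (hb : π b = bz)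
    (hπ : Function.Surjective π)
    (hker : ∀ x, π x = 0 → ∃ α γ : ℝ, x = α • v + γ • A v)
    (hK : ∀ (ν : ℝ) (x y : Z), y = Az x + K x • bz → Az y + K y • bz = -(ν ^ 2) • x → x = 0)
    (hv : v ≠ 0) (hπv : π v = 0) (hAv : A v = 0) :
    ∃ Pi : E →L[ℝ] ℝ, IsBlockSplitting A b Az bz K (0 : ℝ →L[ℝ] ℝ) 1 π Pi := by
  obtain ⟨φ, hφ, -, h0, hφv⟩ := exists_functional (ω := 0) hA hb hπ hker hK hv hπv
    (by rw [hAv, map_zero]) (by simp [hAv]) (fun _ => hAv)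
  replace h0 := h0 rfl
  have hφb : φ b ≠ 0 := by
    intro hb0
    have h1 := hreach (LinearMap.ker φ.toLinearMap) hb0 (fun x _ => by
      have := h0 x
      rw [map_add, map_smul, hb0, smul_zero, add_zero] at this
      exact this)
    exact hφ (by ext x; exact LinearMap.congr_fun (LinearMap.ker_eq_top.1 h1) x)
  have hφv0 : φ v ≠ 0 := fun h => hφv ⟨h, by rw [hAv, map_zero]⟩
  refine ⟨(φ b)⁻¹ • φ, hnorm, hA, hb, fun x => ?_, ?_, ?_⟩
  · simp only [smul_apply, zero_apply, h0, smul_zero]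
  · simp [hφb]
  · refine exists_norm_le_of_injective _ _ fun x hx hπx => ?_
    obtain ⟨α, γ, rfl⟩ := hker x hπx
    have : α = 0 := by simpa [hAv, hφb, hφv0] using hx
    simp [this, hAv]

/-- A pair of eigenvalues `± i ω`. With `F` the linearised closed loop, `P = φ ∘ F + i ω φ` is a
complex left eigenvector: `P ∘ F = i ω P`. -/
theorem exists_isBlockSplitting_complex (hreach : IsReachable A b) (hnorm : ‖π‖ ≤ 1)
    (hA : ∀ x, π (A x) = Az (π x)) (hb : π b = bz)
    (hπ : Function.Surjective π)
    (hker : ∀ x, π x = 0 → ∃ α γ : ℝ, x = α • v + γ • A v)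
    (hK : ∀ (ν : ℝ) (x y : Z), y = Az x + K x • bz → Az y + K y • bz = -(ν ^ 2) • x → x = 0)
    (hv : v ≠ 0) (hπv : π v = 0) (hπAv : π (A v) = 0) (hAv : A (A v) = -(ω ^ 2) • v)
    (hω : ω ≠ 0) :
    ∃ Pi : E →L[ℝ] ℂ, IsBlockSplitting A b Az bz K (rotationCLM ω) 1 π Pi := by
  obtain ⟨φ, hφ, hFF, -, hφv⟩ := exists_functional hA hb hπ hker hK hv hπv hπAv hAv
    (fun h => absurd h hω)
  set F : E →L[ℝ] E := A + (K.comp π).smulRight b with hF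
  have hFapp : ∀ x, F x = A x + K (π x) • b := fun x => by simp [hF]
  set P : E →L[ℝ] ℂ := Complex.ofRealCLM.comp (φ.comp F) +
    (Complex.I * (ω : ℂ)) • Complex.ofRealCLM.comp φ with hP
  have hPapp : ∀ x, P x = (φ (F x) : ℂ) + Complex.I * ω * (φ x : ℂ) := fun x => by simp [hP]
  have hPF : ∀ x, P (F x) = Complex.I * ω * P x := fun x => by
    have h1 : φ (F (F x)) = -(ω ^ 2) * φ x := by
      rw [hFapp (F x)]; exact hFF x (F x) (hFapp x)
    rw [hPapp, hPapp, h1]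
    push_cast
    linear_combination (-(ω : ℂ) ^ 2 * φ x) * Complex.I_sq
  have hP0 : ∀ x, P x = 0 → φ (F x) = 0 ∧ φ x = 0 := fun x hx => by
    rw [hPapp] at hx
    have h1 := congrArg Complex.re hx
    have h2 := congrArg Complex.im hx
    simp at h1 h2
    exact ⟨h1, h2.resolve_left hω⟩
  have hPb : P b ≠ 0 := by
    intro hb0
    have h1 := hreach (LinearMap.ker P.toLinearMap) hb0 (fun x hx => by
      have h2 : P (F x) = 0 := by
        rw [hPF]; rw [show P x = 0 from hx, mul_zero]
      rw [hFapp, map_add, map_smul, hb0, smul_zero, add_zero] at h2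
      exact h2)
    refine hφ ?_
    ext x
    have h3 : x ∈ LinearMap.ker P.toLinearMap := by rw [h1]; trivial
    exact (hP0 x h3).2
  refine ⟨(P b)⁻¹ • P, hnorm, hA, hb, fun x => ?_, ?_, ?_⟩
  · rw [← hFapp]
    simp only [smul_apply, hPF, smul_eq_mul]
    change _ = Complex.I * ω * _
    ring
  · simp [hPb]
  · refine exists_norm_le_of_injective _ _ fun x hx hπx => ?_
    have hx' : P x = 0 := by simpa [hPb] using hx
    obtain ⟨h1, h2⟩ := hP0 x hx'
    rw [hFapp, hπx, map_zero, zero_smul, add_zero] at h1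
    obtain ⟨α, γ, rfl⟩ := hker x hπx
    simp only [map_add, map_smul, hAv, smul_eq_mul] at h1 h2
    have hpos : 0 < ω ^ 2 * φ v ^ 2 + φ (A v) ^ 2 := by
      have hω2 : 0 < ω ^ 2 := by positivity
      by_cases h : φ v = 0
      · have : φ (A v) ≠ 0 := fun h' => hφv ⟨h, h'⟩
        positivity
      · positivity
    have hα : α = 0 := by
      have : α * (ω ^ 2 * φ v ^ 2 + φ (A v) ^ 2) = 0 := by
        linear_combination (ω ^ 2 * φ v) * h2 + φ (A v) * h1
      exact (mul_eq_zero.1 this).resolve_right hpos.ne'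
    have hγ : γ = 0 := by
      have : γ * (ω ^ 2 * φ v ^ 2 + φ (A v) ^ 2) = 0 := by
        linear_combination φ (A v) * h2 - φ v * h1
      exact (mul_eq_zero.1 this).resolve_right hpos.ne'
    simp [hα, hγ]

end Splitting

/-- By induction on the dimension: an `A`-invariant subspace spanned by `v` and `A v`, on which
`A² = -ω²`, is factored out, and the feedback of the quotient extends. -/
theorem exists_isGoodFeedback (p : ℕ) (E : Type) [NormedAddCommGroup E] [InnerProductSpace ℝ E]
    [FiniteDimensional ℝ E] (A : E →L[ℝ] E) (b : E) (hreach : IsReachable A b)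
    (hcrit : IsCritical A) {ε : ℝ} (hε : 0 < ε) : ∃ κ, IsGoodFeedback A b p ε κ := by
  induction hd : Module.finrank ℝ E using Nat.strong_induction_on generalizing E ε with
  | _ d ih =>
  rcases subsingleton_or_nontrivial E with hE | hE
  · exact ⟨_, isGoodFeedback_zero_of_subsingleton A b p hε.le⟩
  obtain ⟨ω, v, hv, hAv, hω⟩ := hcrit.exists_apply_apply_eq
  set U : Submodule ℝ E := Submodule.span ℝ {v, A v} with hU
  have hvU : v ∈ U := Submodule.subset_span (by simp)
  have hAvU : A v ∈ U := Submodule.subset_span (by simp)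
  have hUA : ∀ x ∈ U, A x ∈ U := fun x hx => by
    obtain ⟨α, γ, rfl⟩ := Submodule.mem_span_pair.1 hx
    rw [map_add, map_smul, map_smul, hAv]
    exact U.add_mem (U.smul_mem _ hAvU) (U.smul_mem _ (U.smul_mem _ hvU))
  set π : E →L[ℝ] Uᗮ := Uᗮ.orthogonalProjectionOnto with hπ
  have hπ0 : ∀ x, π x = 0 ↔ x ∈ U := fun x => by
    rw [hπ, Submodule.orthogonalProjectionOnto_eq_zero_iff, Submodule.orthogonal_orthogonal]
  have hπself : ∀ z : Uᗮ, π z = z := fun z =>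
    Submodule.orthogonalProjectionOnto_mem_subspace_eq_self z
  have hsurj : Function.Surjective π := fun z => ⟨z, hπself z⟩
  set Az : Uᗮ →L[ℝ] Uᗮ := (π.comp A).comp Uᗮ.subtypeL with hAz
  have hA : ∀ x, π (A x) = Az (π x) := fun x => by
    have h1 : x - (π x : E) ∈ U := by rw [← hπ0, map_sub, hπself, sub_self]
    have h2 := (hπ0 _).2 (hUA _ h1)
    rw [map_sub, map_sub, sub_eq_zero] at h2
    exact h2
  have hker : ∀ x, π x = 0 → ∃ α γ : ℝ, x = α • v + γ • A v := fun x hx => by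
    obtain ⟨α, γ, h⟩ := Submodule.mem_span_pair.1 ((hπ0 x).1 hx)
    exact ⟨α, γ, h.symm⟩
  have hlt : Module.finrank ℝ Uᗮ < d := by
    have h1 := Submodule.finrank_add_finrank_orthogonal U
    have h2 : 0 < Module.finrank ℝ U :=
      Module.finrank_pos_iff_exists_ne_zero.2 ⟨⟨v, hvU⟩, fun h => hv (congrArg Subtype.val h)⟩
    omega
  obtain ⟨κ, hκ⟩ := ih _ hlt Uᗮ Az (π b) (hreach.of_surjective hsurj hA)
    (hcrit.of_surjective hsurj hA) (half_pos hε) rfl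
  obtain ⟨K, hK⟩ := hκ.linearization
  have hnorm : ‖π‖ ≤ 1 := Submodule.orthogonalProjectionOnto_norm_le _
  by_cases h0 : ω = 0
  · obtain ⟨Pi, hPi⟩ := exists_isBlockSplitting_real hreach hnorm hA rfl hsurj hker hK.2 hv
      ((hπ0 v).2 hvU) (hω h0)
    exact hPi.exists_isGoodFeedback isDampedBlock_real hε hκ hK
  · obtain ⟨Pi, hPi⟩ := exists_isBlockSplitting_complex hreach hnorm hA rfl hsurj hker hK.2 hv
      ((hπ0 v).2 hvU) ((hπ0 _).2 hAvU) hAv h0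
    exact hPi.exists_isGoodFeedback (isDampedBlock_complex h0) hε hκ hK

end Induction

/-! ### From matrices to operators -/

section Matrices

theorem HasOnlyCriticalEigenvalues.isCritical {n : ℕ} {A : Matrix (Fin n) (Fin n) ℝ}
    (hA : HasOnlyCriticalEigenvalues A) : IsCritical (Matrix.toEuclideanCLM (𝕜 := ℝ) A) := by
  set M := A.map (algebraMap ℝ ℂ) with hM
  set T := Matrix.toLin' M with hT
  set f := Polynomial.aeval (R := ℂ) T with hf
  set L := M.charpoly.roots.toList with hL
  have hre : ∀ z ∈ L, z.re = 0 := fun z hz =>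
    hA z (mem_spectrum_of_mem_charpoly_roots (Multiset.mem_toList.1 hz))
  have hkill : ∀ v, f ((L.map fun z => Polynomial.X - Polynomial.C z).prod) v = 0 := fun v => by
    rw [map_list_prod, List.map_map]
    have h : (f ∘ fun z => Polynomial.X - Polynomial.C z) = fun z => T - algebraMap ℂ _ z := by
      funext z; simp [hf]
    rw [h]
    exact prod_charpoly_roots_apply M v
  -- `T² + ω² = (T + z) (T - z)` for an imaginary root `z = i ω`
  have hkill2 : ∀ v, f ((L.map fun z => (Polynomial.X + Polynomial.C z) *
      (Polynomial.X - Polynomial.C z)).prod) v = 0 := fun v => by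
    rw [List.prod_map_mul, map_mul, Module.End.mul_apply, hkill, map_zero]
  have htransfer : ∀ l : List ℂ, (∀ z ∈ l, z.re = 0) → ∀ x, complexify n
      (((l.map Complex.im).map fun ω => Matrix.toEuclideanCLM (𝕜 := ℝ) A *
        Matrix.toEuclideanCLM (𝕜 := ℝ) A + (ω ^ 2) •
          (1 : EuclideanSpace ℝ (Fin n) →L[ℝ] EuclideanSpace ℝ (Fin n))).prod x) =
      f ((l.map fun z => (Polynomial.X + Polynomial.C z) *
        (Polynomial.X - Polynomial.C z)).prod) (complexify n x) := by
    intro l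
    induction l with
    | nil => intro _ x; simp
    | cons z l ih =>
      intro hz x
      have hz0 : z ^ 2 = -((z.im ^ 2 : ℝ) : ℂ) := by
        have h1 : z = Complex.I * z.im := by
          apply Complex.ext <;> simp [hz z (by simp)]
        conv_lhs => rw [h1]
        push_cast
        linear_combination ((z.im : ℂ) ^ 2) * Complex.I_sq
      have hX : (Polynomial.X + Polynomial.C z) * (Polynomial.X - Polynomial.C z) =
          Polynomial.X ^ 2 + Polynomial.C ((z.im ^ 2 : ℝ) : ℂ) := by
        have : Polynomial.C (z ^ 2) = -Polynomial.C ((z.im ^ 2 : ℝ) : ℂ) := by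
          rw [hz0, Polynomial.C_neg]
        rw [Polynomial.C_pow] at this
        linear_combination -this
      have hfX : ∀ v, f (Polynomial.X ^ 2 + Polynomial.C ((z.im ^ 2 : ℝ) : ℂ)) v =
          T (T v) + ((z.im ^ 2 : ℝ) : ℂ) • v := fun v => by
        rw [map_add, LinearMap.add_apply, pow_two, map_mul, Module.End.mul_apply, hf,
          Polynomial.aeval_X, Polynomial.aeval_C, Module.algebraMap_end_apply]
      rw [List.map_cons, List.map_cons, List.prod_cons, List.map_cons, List.prod_cons, map_mul,
        Module.End.mul_apply, hX, hfX, ← ih (fun w hw => hz w (by simp [hw]))]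
      simp only [mul_apply_eq_comp, add_apply, smul_apply, one_apply_eq_self, map_add, map_smul,
        complexify_mulVec]
      rw [Complex.coe_smul]
  refine ⟨L.map Complex.im, ?_⟩
  ext1 x
  apply complexify_injective
  rw [htransfer L hre, hkill2]
  simp

theorem IsControllablePair.isReachable {n : ℕ} {A : Matrix (Fin n) (Fin n) ℝ} {b : Fin n → ℝ}
    (h : IsControllablePair A b) :
    IsReachable (Matrix.toEuclideanCLM (𝕜 := ℝ) A) (WithLp.toLp 2 b) := by
  intro S hb hS
  have hpow : ∀ k : ℕ, WithLp.toLp 2 ((A ^ k).mulVec b) ∈ S := by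
    intro k
    induction k with
    | zero => simpa using hb
    | succ k ih =>
      have := hS _ ih
      rw [Matrix.toEuclideanCLM_toLp, Matrix.mulVec_mulVec, ← pow_succ'] at this
      exact this
  rw [eq_top_iff]
  intro x _
  have h1 : Submodule.span ℝ (range fun k : Fin n => (A ^ (k : ℕ)).mulVec b) ≤
      S.comap (WithLp.linearEquiv 2 ℝ (Fin n → ℝ)).symm.toLinearMap := by
    rw [Submodule.span_le]
    rintro _ ⟨k, rfl⟩
    exact hpow k
  rw [IsControllablePair] at h
  rw [h] at h1
  exact h1 (x := x.ofLp) trivial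

end Matrices

/-! ### Closed loops -/

section ClosedLoop

open scoped ContDiff

/-- For a globally Lipschitz closed loop forward completeness is automatic, so that only the
asymptotic gain has to be proved. -/
theorem isSISSLStabilizing_of_smallGain {E V : Type*} [NormedAddCommGroup E] [NormedSpace ℝ E]
    [CompleteSpace E] {f : E → V → E} {ν : E → V} {g : E → E}
    (hfg : closedLoop f ν = g) (hg : ∃ K, 0 ≤ K ∧ ∀ x y, ‖g x - g y‖ ≤ K * ‖x - y‖) (hg0 : g 0 = 0)
    (h : ∃ Δ N : ℝ, 0 < Δ ∧ 0 < N ∧ ∀ δ, 0 < δ → δ ≤ Δ → ∀ e : ℝ → E, EventuallyBoundedBy e δ →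
      ∀ x, IsSolution (fun t x => g x + e t) x → EventuallyBoundedBy x (N * δ)) :
    IsSISSLStabilizing f ν := by
  obtain ⟨K, hK, hL⟩ := hg
  obtain ⟨Δ, N, hΔ, hN, hgain⟩ := h
  have h1 : IsSISSLInputFree g := ⟨Δ, N, hΔ, hN, fun δ hδ hδΔ e he heδ =>
    ⟨isForwardComplete_of_lipschitz hK hL he, fun x hx => hgain δ hδ hδΔ e heδ x hx⟩⟩
  rw [IsSISSLStabilizing, hfg]
  exact ⟨h1.isGAS hK hL hg0, h1⟩

variable {E : Type*} [NormedAddCommGroup E] [InnerProductSpace ℝ E] {A : E →L[ℝ] E} {b : E}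
  {p : ℕ} {ε : ℝ} {κ : E → ℝ}

theorem IsGoodFeedback.apply_zero (h : IsGoodFeedback A b p ε κ) : κ 0 = 0 := by
  obtain ⟨K, ⟨C, _, hC⟩, -⟩ := h.linearization
  simpa using hC 0

/-- The residual is now `κ x • b` itself: bounds for the derivatives of the control of order less
than `n` give, through the jet gain, bounds for the order `n`. -/
theorem IsGoodFeedback.exists_jetBound [CompleteSpace E] (h : IsGoodFeedback A b p ε κ)
    (hε : 0 ≤ ε) : ∀ n ≤ p, ∃ w, 1 ≤ w ∧ ∀ x, IsSolution (fun _ x => A x + κ x • b) x →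
      ∀ t, 0 ≤ t → JetBound n (fun s => κ (x s)) t ε w := by
  have hG : ContDiff ℝ ∞ fun x => A x + κ x • b :=
    A.contDiff.add (h.smooth.smul contDiff_const)
  have hmain : ∀ n ≤ p, ∀ w : ℝ, 1 ≤ w → ∀ x, IsSolution (fun _ x => A x + κ x • b) x →
      ∀ t, 0 ≤ t → (∀ k < n, ‖b‖ * ‖iteratedDerivWithin k (fun s => κ (x s)) (Ici 0) t‖ ≤ w) →
        JetBound n (fun s => κ (x s)) t ε w := by
    intro n hn w hw x hx t ht hk
    have hxs := IsSolution.contDiffOn hG hx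
    have hκs : ContDiffOn ℝ ∞ (fun s => κ (x s)) (Ici 0) := h.smooth.comp_contDiffOn hxs
    refine h.jetGain n hn w hw x (fun s => κ (x s) • b) hxs (hκs.smul contDiffOn_const)
      (fun s hs => IsSolution.hasDerivWithinAt hG.continuous hx hs) t ht (fun k hkn => ?_)
    have h1 := iteratedDerivWithin_clm_comp ht hκs ((1 : ℝ →L[ℝ] ℝ).smulRight b) k
    have h2 : iteratedDerivWithin k (fun s => κ (x s) • b) (Ici 0) t =
      iteratedDerivWithin k (fun s => κ (x s)) (Ici 0) t • b := h1
    rw [h2, norm_smul, mul_comm]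
    exact hk k hkn
  intro n
  induction n with
  | zero => exact fun hn => ⟨1, le_rfl, fun x hx t ht =>
      hmain 0 hn 1 le_rfl x hx t ht (fun k hk => absurd hk (Nat.not_lt_zero k))⟩
  | succ n ih =>
    intro hn
    obtain ⟨w, hw, hjet⟩ := ih (by omega)
    have hw0 : 0 ≤ w := zero_le_one.trans hw
    refine ⟨1 + ‖b‖ * (ε * w ^ n), le_add_of_nonneg_right (by positivity), fun x hx t ht =>
      hmain _ hn _ (le_add_of_nonneg_right (by positivity)) x hx t ht fun k hk => ?_⟩
    have hk' : k ≤ n := by omega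
    have h1 := hjet x hx t ht k hk'
    calc _ ≤ ‖b‖ * (ε * w ^ k) := by gcongr
      _ ≤ ‖b‖ * (ε * w ^ n) := by gcongr
      _ ≤ _ := by linarith

end ClosedLoop

/-! ### Single-input systems -/

section SingleInput

open scoped ContDiff

variable {n : ℕ} {A : Matrix (Fin n) (Fin n) ℝ} {b : Fin n → ℝ} {p : ℕ} {ε : ℝ}
  {κ : EuclideanSpace ℝ (Fin n) → ℝ}

theorem closedLoop_singleInputSystem (A : Matrix (Fin n) (Fin n) ℝ) (b : Fin n → ℝ)
    (κ : EuclideanSpace ℝ (Fin n) → ℝ) : closedLoop (singleInputSystem A b) κ =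
      fun x => Matrix.toEuclideanCLM (𝕜 := ℝ) A x + κ x • WithLp.toLp 2 b := rfl

theorem IsGoodFeedback.isPBounded
    (h : IsGoodFeedback (Matrix.toEuclideanCLM (𝕜 := ℝ) A) (WithLp.toLp 2 b) p ε κ) (hε : 0 < ε) :
    IsPBounded (singleInputSystem A b) p κ := by
  obtain ⟨w, hw, hjet⟩ := h.exists_jetBound hε.le p le_rfl
  have hw0 : 0 < w := zero_lt_one.trans_le hw
  refine ⟨fun _ => ε * w ^ p, fun _ => by positivity, h.smooth.of_le (by exact_mod_cast le_top),
    fun x hx => ?_⟩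
  rw [closedLoop_singleInputSystem] at hx
  have hG : ContDiff ℝ ∞ fun x => Matrix.toEuclideanCLM (𝕜 := ℝ) A x + κ x • WithLp.toLp 2 b :=
    (Matrix.toEuclideanCLM (𝕜 := ℝ) A).contDiff.add (h.smooth.smul contDiff_const)
  refine ⟨(h.smooth.comp_contDiffOn (IsSolution.contDiffOn hG hx)).of_le (by exact_mod_cast le_top),
    fun j t ht => ?_⟩
  have hj : (j : ℕ) ≤ p := by omega
  exact (hjet x hx t ht j hj).trans
    (mul_le_mul_of_nonneg_left (pow_le_pow_right₀ hw hj) hε.le)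

theorem IsGoodFeedback.isSISSLStabilizing
    (h : IsGoodFeedback (Matrix.toEuclideanCLM (𝕜 := ℝ) A) (WithLp.toLp 2 b) p ε κ) :
    IsSISSLStabilizing (singleInputSystem A b) κ :=
  isSISSLStabilizing_of_smallGain (closedLoop_singleInputSystem A b κ)
    (h.boundedLipschitz.exists_lipschitz _ _) (by simp [h.apply_zero]) h.smallGain

end SingleInput

/-! ### Cascades of systems -/

section Cascade

open scoped ContDiff

variable {q : ℕ} {X : Fin (q + 1) → Type} [∀ i, NormedAddCommGroup (X i)]
  [∀ i, InnerProductSpace ℝ (X i)]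

theorem PiLp.norm_le_sum {ι : Type*} [Fintype ι] {Y : ι → Type*} [∀ i, NormedAddCommGroup (Y i)]
    (x : PiLp 2 Y) : ‖x‖ ≤ ∑ i, ‖x i‖ := by
  refine abs_le_of_sq_le_sq' ?_ (by positivity) |>.2
  rw [PiLp.norm_sq_eq_of_L2]
  exact Finset.sum_sq_le_sq_sum_of_nonneg fun i _ => norm_nonneg _

/-- The linear map into a Euclidean product with the given components. -/
noncomputable def piCLM {F : Type*} [NormedAddCommGroup F] [NormedSpace ℝ F]
    (L : ∀ i, F →L[ℝ] X i) : F →L[ℝ] PiLp 2 X :=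
  (PiLp.continuousLinearEquiv 2 ℝ X).symm.toContinuousLinearMap.comp (ContinuousLinearMap.pi L)

/-- The blocks `j > i` of the state, the others being replaced by zero. -/
noncomputable def tail (X : Fin (q + 1) → Type) [∀ i, NormedAddCommGroup (X i)]
    [∀ i, InnerProductSpace ℝ (X i)] (i : Fin (q + 1)) : PiLp 2 X →L[ℝ] PiLp 2 X :=
  piCLM fun j => if i < j then PiLp.proj 2 X j else 0

/-- The block matrix `a` as an operator. -/
noncomputable def drift (a : ∀ i j, X j →L[ℝ] X i) : PiLp 2 X →L[ℝ] PiLp 2 X :=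
  piCLM fun i => ∑ j, (a i j).comp (PiLp.proj 2 X j)

/-- The operator that maps the inputs `u` to the vector with blocks `∑ k, u k • β i k`. -/
noncomputable def inputMap (β : ∀ i, Fin q → X i) : EuclideanSpace ℝ (Fin q) →L[ℝ] PiLp 2 X :=
  piCLM fun i => ∑ k, (EuclideanSpace.proj k).smulRight (β i k)

theorem tail_apply (i j : Fin (q + 1)) (x : PiLp 2 X) :
    tail X i x j = if i < j then x j else 0 := by
  change (if i < j then PiLp.proj (𝕜 := ℝ) 2 X j else 0) x = _
  split_ifs <;> rfl

theorem drift_apply (a : ∀ i j, X j →L[ℝ] X i) (x : PiLp 2 X) (i : Fin (q + 1)) :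
    drift a x i = ∑ j, a i j (x j) := by
  change (∑ j, (a i j).comp (PiLp.proj (𝕜 := ℝ) 2 X j)) x = _
  rw [sum_apply]; rfl

theorem inputMap_apply (β : ∀ i, Fin q → X i) (u : EuclideanSpace ℝ (Fin q)) (i : Fin (q + 1)) :
    inputMap β u i = ∑ k, u k • β i k := by
  change (∑ k, (EuclideanSpace.proj (𝕜 := ℝ) k).smulRight (β i k)) u = _
  rw [sum_apply]; rfl

theorem norm_sq_tail (k : Fin q) (x : PiLp 2 X) :
    ‖tail X k.succ x‖ ^ 2 = ∑ l ∈ Finset.Ioi k, ‖x l.succ‖ ^ 2 := by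
  rw [PiLp.norm_sq_eq_of_L2, Fin.sum_univ_succ, tail_apply, if_neg (by simp), norm_zero,
    zero_pow two_ne_zero, zero_add, ← Finset.sum_filter_add_sum_filter_not _ (fun l => k < l)]
  rw [Finset.sum_eq_zero (s := Finset.univ.filter fun l => ¬ k < l), add_zero]
  · refine Finset.sum_congr (by ext l; simp) fun l hl => ?_
    rw [tail_apply, if_pos (by simpa using hl)]
  · intro l hl
    rw [tail_apply, if_neg (by simpa using hl), norm_zero, zero_pow two_ne_zero]

theorem norm_tail_le (i : Fin (q + 1)) {x : PiLp 2 X} {M : ℝ} (hM : 0 ≤ M)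
    (hx : ∀ l : Fin q, i < l.succ → ‖x l.succ‖ ≤ M) : ‖tail X i x‖ ≤ q * M := by
  refine (PiLp.norm_le_sum _).trans ?_
  rw [Fin.sum_univ_succ, tail_apply, if_neg (Fin.not_lt_zero i), norm_zero, zero_add]
  calc _ ≤ ∑ _l : Fin q, M := Finset.sum_le_sum fun l _ => by
        rw [tail_apply]
        split_ifs with h
        · exact hx l h
        · simpa using hM
    _ = q * M := by simp

variable {a : ∀ i j, X j →L[ℝ] X i} {β : ∀ i, Fin q → X i}

theorem drift_apply_eq (ha : ∀ i j, j < i → a i j = 0) (x : PiLp 2 X) (i : Fin (q + 1)) :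
    drift a x i = a i i (x i) + drift a (tail X i x) i := by
  rw [drift_apply, drift_apply, ← Finset.add_sum_erase _ _ (Finset.mem_univ i),
    ← Finset.add_sum_erase (a := i) _ (fun j => a i j (tail X i x j)) (Finset.mem_univ i)]
  simp only [tail_apply, lt_irrefl, if_false, map_zero, zero_add]
  congr 1
  refine Finset.sum_congr rfl fun j hj => ?_
  split_ifs with h
  · rfl
  · have : j < i := lt_of_le_of_ne (not_lt.1 h) (Finset.ne_of_mem_erase hj)
    simp [ha i j this]

theorem tail_drift (ha : ∀ i j, j < i → a i j = 0) (i : Fin (q + 1)) (x : PiLp 2 X) :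
    tail X i (drift a x) = tail X i (drift a (tail X i x)) := by
  ext1 j
  rw [tail_apply, tail_apply]
  split_ifs with h
  · rw [drift_apply, drift_apply]
    refine Finset.sum_congr rfl fun l _ => ?_
    rw [tail_apply]
    split_ifs with h'
    · rfl
    · simp [ha j l ((not_lt.1 h').trans_lt h)]
  · rfl

theorem inputMap_apply_succ (hβ : ∀ (i : Fin (q + 1)) (k : Fin q), k.succ < i → β i k = 0)
    (u : EuclideanSpace ℝ (Fin q)) (k : Fin q) :
    inputMap β u k.succ = u k • β k.succ k + ∑ l ∈ Finset.Ioi k, u l • β k.succ l := by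
  rw [inputMap_apply, ← Finset.add_sum_erase _ _ (Finset.mem_univ k)]
  congr 1
  symm
  refine Finset.sum_subset (fun l hl => ?_) (fun l hl hl' => ?_)
  · simpa using (Finset.mem_Ioi.1 hl).ne'
  · have h1 : l < k := lt_of_le_of_ne (not_lt.1 fun h => hl' (Finset.mem_Ioi.2 h))
      (Finset.ne_of_mem_erase hl)
    simp [hβ k.succ l (by simpa using h1)]

/-- The feedback that attenuates `κ k` when the blocks after the block `k` are large. -/
noncomputable def cascadeFeedback (p : ℕ) (κ : ∀ k : Fin q, X k.succ → ℝ) (x : PiLp 2 X) :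
    EuclideanSpace ℝ (Fin q) :=
  WithLp.toLp 2 fun k => κ k (x k.succ) * weight p (tail X k.succ x)

theorem cascadeFeedback_apply (p : ℕ) (κ : ∀ k : Fin q, X k.succ → ℝ) (x : PiLp 2 X) (k : Fin q) :
    cascadeFeedback p κ x k = κ k (x k.succ) * weight p (tail X k.succ x) := rfl

variable {p : ℕ} {κ : ∀ k : Fin q, X k.succ → ℝ}

theorem contDiff_cascadeFeedback (hκ : ∀ k, ContDiff ℝ ∞ (κ k)) :
    ContDiff ℝ ∞ (cascadeFeedback p κ) := by
  rw [contDiff_euclidean]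
  intro k
  exact ((hκ k).comp (PiLp.proj (𝕜 := ℝ) 2 X k.succ).contDiff).mul
    ((contDiff_weight p).comp (tail X k.succ).contDiff)

theorem exists_lipschitz_cascade (a : ∀ i j, X j →L[ℝ] X i) (β : ∀ i, Fin q → X i)
    (hκ : ∀ k, BoundedLipschitz (κ k)) : ∃ K, 0 ≤ K ∧ ∀ x y : PiLp 2 X,
      ‖(drift a x + inputMap β (cascadeFeedback p κ x)) -
        (drift a y + inputMap β (cascadeFeedback p κ y))‖ ≤ K * ‖x - y‖ := by
  have h1 : ∀ k, BoundedLipschitz fun x : PiLp 2 X => cascadeFeedback p κ x k := fun k =>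
    ((hκ k).comp_clm (PiLp.proj (𝕜 := ℝ) 2 X k.succ)).mul
      ((boundedLipschitz_weight p).comp_clm (tail X k.succ))
  choose C hC0 _ hC using h1
  have hCs : 0 ≤ ∑ k, C k := Finset.sum_nonneg fun k _ => hC0 k
  refine ⟨‖drift a‖ + ‖inputMap β‖ * ∑ k, C k, by positivity, fun x y => ?_⟩
  rw [add_sub_add_comm, ← map_sub, ← map_sub, add_mul, mul_assoc]
  refine (norm_add_le _ _).trans (add_le_add ((drift a).le_opNorm _)
    ((inputMap β).le_opNorm_of_le ?_))
  refine (PiLp.norm_le_sum _).trans ?_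
  rw [Finset.sum_mul]
  exact Finset.sum_le_sum fun k _ => hC k x y

end Cascade

/-! ### Derivatives of the control along a cascade -/

section CascadeJets

open scoped ContDiff

variable {q : ℕ} {X : Fin (q + 1) → Type} [∀ i, NormedAddCommGroup (X i)]
  [∀ i, InnerProductSpace ℝ (X i)] {a : ∀ i j, X j →L[ℝ] X i} {β : ∀ i, Fin q → X i}

/-- One inductive step on the order of the derivatives: bounds for the derivatives of the input of
order less than `n` give bounds for the derivatives of order at most `n` of every component. -/
theorem exists_jetBound_cascade_step (ha : ∀ i j, j < i → a i j = 0) (β : ∀ i, Fin q → X i)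
    (p : ℕ) (k : Fin q) :
    ∃ C : ℝ, 0 < C ∧ ∀ ε, 0 < ε → ∀ κ : X k.succ → ℝ, ContDiff ℝ ∞ κ →
      HasJetGain (a k.succ k.succ) p κ ε → ∀ (x : ℝ → PiLp 2 X) (U : ℝ → EuclideanSpace ℝ (Fin q)),
      ContDiffOn ℝ ∞ x (Ici 0) → ContDiffOn ℝ ∞ U (Ici 0) →
      (∀ t, 0 ≤ t → HasDerivWithinAt x (drift a (x t) + inputMap β (U t)) (Ici 0) t) →
      ∀ n ≤ p, ∀ t, 0 ≤ t → (∀ j < n, ‖iteratedDerivWithin j U (Ici 0) t‖ ≤ 1) →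
        JetBound n (fun s => κ (x s k.succ) * weight p (tail X k.succ (x s))) t (ε * C) 1 := by
  obtain ⟨Cw, hCw, hweight⟩ := exists_jetBound_one_add_norm_sq_rpow.{0} p (-((p + 1 : ℕ) : ℝ))
  set P := tail X k.succ with hP
  set L := P.comp (drift a) with hL
  set B := P.comp (inputMap β) with hB
  set R₁ := (PiLp.proj (𝕜 := ℝ) 2 X k.succ).comp (drift a) with hR₁
  set R₂ := (PiLp.proj (𝕜 := ℝ) 2 X k.succ).comp (inputMap β) with hR₂
  set c := (1 + ‖B‖) * (‖L‖ + 1 + 1) with hc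
  have hc1 : 1 ≤ c := one_le_mul_of_one_le_of_one_le (by linarith [norm_nonneg B])
    (by linarith [norm_nonneg L])
  set d := ‖R₁‖ * c ^ p + ‖R₂‖ + 1 with hd
  have hd0 : 1 ≤ d := by
    have : 0 ≤ ‖R₁‖ * c ^ p := by positivity
    linarith [norm_nonneg R₂]
  refine ⟨Cw * (d + 4 * c) ^ p, by positivity,
    fun ε hε κ cκ hκ x U cx cU hx n hn t ht hU => ?_⟩
  -- the blocks after the block `k`
  have cy : ContDiffOn ℝ ∞ (fun s => P (x s)) (Ici 0) := P.contDiff.comp_contDiffOn cx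
  have cB : ContDiffOn ℝ ∞ (fun s => B (U s)) (Ici 0) := B.contDiff.comp_contDiffOn cU
  have hy : ∀ s, 0 ≤ s → HasDerivWithinAt (fun s => P (x s)) (L (P (x s)) + B (U s)) (Ici 0) s :=
    fun s hs => by
      refine (P.hasFDerivAt.comp_hasDerivWithinAt s (hx s hs)).congr_deriv ?_
      rw [map_add, tail_drift ha]; rfl
  have hrB : ∀ j < n, ‖iteratedDerivWithin j (fun s => B (U s)) (Ici 0) t‖ ≤ ‖B‖ * 1 ^ j :=
    fun j hj => by
      rw [iteratedDerivWithin_clm_comp ht cU, one_pow]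
      exact B.le_opNorm_of_le (hU j hj)
  have jy := jetBound_of_hasDerivWithinAt cy cB hy (n := n) ht (norm_nonneg B) zero_le_one hrB
  set w₀ := √(1 + ‖P (x t)‖ ^ 2) with hw₀
  have hw₀1 : 1 ≤ w₀ := Real.one_le_sqrt.2 (by nlinarith [sq_nonneg ‖P (x t)‖])
  have hyw₀ : ‖P (x t)‖ ≤ w₀ := Real.le_sqrt_of_sq_le (by linarith)
  have jy1 : JetBound n (fun s => P (x s)) t w₀ c :=
    (jy.mono (a' := (1 + ‖B‖) * w₀) (by nlinarith [norm_nonneg B]) (by positivity) (by positivity)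
      le_rfl).absorb (by linarith [norm_nonneg B]) hyw₀ (by positivity)
  have jweight := hweight n hn _ t c ht (by positivity) cy jy1
  simp only [← weight_eq_rpow] at jweight
  -- the block `k`
  have cxk : ContDiffOn ℝ ∞ (fun s => x s k.succ) (Ici 0) :=
    (PiLp.proj (𝕜 := ℝ) 2 X k.succ).contDiff.comp_contDiffOn cx
  have cR₁ : ContDiffOn ℝ ∞ (fun s => R₁ (P (x s))) (Ici 0) := R₁.contDiff.comp_contDiffOn cy
  have cR₂ : ContDiffOn ℝ ∞ (fun s => R₂ (U s)) (Ici 0) := R₂.contDiff.comp_contDiffOn cU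
  have hxk : ∀ s, 0 ≤ s → HasDerivWithinAt (fun s => x s k.succ)
      (a k.succ k.succ (x s k.succ) + (R₁ (P (x s)) + R₂ (U s))) (Ici 0) s := fun s hs => by
    refine ((PiLp.proj (𝕜 := ℝ) 2 X k.succ).hasFDerivAt.comp_hasDerivWithinAt s
      (hx s hs)).congr_deriv ?_
    rw [map_add, ← add_assoc]
    congr 1
    exact drift_apply_eq ha _ _
  have hr : ∀ j < n, ‖iteratedDerivWithin j (fun s => R₁ (P (x s)) + R₂ (U s)) (Ici 0) t‖ ≤
      d * w₀ := fun j hj => by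
    have hj' : (j : WithTop ℕ∞) ≤ ∞ := by exact_mod_cast le_top
    rw [iteratedDerivWithin_fun_add (f := fun s => R₁ (P (x s))) (mem_Ici.2 ht) (uniqueDiffOn_Ici 0)
      (cR₁.of_le hj' t ht) (cR₂.of_le hj' t ht), iteratedDerivWithin_clm_comp ht cy,
      iteratedDerivWithin_clm_comp ht cU]
    refine (norm_add_le _ _).trans ((add_le_add (R₁.le_opNorm_of_le (jy1 j hj.le))
      (R₂.le_opNorm_of_le (hU j hj))).trans ?_)
    have h1 : c ^ j ≤ c ^ p := pow_le_pow_right₀ hc1 (by omega)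
    calc ‖R₁‖ * (w₀ * c ^ j) + ‖R₂‖ * 1 ≤ ‖R₁‖ * (w₀ * c ^ p) + ‖R₂‖ * w₀ := by gcongr
      _ = (‖R₁‖ * c ^ p + ‖R₂‖) * w₀ := by ring
      _ ≤ d * w₀ := by gcongr; linarith
  have jκ := hκ n hn (d * w₀) (one_le_mul_of_one_le_of_one_le hd0 hw₀1) _ _ cxk (cR₁.add cR₂) hxk
    t ht hr
  have j1 := jκ.mul jweight ht (cκ.comp_contDiffOn cxk) ((contDiff_weight p).comp_contDiffOn cy)
  intro j hj
  refine (j1 j hj).trans ?_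
  have hwp := weight_pos p (P (x t))
  have h2 : d * w₀ + 4 * c ≤ (d + 4 * c) * w₀ := by nlinarith
  have h3 : weight p (P (x t)) * w₀ ^ j ≤ 1 := weight_mul_sqrt_pow_le_one (by omega) _
  have h4 : (d + 4 * c) ^ j ≤ (d + 4 * c) ^ p := pow_le_pow_right₀ (by linarith) (hj.trans hn)
  calc _ ≤ ε * (Cw * weight p (P (x t))) * ((d + 4 * c) * w₀) ^ j := by gcongr
    _ = ε * Cw * (d + 4 * c) ^ j * (weight p (P (x t)) * w₀ ^ j) := by rw [mul_pow]; ring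
    _ ≤ ε * Cw * (d + 4 * c) ^ p * 1 := by gcongr
    _ = _ := by ring

/-- The control signal and its derivatives are as small as the jet gains of the single feedbacks,
with a factor that does not depend on these. -/
theorem exists_norm_iteratedDerivWithin_cascade_le (ha : ∀ i j, j < i → a i j = 0)
    [∀ i, CompleteSpace (X i)] (β : ∀ i, Fin q → X i) (p : ℕ) :
    ∃ C : ℝ, 0 < C ∧ ∀ ε, 0 < ε → ε * C ≤ 1 → ∀ κ : ∀ k : Fin q, X k.succ → ℝ,
      (∀ k, ContDiff ℝ ∞ (κ k)) → (∀ k, HasJetGain (a k.succ k.succ) p (κ k) ε) →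
      ∀ x : ℝ → PiLp 2 X,
      IsSolution (fun _ x => drift a x + inputMap β (cascadeFeedback p κ x)) x →
      ∀ j ≤ p, ∀ t, 0 ≤ t →
        ‖iteratedDerivWithin j (fun s => cascadeFeedback p κ (x s)) (Ici 0) t‖ ≤ ε * C := by
  choose C hC hstep using exists_jetBound_cascade_step (X := X) ha β p
  have hCs : 0 ≤ ∑ k, C k := Finset.sum_nonneg fun k _ => (hC k).le
  refine ⟨∑ k, C k + 1, by positivity, fun ε hε hεC κ cκ hκ x hx => ?_⟩
  have cμ : ContDiff ℝ ∞ (cascadeFeedback p κ) := contDiff_cascadeFeedback cκ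
  have hG : ContDiff ℝ ∞ fun x => drift a x + inputMap β (cascadeFeedback p κ x) :=
    (drift a).contDiff.add ((inputMap β).contDiff.comp cμ)
  have cx := IsSolution.contDiffOn hG hx
  have cU : ContDiffOn ℝ ∞ (fun s => cascadeFeedback p κ (x s)) (Ici 0) := cμ.comp_contDiffOn cx
  intro j
  induction j using Nat.strong_induction_on with
  | _ j ih =>
  intro hj t ht
  refine (PiLp.norm_le_sum _).trans ?_
  calc _ ≤ ∑ k, ε * C k := Finset.sum_le_sum fun k _ => by
        have h1 := hstep k ε hε (κ k) (cκ k) (hκ k) x _ cx cU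
          (fun s hs => IsSolution.hasDerivWithinAt hG.continuous hx hs) j hj t ht
          (fun i hi => (ih i hi (hi.le.trans hj) t ht).trans hεC) j le_rfl
        rw [one_pow, mul_one] at h1
        have h2 := iteratedDerivWithin_clm_comp ht cU (EuclideanSpace.proj (𝕜 := ℝ) k) j
        exact (congrArg norm h2).symm.le.trans h1
    _ = ε * ∑ k, C k := by rw [Finset.mul_sum]
    _ ≤ _ := by gcongr; linarith

end CascadeJets

/-! ### Asymptotic gain of a cascade -/

section CascadeGain

open scoped ContDiff

variable {q : ℕ} {X : Fin (q + 1) → Type} [∀ i, NormedAddCommGroup (X i)]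
  [∀ i, InnerProductSpace ℝ (X i)] [∀ i, CompleteSpace (X i)] {a : ∀ i j, X j →L[ℝ] X i}
  {β : ∀ i, Fin q → X i} {p : ℕ} {κ : ∀ k : Fin q, X k.succ → ℝ}

/-- If the blocks after the block `k` are eventually of size `N δ`, so is the block `k`, with another
`N`: the attenuation of `κ k` is a disturbance of size `δ²`. -/
theorem cascade_smallGain_step (ha : ∀ i j, j < i → a i j = 0)
    (hβ : ∀ (i : Fin (q + 1)) (k : Fin q), k.succ < i → β i k = 0)
    {C : Fin q → ℝ} (hC0 : ∀ k, 0 ≤ C k) (hC : ∀ k z, |κ k z| ≤ C k)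
    (hC' : ∀ k z, |κ k z| ≤ C k * ‖z‖) (k : Fin q)
    (hgain : HasSmallGain (a k.succ k.succ) (β k.succ k) (κ k)) {N : ℝ} (hN : 0 < N) :
    ∃ Δ N' : ℝ, 0 < Δ ∧ 0 < N' ∧ ∀ δ, 0 < δ → δ ≤ Δ → δ ≤ 1 → ∀ e x : ℝ → PiLp 2 X,
      EventuallyBoundedBy e δ →
      IsSolution (fun t x => (drift a x + inputMap β (cascadeFeedback p κ x)) + e t) x →
      (∀ᶠ t in atTop, ∀ l, k < l → ‖x t l.succ‖ ≤ N * δ) →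
      ∀ᶠ t in atTop, ‖x t k.succ‖ ≤ N' * δ := by
  obtain ⟨Δ, N', hΔ, hN', hg⟩ := hgain
  set D := ‖drift a‖ * (q * N) + ∑ l, C l * N * ‖β k.succ l‖ +
    C k * ((p + 1) * (q * N) ^ 2) * ‖β k.succ k‖ + 1 with hD
  have hS : 0 ≤ ∑ l, C l * N * ‖β k.succ l‖ :=
    Finset.sum_nonneg fun l _ => by have := hC0 l; positivity
  have hCk := hC0 k
  have hD0 : 0 < D := by positivity
  refine ⟨Δ / D, N' * D, by positivity, by positivity, fun δ hδ hδΔ hδ1 e x he hx hl => ?_⟩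
  have hDδ : D * δ ≤ Δ := by rw [mul_comm]; exact (le_div_iff₀ hD0).1 hδΔ
  have h1 := eventuallyBoundedBy_iff.1 (hg (D * δ) (by positivity) hDδ
    (fun t => drift a (tail X k.succ (x t)) k.succ +
      ∑ l ∈ Finset.Ioi k, cascadeFeedback p κ (x t) l • β k.succ l +
      (κ k (x t k.succ) * (weight p (tail X k.succ (x t)) - 1)) • β k.succ k + e t k.succ) ?_
    (fun t => x t k.succ) (hx.map (PiLp.proj (𝕜 := ℝ) 2 X k.succ) fun t _ => ?_))
  · filter_upwards [h1] with t ht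
    rwa [mul_assoc]
  · rw [eventuallyBoundedBy_iff] at he ⊢
    filter_upwards [he, hl] with t het hlt
    have htail : ‖tail X k.succ (x t)‖ ≤ q * (N * δ) :=
      norm_tail_le _ (by positivity) fun l hl => hlt l (by simpa using hl)
    have hw1 := weight_le_one p (tail X k.succ (x t))
    have hw2 := one_sub_weight_le p (tail X k.succ (x t))
    have b1 : ‖drift a (tail X k.succ (x t)) k.succ‖ ≤ ‖drift a‖ * (q * (N * δ)) :=
      (PiLp.norm_apply_le _ _).trans ((drift a).le_opNorm_of_le htail)
    have b2 : ‖∑ l ∈ Finset.Ioi k, cascadeFeedback p κ (x t) l • β k.succ l‖ ≤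
        (∑ l, C l * N * ‖β k.succ l‖) * δ := by
      rw [Finset.sum_mul]
      refine (norm_sum_le _ _).trans ((Finset.sum_le_sum fun l hl => ?_).trans
        (Finset.sum_le_sum_of_subset_of_nonneg (Finset.subset_univ _)
          fun l _ _ => by have := hC0 l; positivity))
      have hcl := hC0 l
      rw [norm_smul, cascadeFeedback_apply, norm_mul,
        Real.norm_of_nonneg (weight_pos p (tail X l.succ (x t))).le, Real.norm_eq_abs]
      calc _ ≤ |κ l (x t l.succ)| * 1 * ‖β k.succ l‖ := by
            gcongr; exact weight_le_one _ _
        _ ≤ C l * (N * δ) * 1 * ‖β k.succ l‖ := by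
            gcongr
            exact (hC' l _).trans (by gcongr; exact hlt l (by simpa using hl))
        _ = _ := by ring
    have b3 : ‖(κ k (x t k.succ) * (weight p (tail X k.succ (x t)) - 1)) • β k.succ k‖ ≤
        C k * ((p + 1) * (q * N) ^ 2) * ‖β k.succ k‖ * δ := by
      rw [norm_smul, norm_mul, norm_sub_rev, Real.norm_eq_abs, Real.norm_of_nonneg (by linarith)]
      calc _ ≤ C k * ((p + 1) * (q * (N * δ)) ^ 2) * ‖β k.succ k‖ := by
            gcongr
            · exact hC k _
            · exact hw2.trans (by gcongr)
        _ = C k * ((p + 1) * (q * N) ^ 2) * ‖β k.succ k‖ * δ * δ := by ring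
        _ ≤ C k * ((p + 1) * (q * N) ^ 2) * ‖β k.succ k‖ * δ * 1 := by gcongr
        _ = _ := mul_one _
    have b4 : ‖e t k.succ‖ ≤ δ := (PiLp.norm_apply_le _ _).trans het
    refine (norm_add_le _ _).trans ((add_le_add (norm_add₃_le.trans
      (add_le_add_three b1 b2 b3)) b4).trans ?_)
    rw [hD]
    linarith
  · change a k.succ k.succ (x t k.succ) + κ k (x t k.succ) • β k.succ k + _ =
      drift a (x t) k.succ + inputMap β (cascadeFeedback p κ (x t)) k.succ + e t k.succ
    rw [drift_apply_eq ha (x t), inputMap_apply_succ hβ, cascadeFeedback_apply, mul_sub, sub_smul,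
      mul_one]
    abel

/-- From the last block to the first, each block with index at least one is a good feedback loop, and
the block `0` a stable linear system, under a disturbance of size `δ`. -/
theorem cascade_smallGain (ha : ∀ i j, j < i → a i j = 0)
    (hβ : ∀ (i : Fin (q + 1)) (k : Fin q), k.succ < i → β i k = 0)
    (h0 : ∃ C : ℝ, 0 < C ∧ ∀ η, 0 < η → ∀ e, EventuallyBoundedBy e η → ∀ x,
      IsSolution (fun t x => a 0 0 x + e t) x → EventuallyBoundedBy x (C * η))
    (hκ : ∀ k, BoundedLipschitz (κ k)) (hκ0 : ∀ k, κ k 0 = 0)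
    (hgain : ∀ k : Fin q, HasSmallGain (a k.succ k.succ) (β k.succ k) (κ k)) :
    ∃ Δ N : ℝ, 0 < Δ ∧ 0 < N ∧ ∀ δ, 0 < δ → δ ≤ Δ → ∀ e : ℝ → PiLp 2 X,
      EventuallyBoundedBy e δ → ∀ x,
      IsSolution (fun t x => (drift a x + inputMap β (cascadeFeedback p κ x)) + e t) x →
      EventuallyBoundedBy x (N * δ) := by
  choose C hC0 hC hL using hκ
  have hC' : ∀ k z, |κ k z| ≤ C k * ‖z‖ := fun k z => by
    simpa [hκ0 k] using hL k z 0
  -- downward induction over the blocks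
  have key : ∀ j ≤ q, ∃ Δ N : ℝ, 0 < Δ ∧ Δ ≤ 1 ∧ 0 < N ∧ ∀ δ, 0 < δ → δ ≤ Δ →
      ∀ e x : ℝ → PiLp 2 X, EventuallyBoundedBy e δ →
      IsSolution (fun t x => (drift a x + inputMap β (cascadeFeedback p κ x)) + e t) x →
      ∀ᶠ t in atTop, ∀ l : Fin q, q ≤ l + j → ‖x t l.succ‖ ≤ N * δ := by
    intro j
    induction j with
    | zero => exact fun _ => ⟨1, 1, one_pos, le_rfl, one_pos, fun δ _ _ e x _ _ =>
        Eventually.of_forall fun t l hl => absurd l.2 (by omega)⟩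
    | succ j ih =>
      intro hj
      obtain ⟨Δ, N, hΔ, hΔ1, hN, h⟩ := ih (by omega)
      set k : Fin q := ⟨q - (j + 1), by omega⟩ with hk
      obtain ⟨Δ', N', hΔ', hN', h'⟩ := cascade_smallGain_step (p := p) ha hβ hC0 hC hC' k
        (hgain k) hN
      refine ⟨min Δ Δ', max N N', lt_min hΔ hΔ', (min_le_left _ _).trans hΔ1, by positivity,
        fun δ hδ hδΔ e x he hx => ?_⟩
      have h1 := h δ hδ (hδΔ.trans (min_le_left _ _)) e x he hx
      have h2 := h' δ hδ (hδΔ.trans (min_le_right _ _))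
        ((hδΔ.trans (min_le_left _ _)).trans hΔ1) e x he hx (by
          filter_upwards [h1] with t ht l hl
          have : q - (j + 1) < l := hl
          exact ht l (by omega))
      filter_upwards [h1, h2] with t ht1 ht2 l hl
      by_cases hlj : q ≤ l + j
      · exact (ht1 l hlj).trans (by gcongr; exact le_max_left _ _)
      · have : l = k := Fin.ext (by simp only [hk]; omega)
        rw [this]
        exact ht2.trans (by gcongr; exact le_max_right _ _)
  obtain ⟨Δ, N, hΔ, -, hN, h⟩ := key q le_rfl
  obtain ⟨C₀, hC₀, hH⟩ := h0
  set D := ‖drift a‖ * (q * N) + ∑ l, C l * N * ‖β 0 l‖ + 1 with hD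
  have hS : 0 ≤ ∑ l, C l * N * ‖β 0 l‖ :=
    Finset.sum_nonneg fun l _ => by have := hC0 l; positivity
  have hD0 : 0 < D := by positivity
  refine ⟨Δ, C₀ * D + q * N, hΔ, by positivity, fun δ hδ hδΔ e he x hx => ?_⟩
  have h1 := h δ hδ hδΔ e x he hx
  have h2 := eventuallyBoundedBy_iff.1 (hH (D * δ) (by positivity)
    (fun t => drift a (tail X 0 (x t)) 0 + inputMap β (cascadeFeedback p κ (x t)) 0 + e t 0) ?_
    (fun t => x t 0) (hx.map (PiLp.proj (𝕜 := ℝ) 2 X 0) fun t _ => ?_))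
  · rw [eventuallyBoundedBy_iff]
    filter_upwards [h1, h2] with t ht1 ht2
    refine (PiLp.norm_le_sum _).trans ?_
    rw [Fin.sum_univ_succ]
    have h3 : ∑ l : Fin q, ‖x t l.succ‖ ≤ ∑ _l : Fin q, N * δ :=
      Finset.sum_le_sum fun l _ => ht1 l (by omega)
    rw [Finset.sum_const, Finset.card_univ, Fintype.card_fin, nsmul_eq_mul] at h3
    linarith
  · rw [eventuallyBoundedBy_iff] at he ⊢
    filter_upwards [he, h1] with t het ht1
    have b1 : ‖drift a (tail X 0 (x t)) 0‖ ≤ ‖drift a‖ * (q * (N * δ)) :=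
      (PiLp.norm_apply_le _ _).trans ((drift a).le_opNorm_of_le
        (norm_tail_le _ (by positivity) fun l _ => ht1 l (by omega)))
    have b2 : ‖inputMap β (cascadeFeedback p κ (x t)) 0‖ ≤ (∑ l, C l * N * ‖β 0 l‖) * δ := by
      rw [inputMap_apply, Finset.sum_mul]
      refine (norm_sum_le _ _).trans (Finset.sum_le_sum fun l _ => ?_)
      have hcl := hC0 l
      rw [norm_smul, cascadeFeedback_apply, norm_mul,
        Real.norm_of_nonneg (weight_pos p (tail X l.succ (x t))).le, Real.norm_eq_abs]
      calc _ ≤ |κ l (x t l.succ)| * 1 * ‖β 0 l‖ := by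
            gcongr; exact weight_le_one _ _
        _ ≤ C l * (N * δ) * 1 * ‖β 0 l‖ := by
            gcongr
            exact (hC' l _).trans (by gcongr; exact ht1 l (by omega))
        _ = _ := by ring
    have b4 : ‖e t 0‖ ≤ δ := (PiLp.norm_apply_le _ _).trans het
    refine norm_add₃_le.trans ((add_le_add_three b1 b2 b4).trans ?_)
    rw [hD]
    linarith
  · change a 0 0 (x t 0) + _ =
      drift a (x t) 0 + inputMap β (cascadeFeedback p κ (x t)) 0 + e t 0
    rw [drift_apply_eq ha (x t)]
    abel

end CascadeGain

/-! ### Block systems as cascades -/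

section BlockSystem

variable {q : ℕ} {n : Fin (q + 1) → ℕ}

/-- The blocks of a block matrix as operators. -/
noncomputable def blockOperator (A : (i j : Fin (q + 1)) → Matrix (Fin (n i)) (Fin (n j)) ℝ)
    (i j : Fin (q + 1)) : EuclideanSpace ℝ (Fin (n j)) →L[ℝ] EuclideanSpace ℝ (Fin (n i)) :=
  LinearMap.toContinuousLinearMap (Matrix.toEuclideanLin (A i j))

theorem closedLoop_blockSystem (A : (i j : Fin (q + 1)) → Matrix (Fin (n i)) (Fin (n j)) ℝ)
    (b : (i : Fin (q + 1)) → Fin q → Fin (n i) → ℝ)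
    (ν : BlockState n → EuclideanSpace ℝ (Fin q)) :
    closedLoop (blockSystem A b) ν = fun x =>
      drift (blockOperator A) x + inputMap (fun i k => WithLp.toLp 2 (b i k)) (ν x) := by
  funext x
  ext1 i
  change WithLp.toLp 2 (∑ j, (A i j).mulVec (x j).ofLp + ∑ k, ν x k • b i k) =
    drift (blockOperator A) x i + inputMap (fun i k => WithLp.toLp 2 (b i k)) (ν x) i
  rw [drift_apply, inputMap_apply, WithLp.toLp_add, WithLp.toLp_sum, WithLp.toLp_sum]
  rfl

theorem nestedFeedback_eq_cascadeFeedback (p : ℕ)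
    (κ : (k : Fin q) → EuclideanSpace ℝ (Fin (n k.succ)) → ℝ) :
    nestedFeedback p κ = cascadeFeedback p κ := by
  funext x
  ext1 k
  rw [cascadeFeedback_apply, weight, norm_sq_tail, ← div_eq_mul_inv]
  rfl

end BlockSystem

theorem theorem2 (p : ℕ) (R : Fin (p + 1) → ℝ) (hR : ∀ j, 0 < R j)
    (q : ℕ) (n : Fin (q + 1) → ℕ)
    (A : (i j : Fin (q + 1)) → Matrix (Fin (n i)) (Fin (n j)) ℝ)
    (b : (i : Fin (q + 1)) → Fin q → Fin (n i) → ℝ)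
    (hAb : IsReducedControllabilityForm A b) :
    ∃ κ : (k : Fin q) → EuclideanSpace ℝ (Fin (n k.succ)) → ℝ,
      (∀ k : Fin q,
        IsPBounded (singleInputSystem (A k.succ k.succ) (b k.succ k)) p (κ k) ∧
        IsSISSLStabilizing (singleInputSystem (A k.succ k.succ) (b k.succ k)) (κ k)) ∧
      IsPBoundedBy (blockSystem A b) p R (nestedFeedback p κ) ∧
      IsSISSLStabilizing (blockSystem A b) (nestedFeedback p κ) := by
  set a := blockOperator A with ha_def
  have ha : ∀ i j, j < i → a i j = 0 := fun i j h => by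
    rw [ha_def, blockOperator, hAb.upper_A i j h, map_zero, map_zero]
  have hβ : ∀ (i : Fin (q + 1)) (k : Fin q), k.succ < i → WithLp.toLp 2 (b i k) = 0 :=
    fun i k h => by rw [hAb.upper_b i k h, WithLp.toLp_zero]
  have haa : ∀ i, a i i = Matrix.toEuclideanCLM (𝕜 := ℝ) (A i i) := fun i => rfl
  obtain ⟨C, hC, hjet⟩ := exists_norm_iteratedDerivWithin_cascade_le ha
    (fun i k => WithLp.toLp 2 (b i k)) p
  obtain ⟨j₀, hj₀⟩ := Finite.exists_min R
  set m := min 1 (R j₀) with hm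
  have hm0 : 0 < m := lt_min one_pos (hR j₀)
  have hmR : ∀ j, m ≤ R j := fun j => (min_le_right _ _).trans (hj₀ j)
  have hε : 0 < m / C := by positivity
  have hεC : m / C * C = m := div_mul_cancel₀ _ hC.ne'
  choose κ hκ using fun k : Fin q => exists_isGoodFeedback p _ _ _
    (hAb.controllable k).isReachable (hAb.critical k).isCritical hε
  have hloop := closedLoop_blockSystem A b (cascadeFeedback p κ)
  refine ⟨κ, fun k => ⟨(hκ k).isPBounded hε, (hκ k).isSISSLStabilizing⟩, ?_, ?_⟩
  all_goals rw [nestedFeedback_eq_cascadeFeedback]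
  · have cμ := contDiff_cascadeFeedback (X := fun i => EuclideanSpace ℝ (Fin (n i))) (p := p)
      fun k => (hκ k).smooth
    refine ⟨cμ.of_le (by exact_mod_cast le_top), fun x hx => ?_⟩
    rw [hloop] at hx
    have hG := (drift a).contDiff.add
      ((inputMap fun i k => WithLp.toLp 2 (b i k)).contDiff.comp cμ)
    refine ⟨(cμ.comp_contDiffOn (IsSolution.contDiffOn hG hx)).of_le (by exact_mod_cast le_top),
      fun j t ht => ?_⟩
    refine (hjet _ hε (hεC.le.trans (min_le_left _ _)) κ (fun k => (hκ k).smooth)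
      (fun k => (hκ k).jetGain) x hx j (by omega) t ht).trans ?_
    rw [hεC]
    exact hmR j
  · refine isSISSLStabilizing_of_smallGain hloop
      (exists_lipschitz_cascade _ _ fun k => (hκ k).boundedLipschitz) ?_
      (cascade_smallGain ha hβ hAb.hurwitz.exists_eventuallyBoundedBy
        (fun k => (hκ k).boundedLipschitz) (fun k => (hκ k).apply_zero) fun k => (hκ k).smallGain)
    have : cascadeFeedback (X := fun i => EuclideanSpace ℝ (Fin (n i))) p κ 0 = 0 := by
      ext1 k
      rw [cascadeFeedback_apply]
      simp [(hκ k).apply_zero]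
    rw [this, map_zero, map_zero, add_zero]
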